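/- **Setting.** An almost contact metric structure $(\varphi,\xi,\eta,\langle\,,\rangle)$ on a $(2m+1)$-dimensional smooth manifold $\tilde M$ consists of a smooth $(1,1)$-tensor field $\varphi$, a smooth vector field $\xi$, a smooth 1-form $\eta$ and a Riemannian metric with $\varphi^2=-I+\eta\otimes\xi$, $\eta(\xi)=1$ and $\langle X,Y\rangle=\langle\varphi X,\varphi Y\rangle+\eta(X)\eta(Y)$. It is a contact metric structure if $d\eta(X,Y)=\langle X,\varphi Y\rangle$, where $d\eta(X,Y)=\frac12\{X\eta(Y)-Y\eta(X)-\eta([X,Y])\}$. Put $h=\frac12\mathfrak L_\xi\varphi$ and $\tilde R(X,Y)Z=\tilde\nabla_X\tilde\nabla_YZ-\tilde\nabla_Y\tilde\nabla_XZ-\tilde\nabla_{[X,Y]}Z$, with $\tilde\nabla$ the Levi-Civita connection. For real constants $\kappa,\mu,c$, the contact metric manifold $\tilde M$ is a $(\kappa,\mu)$-contact space form $\tilde M(c)$ if $$\tilde R(X,Y)\xi=\kappa\{\eta(Y)X-\eta(X)Y\}+\mu\{\eta(Y)hX-\eta(X)hY\}$$ for all $X,Y$, and the plane spanned by $X$ and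 $\varphi X$ has sectional curvature $c$ for every unit vector $X$ orthogonal to $\xi$. Let $M$ be an $n$-dimensional Riemannian manifold isometrically immersed in $\tilde M$ with $\xi$ tangent to $M$; tangent vectors of $M$ are identified with their images. Let $\nabla$ be the Levi-Civita connection of $M$, $K$ its sectional curvature, $\tau=\sum_{i<j}K(e_i\wedge e_j)$ its scalar curvature (for any orthonormal basis $e_1,\dots,e_n$ of $T_pM$), $\sigma(X,Y)=\tilde\nabla_XY-\nabla_XY$ the second fundamental form, $H=\frac1n\operatorname{trace}\sigma$ the mean curvature vector, and $A_N$ the shape operator given by $\langle A_NX,Y\rangle=\langle\sigma(X,Y),N\rangle$. For $X$ tangent to $M$ let $PX$, $h^TX$ and $(\varphi h)^TX$ be the parts of $\varphi X$, $hX$ and $\varphi hX$ tangent to $M$, and put $\|Q\|^2=\sum_{i,j=1}^n\langle e_i,Qe_j\rangle^2$ for $Q\in\{P,h^T,(\varphi h)^T\}$. Let $\mathcal D_p$ be the orthogonal complement of $\xi$ in $T_pM$. For a plane section $\pi\subset T_pM$ with orthonormal basis $u_1,u_2$ put $\alpha(\pi)=\langle u_1,Pu_2\rangle^2$, and let $\operatorname{trace}(h|_\pi)$,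 $\det(h|_\pi)$ and $\det((\varphi h)|_\pi)$ be the trace and determinants of the $2\times2$ matrices $(\langle u_i,hu_j\rangle)$ and $(\langle u_i,\varphi hu_j\rangle)$. **Theorem 3.2.** Let $M$ be an $n$-dimensional $(n\ge3)$ Riemannian manifold isometrically immersed in a $(2m+1)$-dimensional $(\kappa,\mu)$-contact space form $\tilde M(c)$ such that $\xi$ is tangent to $M$. Then, for each point $p\in M$ and each plane section $\pi\subset\mathcal D_p$, $$\begin{aligned}\tau-K(\pi)\le{}&\frac{n^2(n-2)}{2(n-1)}\|H\|^2+\frac18n(c+3)(n-3)+(n-1)\kappa+\frac{3(c-1)}8\{\|P\|^2-2\alpha(\pi)\}\\&+(\mu+n-2)\operatorname{trace}(h^T)-\frac12\{2\operatorname{trace}(h|_\pi)+\det(h|_\pi)-\det((\varphi h)|_\pi)\}\\&+\frac14\{\|(\varphi h)^T\|^2-\|h^T\|^2-(\operatorname{trace}((\varphi h)^T))^2+(\operatorname{trace}(h^T))^2\}.\end{aligned}$$ Equality holds at $p$ (for $\pi$) if and only if there exist an orthonormal basis $e_1,\dots,e_n$ of $T_pM$ and an orthonormal basis $e_{n+1},\dots,e_{2m+1}$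 of the normal space $T_p^\perp M$ such that (a) $e_n=\xi$; (b) $\pi=\operatorname{Span}\{e_1,e_2\}$; and (c) with respect to $e_1,\dots,e_n$ the shape operators $A_r=A_{e_r}$ are $$A_{n+1}=\begin{pmatrix}a&0&0\\0&-a&0\\0&0&0_{n-2}\end{pmatrix},\qquad A_r=\begin{pmatrix}c_r&d_r&0\\d_r&-c_r&0\\0&0&0_{n-2}\end{pmatrix}\quad(r=n+2,\dots,2m+1)$$ for some real numbers $a,c_r,d_r$. (If $n=2m+1$, condition (c) is empty.) -/

import Mathlib

open Bundle Manifold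
open scoped ContDiff Manifold

noncomputable section

namespace ContactGeometry

/-- The model space `ℝᵈ`. -/
abbrev Euc (d : ℕ) : Type := EuclideanSpace ℝ (Fin d)

/-! ### Riemannian geometry in a coordinate domain

`G y` is the metric at the point with coordinates `y`; vectors are coordinate vectors. -/

section Coordinates

variable {d : ℕ}

/-- `Γ(u, v) = ∇_u v` for the coordinate-constant vector field `v` and the Levi-Civita connection
`∇` of `G`. It is the vector determined by
`G(Γ(u, v), w) = (1/2) (D_u G(v, w) + D_v G(u, w) - D_w G(u, v))` for all `w`. -/
def christoffel (G : Euc d → Euc d →L[ℝ] Euc d →L[ℝ] ℝ) (y u v : Euc d) : Euc d :=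
  (G y).inverse ((1 / 2 : ℝ) •
    (fderiv ℝ G y u v + fderiv ℝ G y v u - ((fderiv ℝ G y).flip u).flip v))

/-- The curvature tensor `R(u, v)w = ∇_u ∇_v w - ∇_v ∇_u w - ∇_[u, v] w`, computed with
coordinate-constant extensions of `u`, `v`, `w`. -/
def curvature (G : Euc d → Euc d →L[ℝ] Euc d →L[ℝ] ℝ) (y u v w : Euc d) : Euc d :=
  fderiv ℝ (fun z => christoffel G z v w) y u - fderiv ℝ (fun z => christoffel G z u w) y v
    + christoffel G y u (christoffel G y v w) - christoffel G y v (christoffel G y u w)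

/-- The sectional curvature `⟨R(u, v)v, u⟩` of the plane with orthonormal basis `u, v`. -/
def sectional (G : Euc d → Euc d →L[ℝ] Euc d →L[ℝ] ℝ) (y u v : Euc d) : ℝ :=
  G y (curvature G y u v v) u

end Coordinates

/-! ### Tensor fields on a manifold and their coordinate expressions -/

section Manifolds

variable {d : ℕ} {N : Type*} [TopologicalSpace N] [ChartedSpace (Euc d) N]

/-- Smooth Riemannian metrics on a `d`-dimensional manifold. -/
abbrev Metric (d : ℕ) (N : Type*) [TopologicalSpace N] [ChartedSpace (Euc d) N]
    [IsManifold (𝓡 d) ∞ N] :=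
  ContMDiffRiemannianMetric (𝓡 d) ∞ (Euc d) (fun x : N => TangentSpace (𝓡 d) x)

/-- The point with coordinates `y` in the chart at `x₀`. -/
def pt (x₀ : N) (y : Euc d) : N := (extChartAt (𝓡 d) x₀).symm y

/-- The tangent vector at `pt x₀ y` with components `u` in the chart at `x₀`. -/
def frame (x₀ : N) (y : Euc d) : Euc d →L[ℝ] TangentSpace (𝓡 d) (pt x₀ y) :=
  mfderiv 𝓘(ℝ, Euc d) (𝓡 d) (extChartAt (𝓡 d) x₀).symm y

/-- The components in the chart at `x₀` of a tangent vector at `pt x₀ y`. -/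
def coframe (x₀ : N) (y : Euc d) : TangentSpace (𝓡 d) (pt x₀ y) →L[ℝ] Euc d :=
  mfderiv (𝓡 d) 𝓘(ℝ, Euc d) (extChartAt (𝓡 d) x₀) (pt x₀ y)

/-- Coordinate expression of a metric in the chart at `x₀`. -/
def Metric.loc [IsManifold (𝓡 d) ∞ N] (g : Metric d N) (x₀ : N) (y : Euc d) :
    Euc d →L[ℝ] Euc d →L[ℝ] ℝ :=
  let b : Euc d →L[ℝ] Euc d →L[ℝ] ℝ := g.inner (pt x₀ y)
  let A : Euc d →L[ℝ] Euc d := frame x₀ y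
  b.bilinearComp A A

theorem Metric.loc_apply [IsManifold (𝓡 d) ∞ N] (g : Metric d N) (x₀ : N) (y u v : Euc d) :
    g.loc x₀ y u v = g.inner (pt x₀ y) (frame x₀ y u) (frame x₀ y v) := rfl

/-- The sectional curvature at `p` of the plane with orthonormal basis `u, v`. (The chart at `p`
itself is used; its differential at `p` is the identity of `TangentSpace (𝓡 d) p = ℝᵈ`.) -/
def Metric.K [IsManifold (𝓡 d) ∞ N] (g : Metric d N) (p : N) (u v : TangentSpace (𝓡 d) p) : ℝ :=
  sectional (g.loc p) (extChartAt (𝓡 d) p p) u v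

/-- `e` is an orthonormal family of tangent vectors at `p`. -/
def Metric.Orthonormal [IsManifold (𝓡 d) ∞ N] (g : Metric d N) (p : N) {k : ℕ}
    (e : Fin k → TangentSpace (𝓡 d) p) : Prop :=
  ∀ i j, g.inner p (e i) (e j) = if i = j then 1 else 0

/-- The scalar curvature `τ = ∑_{i<j} K(e_i, e_j)`, computed with the orthonormal basis `e`. -/
def Metric.scalar [IsManifold (𝓡 d) ∞ N] (g : Metric d N) (p : N)
    (e : Fin d → TangentSpace (𝓡 d) p) : ℝ :=
  ∑ i, ∑ j ∈ Finset.Ioi i, g.K p (e i) (e j)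

end Manifolds

/-! ### Contact metric structures -/

/-- Almost contact metric structures `(φ, ξ, η, ⟨ , ⟩)` on a manifold of dimension `2m+1`. -/
structure AlmostContactMetric (m : ℕ) (N : Type*) [TopologicalSpace N]
    [ChartedSpace (Euc (2 * m + 1)) N] [IsManifold (𝓡 (2 * m + 1)) ∞ N] where
  /-- the Riemannian metric -/
  g : Metric (2 * m + 1) N
  /-- the (1,1)-tensor field -/
  φ : ∀ x : N, TangentSpace (𝓡 (2 * m + 1)) x →L[ℝ] TangentSpace (𝓡 (2 * m + 1)) x
  /-- the structure vector field -/
  ξ : ∀ x : N, TangentSpace (𝓡 (2 * m + 1)) x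
  /-- the 1-form -/
  η : ∀ x : N, TangentSpace (𝓡 (2 * m + 1)) x →L[ℝ] ℝ
  smooth_φ : ContMDiff (𝓡 (2 * m + 1))
    ((𝓡 (2 * m + 1)).prod 𝓘(ℝ, Euc (2 * m + 1) →L[ℝ] Euc (2 * m + 1))) ∞
    (fun x : N => TotalSpace.mk' (Euc (2 * m + 1) →L[ℝ] Euc (2 * m + 1))
      (E := fun x : N =>
        TangentSpace (𝓡 (2 * m + 1)) x →L[ℝ] TangentSpace (𝓡 (2 * m + 1)) x) x (φ x))
  smooth_ξ : ContMDiff (𝓡 (2 * m + 1)) (𝓡 (2 * m + 1)).tangent ∞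
    (fun x : N => (⟨x, ξ x⟩ : TangentBundle (𝓡 (2 * m + 1)) N))
  smooth_η : ContMDiff (𝓡 (2 * m + 1))
    ((𝓡 (2 * m + 1)).prod 𝓘(ℝ, Euc (2 * m + 1) →L[ℝ] ℝ)) ∞
    (fun x : N => TotalSpace.mk' (Euc (2 * m + 1) →L[ℝ] ℝ)
      (E := fun x : N => TangentSpace (𝓡 (2 * m + 1)) x →L[ℝ] Trivial N ℝ x) x (η x))
  φ_sq : ∀ x v, φ x (φ x v) = -v + η x v • ξ x
  η_ξ : ∀ x, η x (ξ x) = 1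
  compatible : ∀ x u v, g.inner x u v = g.inner x (φ x u) (φ x v) + η x u * η x v

namespace AlmostContactMetric

variable {m : ℕ} {N : Type*} [TopologicalSpace N]
  [ChartedSpace (Euc (2 * m + 1)) N] [IsManifold (𝓡 (2 * m + 1)) ∞ N]
  (S : AlmostContactMetric m N)

/-- Coordinate expression of `φ` in the chart at `x₀`. -/
def φLoc (x₀ : N) (y : Euc (2 * m + 1)) : Euc (2 * m + 1) →L[ℝ] Euc (2 * m + 1) :=
  ((coframe x₀ y).comp (S.φ (pt x₀ y))).comp (frame x₀ y)

/-- Coordinate expression of `ξ` in the chart at `x₀`. -/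
def ξLoc (x₀ : N) (y : Euc (2 * m + 1)) : Euc (2 * m + 1) := coframe x₀ y (S.ξ (pt x₀ y))

/-- Coordinate expression of `η` in the chart at `x₀`. -/
def ηLoc (x₀ : N) (y : Euc (2 * m + 1)) : Euc (2 * m + 1) →L[ℝ] ℝ :=
  (S.η (pt x₀ y)).comp (frame x₀ y)

/-- Coordinate expression of `h = (1/2) 𝔏_ξ φ`. For a coordinate-constant field `v`,
`(𝔏_ξ φ) v = [ξ, φ v] - φ [ξ, v] = (D_ξ φ) v - D_{φ v} ξ + φ (D_v ξ)`. -/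
def hLoc (x₀ : N) (y : Euc (2 * m + 1)) : Euc (2 * m + 1) →L[ℝ] Euc (2 * m + 1) :=
  (1 / 2 : ℝ) • (fderiv ℝ (S.φLoc x₀) y (S.ξLoc x₀ y)
    - (fderiv ℝ (S.ξLoc x₀) y).comp (S.φLoc x₀ y)
    + (S.φLoc x₀ y).comp (fderiv ℝ (S.ξLoc x₀) y))

/-- The tensor `h` at the point `q` (by means of the chart at `q`, whose differential at `q` is the
identity). -/
def h (q : N) : TangentSpace (𝓡 (2 * m + 1)) q →L[ℝ] TangentSpace (𝓡 (2 * m + 1)) q :=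
  S.hLoc q (extChartAt (𝓡 (2 * m + 1)) q q)

/-- Contact metric structures: `dη = Φ`, where `Φ(u, v) = ⟨u, φ v⟩` and
`dη(X, Y) = (1/2) (X (η Y) - Y (η X) - η [X, Y])`, in the coordinates of each chart. -/
def IsContactMetric : Prop :=
  ∀ x₀ : N, ∀ y ∈ (extChartAt (𝓡 (2 * m + 1)) x₀).target, ∀ u v : Euc (2 * m + 1),
    (1 / 2 : ℝ) * (fderiv ℝ (S.ηLoc x₀) y u v - fderiv ℝ (S.ηLoc x₀) y v u) =
      S.g.loc x₀ y u (S.φLoc x₀ y v)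

/-- The vector with components `z` at the point with coordinates `y` in the chart at `x₀` belongs
to the `(κ, μ)`-nullity distribution. -/
def InNullity (κ μ : ℝ) (x₀ : N) (y z : Euc (2 * m + 1)) : Prop :=
  ∀ u v : Euc (2 * m + 1), curvature (S.g.loc x₀) y u v z =
    κ • (S.g.loc x₀ y v z • u - S.g.loc x₀ y u z • v)
      + μ • (S.g.loc x₀ y v z • S.hLoc x₀ y u - S.g.loc x₀ y u z • S.hLoc x₀ y v)

/-- `(κ, μ)`-contact metric manifolds: contact metric manifolds with `ξ ∈ N(κ, μ)`. -/
def IsKappaMuContact (κ μ : ℝ) : Prop :=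
  S.IsContactMetric ∧
    ∀ x₀ : N, ∀ y ∈ (extChartAt (𝓡 (2 * m + 1)) x₀).target, S.InNullity κ μ x₀ y (S.ξLoc x₀ y)

/-- `(κ, μ)`-contact space forms: `(κ, μ)`-contact metric manifolds of constant `φ`-sectional
curvature `c`, i.e. the plane spanned by `u` and `φ u` has sectional curvature `c` for every unit
vector `u` orthogonal to `ξ`. -/
def IsKappaMuSpaceForm (κ μ c : ℝ) : Prop :=
  S.IsKappaMuContact κ μ ∧
    ∀ x₀ : N, ∀ y ∈ (extChartAt (𝓡 (2 * m + 1)) x₀).target, ∀ u : Euc (2 * m + 1),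
      S.g.loc x₀ y u u = 1 → S.g.loc x₀ y u (S.ξLoc x₀ y) = 0 →
        sectional (S.g.loc x₀) y u (S.φLoc x₀ y u) = c

end AlmostContactMetric

/-! ### Submanifolds tangent to the structure vector field -/

/-- `n`-dimensional Riemannian manifolds `M` isometrically immersed by `f` in `N`, such that `ξ` is
tangent to `M`. (`f` is an immersion because it preserves the metrics.) -/
structure Submanifold {m : ℕ} {N : Type*} [TopologicalSpace N]
    [ChartedSpace (Euc (2 * m + 1)) N] [IsManifold (𝓡 (2 * m + 1)) ∞ N]
    (S : AlmostContactMetric m N) (n : ℕ) (M : Type*) [TopologicalSpace M]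
    [ChartedSpace (Euc n) M] [IsManifold (𝓡 n) ∞ M] where
  /-- the metric of `M` -/
  g : Metric n M
  /-- the immersion -/
  f : M → N
  smooth : ContMDiff (𝓡 n) (𝓡 (2 * m + 1)) ∞ f
  isometric : ∀ (x : M) (u v : TangentSpace (𝓡 n) x),
    S.g.inner (f x) (mfderiv (𝓡 n) (𝓡 (2 * m + 1)) f x u) (mfderiv (𝓡 n) (𝓡 (2 * m + 1)) f x v)
      = g.inner x u v
  ξ_tangent : ∀ x : M, ∃ v : TangentSpace (𝓡 n) x,
    mfderiv (𝓡 n) (𝓡 (2 * m + 1)) f x v = S.ξ (f x)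

namespace Submanifold

variable {m : ℕ} {N : Type*} [TopologicalSpace N]
  [ChartedSpace (Euc (2 * m + 1)) N] [IsManifold (𝓡 (2 * m + 1)) ∞ N]
  {S : AlmostContactMetric m N} {n : ℕ} {M : Type*} [TopologicalSpace M]
  [ChartedSpace (Euc n) M] [IsManifold (𝓡 n) ∞ M] (F : Submanifold S n M)

/-- The differential of the immersion. -/
def df (p : M) : TangentSpace (𝓡 n) p →L[ℝ] TangentSpace (𝓡 (2 * m + 1)) (F.f p) :=
  mfderiv (𝓡 n) (𝓡 (2 * m + 1)) F.f p

/-- The tangential part of a vector `w` of the ambient space at a point of `M`: the vector `wᵀ`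
tangent to `M` with `⟨wᵀ, v⟩ = ⟨w, df v⟩` for all `v` tangent to `M`. -/
def tangential (p : M) (w : TangentSpace (𝓡 (2 * m + 1)) (F.f p)) : TangentSpace (𝓡 n) p :=
  (F.g.inner p).inverse ((S.g.inner (F.f p) w).comp (F.df p))

/-- `P X`, the tangential part of `φ X`. -/
def P (p : M) (v : TangentSpace (𝓡 n) p) : TangentSpace (𝓡 n) p :=
  F.tangential p (S.φ (F.f p) (F.df p v))

/-- `hᵀ X`, the tangential part of `h X`. -/
def hT (p : M) (v : TangentSpace (𝓡 n) p) : TangentSpace (𝓡 n) p :=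
  F.tangential p (S.h (F.f p) (F.df p v))

/-- `(φ h)ᵀ X`, the tangential part of `φ h X`. -/
def φhT (p : M) (v : TangentSpace (𝓡 n) p) : TangentSpace (𝓡 n) p :=
  F.tangential p (S.φ (F.f p) (S.h (F.f p) (F.df p v)))

/-- The matrix `⟨e_i, Q e_j⟩` of (the compression of) an operator `Q` on `T_pM` with respect to the
orthonormal family `e` (a basis of `T_pM`, or of a plane section). -/
def opMatrix (p : M) (Q : TangentSpace (𝓡 n) p → TangentSpace (𝓡 n) p) {k : ℕ}
    (e : Fin k → TangentSpace (𝓡 n) p) : Matrix (Fin k) (Fin k) ℝ :=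
  Matrix.of fun i j => F.g.inner p (e i) (Q (e j))

/-- `‖Q‖² = ∑_{i,j} ⟨e_i, Q e_j⟩²`. -/
def opNormSq (p : M) (Q : TangentSpace (𝓡 n) p → TangentSpace (𝓡 n) p)
    (e : Fin n → TangentSpace (𝓡 n) p) : ℝ :=
  ∑ i, ∑ j, (F.opMatrix p Q e i j) ^ 2

/-- `f` in the charts at `p` and at `f p`. -/
def fLoc (p : M) (y : Euc n) : Euc (2 * m + 1) :=
  extChartAt (𝓡 (2 * m + 1)) (F.f p) (F.f ((extChartAt (𝓡 n) p).symm y))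

/-- The second fundamental form at `p`, by the Gauss formula `σ(u, v) = ∇̃_u v - ∇_u v`, where the
vector `v` is extended to a vector field on `M` that is constant in the coordinates at `p`. -/
def σ (p : M) (u v : TangentSpace (𝓡 n) p) : TangentSpace (𝓡 (2 * m + 1)) (F.f p) :=
  let y : Euc n := extChartAt (𝓡 n) p p
  let u' : Euc n := u
  let v' : Euc n := v
  let D : Euc n → Euc n →L[ℝ] Euc (2 * m + 1) := fderiv ℝ (F.fLoc p)
  (fderiv ℝ (fun z => D z v') y u'
      + christoffel (S.g.loc (F.f p)) (F.fLoc p y) (D y u') (D y v'))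
    - D y (christoffel (F.g.loc p) y u' v')

/-- The mean curvature vector `H = (1/n) trace σ`, computed with the orthonormal basis `e`. -/
def meanCurvature (p : M) (e : Fin n → TangentSpace (𝓡 n) p) :
    TangentSpace (𝓡 (2 * m + 1)) (F.f p) :=
  (1 / n : ℝ) • ∑ i, F.σ p (e i) (e i)

/-- `‖H‖²`. -/
def meanCurvatureSq (p : M) (e : Fin n → TangentSpace (𝓡 n) p) : ℝ :=
  S.g.inner (F.f p) (F.meanCurvature p e) (F.meanCurvature p e)

/-- The matrix with respect to the orthonormal basis `e` of the shape operator `A_ν`, which is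
given by `⟨A_ν X, Y⟩ = ⟨σ(X, Y), ν⟩`. -/
def shapeMatrix (p : M) (e : Fin n → TangentSpace (𝓡 n) p)
    (ν : TangentSpace (𝓡 (2 * m + 1)) (F.f p)) : Matrix (Fin n) (Fin n) ℝ :=
  Matrix.of fun i j => S.g.inner (F.f p) (F.σ p (e i) (e j)) ν

/-- `ν` is an orthonormal basis of the normal space of `M` at `p`. -/
def IsNormalFrame (p : M) (ν : Fin (2 * m + 1 - n) → TangentSpace (𝓡 (2 * m + 1)) (F.f p)) :
    Prop :=
  S.g.Orthonormal (F.f p) ν ∧ ∀ r v, S.g.inner (F.f p) (ν r) (F.df p v) = 0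

end Submanifold

/-- The `n × n` matrix with upper left block `(c, d; d, -c)` and all other entries `0`. -/
def blockMatrix (n : ℕ) (c d : ℝ) : Matrix (Fin n) (Fin n) ℝ :=
  Matrix.of fun i j =>
    if i.val = 0 ∧ j.val = 0 then c
    else if i.val = 1 ∧ j.val = 1 then -c
    else if (i.val = 0 ∧ j.val = 1) ∨ (i.val = 1 ∧ j.val = 0) then d
    else 0

end ContactGeometry

end

open ContactGeometry

/-!
The inequality is the Gauss equation, summed over an orthonormal basis of `T_pM`, followed by an
algebraic inequality for the second fundamental form `σ`.

*The ambient curvature.* A contact metric structure satisfies `∇_X ξ = -φ X - φ h X`, where `h` is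
symmetric and anticommutes with `φ` (`IsKappaMuOn.grad_eq`). The nullity condition evaluates
`R(X, ξ)ξ` and gives `(φ h)² = (1 - κ) (I - η ⊗ ξ)` (`IsKappaMuOn.symGrad_sq`); with the eigenspaces of
`φ h` it follows that `(∇_X φ) Y = ⟨X + h X, Y⟩ ξ - η(Y) (X + h X)` (`IsKappaMuOn.covEnd_φ_eq`). The Ricci
identity for `φ` then says how `R` behaves under `φ`, and subtracting an explicit tensor from `R`
leaves a Kähler type curvature tensor on `ξ^⊥` that vanishes on all planes spanned by `X`, `φ X`. Such
a tensor vanishes (`sectional_eq_zero_of_holomorphic`). Thus the constants `κ`, `μ`, `c` determine the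
curvature of every plane (`IsKappaMuOn.form_curv_self_eq`).

*The sum.* With the Gauss equation (`IsIsometricOn.gauss`), `τ - K(π)` becomes the right hand side of
the inequality minus the defect
`(1/2) (∑ |σ(e_i, e_j)|² - |tr σ|² / (n - 1)) + ⟨σ(u, u), σ(v, v)⟩ - |σ(u, v)|²` of `σ`, where `u`, `v`
is an orthonormal basis of `π` (`IsIsometricOn.scalar_sub_sectional_eq`).

*The defect.* Since `∇̃_ξ ξ = 0` and `ξ` is tangent to `M`, `σ(ξ, ξ) = 0`
(`IsIsometricOn.sffL_structure_eq_zero`). In an orthonormal basis with `π = Span {e_1, e_2}` and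
`e_n = ξ` the trace of `σ` is therefore the sum of the `n - 2` vectors `σ(e_1, e_1) + σ(e_2, e_2)` and
`σ(e_i, e_i)`, `3 ≤ i < n`, and the Cauchy-Schwarz inequality shows that the defect is nonnegative. It
vanishes exactly if `σ(e_1, e_1) + σ(e_2, e_2) = 0` and `σ(e_i, ·) = 0` for `i ≥ 3`
(`defect_adapted`); a rotation of `e_1`, `e_2` diagonalizes one more shape operator
(`defect_nonneg_and_eq_zero_iff`).

All local computations take place in coordinate domains of normed spaces, with the metric a smooth
function with values in bilinear forms. Smooth sections of the bundles are translated into such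
functions by means of the charts at `p` and at `f p`, whose differentials at these points are the
identity.
-/

noncomputable section

namespace ContactGeometry

-- spaces of bilinear maps with values in spaces of linear maps need a deeper instance search
set_option maxSynthPendingDepth 3
set_option linter.unusedSectionVars false

/-! ### The Levi-Civita connection along a map of coordinate domains -/

section Connection

variable {E E' : Type*} [NormedAddCommGroup E] [NormedSpace ℝ E]
  [NormedAddCommGroup E'] [NormedSpace ℝ E']

/-- `G` is a smooth Riemannian metric on the open set `U`. -/
structure IsMetricOn (G : E → E →L[ℝ] E →L[ℝ] ℝ) (U : Set E) : Prop where
  isOpen : IsOpen U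
  smooth : ContDiffOn ℝ ∞ G U
  symm : ∀ y ∈ U, ∀ u v, G y u v = G y v u
  pos : ∀ y ∈ U, ∀ u, u ≠ 0 → 0 < G y u u

/-- The Levi-Civita connection of `G`: `conn G y u v = ∇_u v` for constant vector fields `v`, as a
continuous bilinear map. -/
def conn (G : E → E →L[ℝ] E →L[ℝ] ℝ) (y : E) : E →L[ℝ] E →L[ℝ] E :=
  (ContinuousLinearMap.compL ℝ E (E →L[ℝ] ℝ) E (G y).inverse).comp
    ((1 / 2 : ℝ) • (fderiv ℝ G y + (fderiv ℝ G y).flip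
      - ((ContinuousLinearMap.flipₗᵢ ℝ E E ℝ).toContinuousLinearEquiv :
          (E →L[ℝ] E →L[ℝ] ℝ) →L[ℝ] (E →L[ℝ] E →L[ℝ] ℝ)).comp (fderiv ℝ G y).flip))

/-- The curvature tensor of `G`, for coordinate-constant vector fields. The derivative of `conn G` is
taken before its arguments are filled in, so that linearity in `u`, `v`, `w` is built in. -/
def curv (G : E → E →L[ℝ] E →L[ℝ] ℝ) (y u v w : E) : E :=
  fderiv ℝ (conn G) y u v w - fderiv ℝ (conn G) y v u w
    + conn G y u (conn G y v w) - conn G y v (conn G y u w)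

variable [FiniteDimensional ℝ E] {G : E → E →L[ℝ] E →L[ℝ] ℝ} {U : Set E}

/-- A positive definite form on a finite-dimensional space is invertible as a map to the dual, so that
`ContinuousLinearMap.inverse` is not the junk value `0` there. -/
theorem exists_equiv_of_pos {V : Type*} [NormedAddCommGroup V] [NormedSpace ℝ V]
    [FiniteDimensional ℝ V] (b : V →L[ℝ] V →L[ℝ] ℝ)
    (pos : ∀ u, u ≠ 0 → 0 < b u u) : ∃ e : V ≃L[ℝ] (V →L[ℝ] ℝ), (e : V →L[ℝ] V →L[ℝ] ℝ) = b := by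
  have hinj : Function.Injective (b : V →ₗ[ℝ] V →L[ℝ] ℝ) := by
    rw [← LinearMap.ker_eq_bot, LinearMap.ker_eq_bot']
    intro u hu
    by_contra h
    have h1 := pos u h
    have h2 : b u = 0 := hu
    simp [h2] at h1
  have hfin : Module.finrank ℝ V = Module.finrank ℝ (V →L[ℝ] ℝ) := by
    rw [← LinearEquiv.finrank_eq (LinearMap.toContinuousLinearMap (𝕜 := ℝ) (E := V) (F' := ℝ))]
    exact (Subspace.dual_finrank_eq (K := ℝ) (V := V)).symm
  refine ⟨(LinearEquiv.ofInjectiveOfFinrankEq (b : V →ₗ[ℝ] V →L[ℝ] ℝ) hinj hfin).toContinuousLinearEquiv, ?_⟩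
  ext u v
  rfl

theorem apply_inverse_of_pos {V : Type*} [NormedAddCommGroup V] [NormedSpace ℝ V]
    [FiniteDimensional ℝ V] (b : V →L[ℝ] V →L[ℝ] ℝ)
    (pos : ∀ u, u ≠ 0 → 0 < b u u) (l : V →L[ℝ] ℝ) : b (b.inverse l) = l := by
  obtain ⟨e, rfl⟩ := exists_equiv_of_pos b pos
  simp [ContinuousLinearMap.inverse_equiv]

/-- A vector is determined by its inner products. -/
theorem eq_of_form_eq {V : Type*} [NormedAddCommGroup V] [NormedSpace ℝ V]
    {b : V →L[ℝ] V →L[ℝ] ℝ} (pos : ∀ u, u ≠ 0 → 0 < b u u) {x y : V}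
    (h : ∀ z, b x z = b y z) : x = y := by
  by_contra hne
  have := pos (x - y) (sub_ne_zero.mpr hne)
  have e : b (x - y) (x - y) = b x (x - y) - b y (x - y) := by simp
  rw [e, h, sub_self] at this
  exact lt_irrefl _ this

namespace IsMetricOn

variable (hG : IsMetricOn G U) {y : E}

include hG

theorem contDiffAt (hy : y ∈ U) : ContDiffAt ℝ ∞ G y :=
  hG.smooth.contDiffAt (hG.isOpen.mem_nhds hy)

theorem eventually_mem (hy : y ∈ U) : ∀ᶠ z in nhds y, z ∈ U := hG.isOpen.mem_nhds hy

/-- The equation that defines the Levi-Civita connection. -/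
theorem form_conn (hy : y ∈ U) (u v w : E) :
    G y (conn G y u v) w =
      (1 / 2 : ℝ) * (fderiv ℝ G y u v w + fderiv ℝ G y v u w - fderiv ℝ G y w u v) := by
  have h : conn G y u v = (G y).inverse ((1 / 2 : ℝ) •
    (fderiv ℝ G y u v + fderiv ℝ G y v u - ((fderiv ℝ G y).flip u).flip v)) := rfl
  rw [h, apply_inverse_of_pos _ (hG.pos y hy)]
  simp

theorem fderiv_symm (hy : y ∈ U) (u v w : E) :
    fderiv ℝ G y u v w = fderiv ℝ G y u w v := by
  have hd : DifferentiableAt ℝ G y := (hG.contDiffAt hy).differentiableAt (by simp)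
  have e1 : fderiv ℝ (fun z => G z v w) y = fderiv ℝ (fun z => G z w v) y :=
    Filter.EventuallyEq.fderiv_eq ((hG.eventually_mem hy).mono fun z hz => hG.symm z hz v w)
  have h1 : ∀ a b : E, fderiv ℝ (fun z => G z a b) y u = fderiv ℝ G y u a b := by
    intro a b
    have := ((hd.hasFDerivAt.clm_apply (hasFDerivAt_const a y)).clm_apply (hasFDerivAt_const b y))
    rw [this.fderiv]; simp
  rw [← h1, ← h1, e1]

theorem conn_symm (hy : y ∈ U) (u v : E) :
    conn G y u v = conn G y v u := by
  refine eq_of_form_eq (hG.pos y hy) fun w => ?_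
  rw [hG.form_conn hy, hG.form_conn hy, hG.fderiv_symm hy w u v]
  ring

/-- The Levi-Civita connection is compatible with the metric. -/
theorem form_conn_add (hy : y ∈ U) (u v w : E) :
    G y (conn G y u v) w + G y v (conn G y u w) = fderiv ℝ G y u v w := by
  rw [hG.symm y hy v, hG.form_conn hy, hG.form_conn hy, hG.fderiv_symm hy u w v,
    hG.fderiv_symm hy w u v]
  ring

theorem contDiffAt_conn (hy : y ∈ U) : ContDiffAt ℝ ∞ (conn G) y := by
  have h1 : ContDiffAt ℝ ∞ (fun z => (G z).inverse) y := by
    obtain ⟨e, he⟩ := exists_equiv_of_pos (G y) (hG.pos y hy)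
    have := contDiffAt_map_inverse (𝕜 := ℝ) (n := ∞) e
    rw [he] at this
    exact this.comp y (hG.contDiffAt hy)
  have h2 : ContDiffAt ℝ ∞ (fderiv ℝ G) y :=
    (hG.contDiffAt hy).fderiv_right (m := ∞) (by simp)
  have h3 : ContDiffAt ℝ ∞ (fun z => (fderiv ℝ G z).flip) y :=
    (ContinuousLinearMap.flipₗᵢ ℝ E E (E →L[ℝ] ℝ)).contDiff.contDiffAt.comp y h2
  unfold conn
  refine ContDiffAt.clm_comp ?_ ?_
  · exact (ContinuousLinearMap.contDiff _).contDiffAt.comp y h1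
  · exact ContDiffAt.const_smul (1 / 2 : ℝ) ((h2.add h3).sub (contDiffAt_const.clm_comp h3))

end IsMetricOn

/-- The covariant derivative `∇_u V` at `y` of a vector field `V` along the map `f`, for the
Levi-Civita connection of `G`. -/
def covAlong (G : E → E →L[ℝ] E →L[ℝ] ℝ) (f : E' → E) (u : E')
    (V : E' → E) (y : E') : E :=
  fderiv ℝ V y u + conn G (f y) (fderiv ℝ f y u) (V y)

section Along

variable (hG : IsMetricOn G U) {f : E' → E} {y : E'} {V W : E' → E}

include hG

/-- The Levi-Civita connection along a map is compatible with the metric. -/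
theorem fderiv_form_along (hf : DifferentiableAt ℝ f y) (hy : f y ∈ U)
    (hV : DifferentiableAt ℝ V y) (hW : DifferentiableAt ℝ W y) (u : E') :
    fderiv ℝ (fun z => G (f z) (V z) (W z)) y u =
      G (f y) (covAlong G f u V y) (W y) + G (f y) (V y) (covAlong G f u W y) := by
  have hd : DifferentiableAt ℝ G (f y) := (hG.contDiffAt hy).differentiableAt (by simp)
  have hc : HasFDerivAt (fun z => G (f z)) ((fderiv ℝ G (f y)).comp (fderiv ℝ f y)) y :=
    hd.hasFDerivAt.comp y hf.hasFDerivAt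
  have := (hc.clm_apply hV.hasFDerivAt).clm_apply hW.hasFDerivAt
  rw [this.fderiv]
  have h := hG.form_conn_add hy (fderiv ℝ f y u) (V y) (W y)
  simp only [covAlong, map_add, add_apply, ContinuousLinearMap.comp_apply,
    ContinuousLinearMap.flip_apply]
  linarith

theorem hasFDerivAt_conn_along {X : E' → E} (hf : DifferentiableAt ℝ f y)
    (hy : f y ∈ U)
    (hX : DifferentiableAt ℝ X y) (hV : DifferentiableAt ℝ V y) (u : E') :
    fderiv ℝ (fun z => conn G (f z) (X z) (V z)) y u =
      fderiv ℝ (conn G) (f y) (fderiv ℝ f y u) (X y) (V y)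
        + conn G (f y) (fderiv ℝ X y u) (V y) + conn G (f y) (X y) (fderiv ℝ V y u) := by
  have hd : DifferentiableAt ℝ (conn G) (f y) :=
    (hG.contDiffAt_conn hy).differentiableAt (by simp)
  have hc : HasFDerivAt (fun z => conn G (f z))
      ((fderiv ℝ (conn G) (f y)).comp (fderiv ℝ f y)) y :=
    hd.hasFDerivAt.comp y hf.hasFDerivAt
  have := (hc.clm_apply hX.hasFDerivAt).clm_apply hV.hasFDerivAt
  rw [this.fderiv]
  simp only [add_apply, ContinuousLinearMap.comp_apply,
    ContinuousLinearMap.flip_apply]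
  abel

theorem conn_differentiableAt {X : E' → E} (hf : DifferentiableAt ℝ f y)
    (hy : f y ∈ U)
    (hX : DifferentiableAt ℝ X y) (hV : DifferentiableAt ℝ V y) :
    DifferentiableAt ℝ (fun z => conn G (f z) (X z) (V z)) y := by
  have hd : DifferentiableAt ℝ (conn G) (f y) :=
    (hG.contDiffAt_conn hy).differentiableAt (by simp)
  have := ((hd.comp y hf).clm_apply hX).clm_apply hV
  simpa only [Function.comp_apply] using this

theorem covAlong_differentiableAt (hf : ContDiffAt ℝ ∞ f y) (hy : f y ∈ U)
    (hV : ContDiffAt ℝ ∞ V y) (u : E') : DifferentiableAt ℝ (covAlong G f u V) y := by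
  have hf' : DifferentiableAt ℝ (fun z => fderiv ℝ f z u) y :=
    ((hf.fderiv_right (m := ∞) (by simp)).differentiableAt (by simp)).clm_apply
      (differentiableAt_const u)
  have hV' : DifferentiableAt ℝ (fun z => fderiv ℝ V z u) y :=
    ((hV.fderiv_right (m := ∞) (by simp)).differentiableAt (by simp)).clm_apply
      (differentiableAt_const u)
  exact hV'.add (conn_differentiableAt hG (hf.differentiableAt (by simp)) hy hf'
    (hV.differentiableAt (by simp)))

omit hG in
theorem fderiv_fderiv_apply {F' : Type*} [NormedAddCommGroup F'] [NormedSpace ℝ F']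
    {X : E' → F'} (hX : ContDiffAt ℝ ∞ X y)
    (u v : E') : fderiv ℝ (fun z => fderiv ℝ X z v) y u = fderiv ℝ (fderiv ℝ X) y u v := by
  have hX' : DifferentiableAt ℝ (fderiv ℝ X) y :=
    (hX.fderiv_right (m := ∞) (by simp)).differentiableAt (by simp)
  rw [(hX'.hasFDerivAt.clm_apply (hasFDerivAt_const v y)).fderiv]
  simp

omit hG in
theorem fderiv_fderiv_comm {F' : Type*} [NormedAddCommGroup F'] [NormedSpace ℝ F']
    {X : E' → F'} (hX : ContDiffAt ℝ ∞ X y)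
    (u v : E') : fderiv ℝ (fun z => fderiv ℝ X z v) y u =
      fderiv ℝ (fun z => fderiv ℝ X z u) y v := by
  rw [fderiv_fderiv_apply hX, fderiv_fderiv_apply hX]
  exact (hX.isSymmSndFDerivAt (by simp; exact ENat.LEInfty.out)) u v

/-- The commutator of covariant derivatives along a map is the curvature. -/
theorem covAlong_comm (hf : ContDiffAt ℝ ∞ f y) (hy : f y ∈ U)
    (hV : ContDiffAt ℝ ∞ V y) (u v : E') :
    covAlong G f u (covAlong G f v V) y - covAlong G f v (covAlong G f u V) y =
      curv G (f y) (fderiv ℝ f y u) (fderiv ℝ f y v) (V y) := by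
  have hf1 := hf.differentiableAt (by simp)
  have hV1 := hV.differentiableAt (by simp)
  have hfd : ∀ w, DifferentiableAt ℝ (fun z => fderiv ℝ f z w) y := fun w =>
    ((hf.fderiv_right (m := ∞) (by simp)).differentiableAt (by simp)).clm_apply
      (differentiableAt_const w)
  have hVd : ∀ w, DifferentiableAt ℝ (fun z => fderiv ℝ V z w) y := fun w =>
    ((hV.fderiv_right (m := ∞) (by simp)).differentiableAt (by simp)).clm_apply
      (differentiableAt_const w)
  have key : ∀ a b, covAlong G f a (covAlong G f b V) y =
      fderiv ℝ (fun z => fderiv ℝ V z b) y a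
      + (fderiv ℝ (conn G) (f y) (fderiv ℝ f y a) (fderiv ℝ f y b) (V y)
        + conn G (f y) (fderiv ℝ (fun z => fderiv ℝ f z b) y a) (V y)
        + conn G (f y) (fderiv ℝ f y b) (fderiv ℝ V y a))
      + (conn G (f y) (fderiv ℝ f y a) (fderiv ℝ V y b)
        + conn G (f y) (fderiv ℝ f y a)
          (conn G (f y) (fderiv ℝ f y b) (V y))) := by
    intro a b
    have h1 := hasFDerivAt_conn_along hG hf1 hy (hfd b) hV1 a
    have h2 := conn_differentiableAt hG hf1 hy (hfd b) hV1
    have e : covAlong G f b V = fun z => fderiv ℝ V z b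
      + conn G (f z) (fderiv ℝ f z b) (V z) := rfl
    rw [covAlong, e, fderiv_fun_add (hVd b) h2, add_apply, h1]
    simp only [map_add]
  rw [key, key, curv, fderiv_fderiv_comm hf u v,
    fderiv_fderiv_comm hV u v]
  abel

end Along

end Connection

/-! ### Symmetries of the curvature tensor -/

section Curvature

variable {E E' : Type*} [NormedAddCommGroup E] [NormedSpace ℝ E]
  [NormedAddCommGroup E'] [NormedSpace ℝ E'] [FiniteDimensional ℝ E]
  {G : E → E →L[ℝ] E →L[ℝ] ℝ} {U : Set E} {y : E}

theorem curv_antisymm (G : E → E →L[ℝ] E →L[ℝ] ℝ) (y u v w : E) :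
    curv G y u v w = -curv G y v u w := by
  simp only [curv]; abel

/-- The covariant derivative of a vector field. -/
abbrev cov (G : E → E →L[ℝ] E →L[ℝ] ℝ) (u : E) (V : E → E) (y : E) : E := covAlong G id u V y

theorem cov_apply (G : E → E →L[ℝ] E →L[ℝ] ℝ) (u : E) (V : E → E) (y : E) :
    cov G u V y = fderiv ℝ V y u + conn G y u (V y) := by
  simp [cov, covAlong]

theorem cov_const (G : E → E →L[ℝ] E →L[ℝ] ℝ) (u v y : E) :
    cov G u (fun _ => v) y = conn G y u v := by
  simp [cov_apply]

namespace IsMetricOn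

variable (hG : IsMetricOn G U) (hy : y ∈ U)
include hG hy

theorem fderiv_form {V W : E → E} (hV : DifferentiableAt ℝ V y) (hW : DifferentiableAt ℝ W y)
    (u : E) : fderiv ℝ (fun z => G z (V z) (W z)) y u =
      G y (cov G u V y) (W y) + G y (V y) (cov G u W y) :=
  fderiv_form_along hG differentiableAt_id hy hV hW u

theorem cov_comm {V : E → E} (hV : ContDiffAt ℝ ∞ V y) (u v : E) :
    cov G u (cov G v V) y - cov G v (cov G u V) y = curv G y u v (V y) := by
  simpa using covAlong_comm hG (f := id) contDiffAt_id hy hV u v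

theorem cov_differentiableAt {V : E → E} (hV : ContDiffAt ℝ ∞ V y) (u : E) :
    DifferentiableAt ℝ (cov G u V) y :=
  covAlong_differentiableAt hG contDiffAt_id hy hV u

theorem fderiv_conn_symm (u v w : E) :
    fderiv ℝ (conn G) y u v w = fderiv ℝ (conn G) y u w v := by
  have hd : DifferentiableAt ℝ (conn G) y := (hG.contDiffAt_conn hy).differentiableAt (by simp)
  have e1 : fderiv ℝ (fun z => conn G z v w) y = fderiv ℝ (fun z => conn G z w v) y :=
    Filter.EventuallyEq.fderiv_eq ((hG.eventually_mem hy).mono fun z hz => hG.conn_symm hz v w)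
  have h1 : ∀ a b : E, fderiv ℝ (fun z => conn G z a b) y u = fderiv ℝ (conn G) y u a b := by
    intro a b
    have := ((hd.hasFDerivAt.clm_apply (hasFDerivAt_const a y)).clm_apply (hasFDerivAt_const b y))
    rw [this.fderiv]; simp
  rw [← h1, ← h1, e1]

/-- The first Bianchi identity. -/
theorem curv_bianchi (u v w : E) :
    curv G y u v w + curv G y v w u + curv G y w u v = 0 := by
  simp only [curv]
  rw [hG.fderiv_conn_symm hy u w v, hG.fderiv_conn_symm hy v u w, hG.fderiv_conn_symm hy w v u,
    hG.conn_symm hy w v, hG.conn_symm hy w u, hG.conn_symm hy v u]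
  abel

/-- `⟨R(u, v)w, w⟩ = 0`, because second derivatives of `⟨w, w⟩` commute. -/
theorem form_curv_self (u v w : E) : G y (curv G y u v w) w = 0 := by
  have hW : ContDiff ℝ ∞ (fun _ : E => w) := contDiff_const
  have h1 : ∀ a, ∀ᶠ z in nhds y, fderiv ℝ (fun z => G z w w) z a
      = 2 * G z (cov G a (fun _ => w) z) w := by
    intro a
    refine (hG.eventually_mem hy).mono fun z hz => ?_
    rw [hG.fderiv_form hz (V := fun _ => w) (W := fun _ => w) (by fun_prop) (by fun_prop),
      hG.symm z hz w]
    ring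
  have h2 : ∀ a b, fderiv ℝ (fun z => fderiv ℝ (fun z => G z w w) z b) y a
      = 2 * (G y (cov G a (cov G b (fun _ => w)) y) w
        + G y (cov G b (fun _ => w) y) (cov G a (fun _ => w) y)) := by
    intro a b
    rw [(show (fun z => fderiv ℝ (fun z => G z w w) z b) =ᶠ[nhds y] _ from h1 b).fderiv_eq]
    have hd := hG.cov_differentiableAt hy (V := fun _ => w) contDiffAt_const b
    have hd2 : DifferentiableAt ℝ (fun z => G z (cov G b (fun _ => w) z) w) y :=
      (((hG.contDiffAt hy).differentiableAt (by simp)).clm_apply hd).clm_apply (by fun_prop)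
    rw [fderiv_const_mul hd2]
    have := hG.fderiv_form hy hd (W := fun _ => w) (by fun_prop) a
    simp [this]
  have hs : ContDiffAt ℝ ∞ (fun z => G z w w) y :=
    ((hG.contDiffAt hy).clm_apply contDiffAt_const).clm_apply contDiffAt_const
  have h3 := fderiv_fderiv_comm hs u v
  rw [h2, h2, hG.symm y hy (cov G v (fun _ => w) y)] at h3
  have h4 := hG.cov_comm hy (V := fun _ => w) contDiffAt_const u v
  rw [← h4, map_sub]
  simp only [sub_apply]
  linarith

theorem curv_add_right (u v w x : E) : curv G y u v (w + x) = curv G y u v w + curv G y u v x := by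
  simp only [curv, map_add]; abel

theorem form_curv_skew (u v w x : E) : G y (curv G y u v w) x = -G y (curv G y u v x) w := by
  have h1 := hG.form_curv_self hy u v (w + x)
  rw [hG.curv_add_right hy] at h1
  simp only [map_add, add_apply] at h1
  linarith [hG.form_curv_self hy u v w, hG.form_curv_self hy u v x]

/-- The pair symmetry of the curvature tensor. -/
theorem form_curv_pair (u v w x : E) : G y (curv G y u v w) x = G y (curv G y w x u) v := by
  have B : ∀ a b c e, G y (curv G y a b c) e + G y (curv G y b c a) e + G y (curv G y c a b) e = 0 := by
    intro a b c e
    have := congrArg (fun z => G y z e) (hG.curv_bianchi hy a b c)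
    simpa using this
  have A : ∀ a b c e, G y (curv G y a b c) e = -G y (curv G y b a c) e := by
    intro a b c e
    rw [curv_antisymm]; simp
  have S := hG.form_curv_skew hy
  linarith [B u v w x, B v w x u, B w x u v, B x u v w, A u v w x, A v w u x, A w u v x,
    S u v w x, S v w u x, S w u v x, A v w x u, A w x v u, A x v w u, S v w x u, S w x v u,
    S x v w u, A w x u v, A x u w v, A u w x v, S w x u v, S x u w v, S u w x v,
    A x u v w, A u v x w, A v x u w, S x u v w, S u v x w, S v x u w]

end IsMetricOn

end Curvature

/-! ### The Gauss equation for isometric immersions of coordinate domains -/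

section Gauss

variable {E E' : Type*} [NormedAddCommGroup E] [NormedSpace ℝ E]
  [NormedAddCommGroup E'] [NormedSpace ℝ E'] [FiniteDimensional ℝ E] [FiniteDimensional ℝ E']

/-- The second fundamental form of the map `f` at `y`, `σ(u, v) = ∇̃_u (df v) - df (∇_u v)`. -/
def sff (G : E → E →L[ℝ] E →L[ℝ] ℝ) (g : E' → E' →L[ℝ] E' →L[ℝ] ℝ) (f : E' → E) (y u v : E') : E :=
  covAlong G f u (fun z => fderiv ℝ f z v) y - fderiv ℝ f y (conn g y u v)

/-- `f` is an isometric immersion of the domain `U'` with metric `g` into the domain `U` with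
metric `G`. -/
structure IsIsometricOn (G : E → E →L[ℝ] E →L[ℝ] ℝ) (U : Set E)
    (g : E' → E' →L[ℝ] E' →L[ℝ] ℝ) (U' : Set E') (f : E' → E) : Prop where
  target : IsMetricOn G U
  source : IsMetricOn g U'
  smooth : ContDiffOn ℝ ∞ f U'
  mapsTo : Set.MapsTo f U' U
  isometric : ∀ z ∈ U', ∀ u v, G (f z) (fderiv ℝ f z u) (fderiv ℝ f z v) = g z u v

namespace IsIsometricOn

variable {G : E → E →L[ℝ] E →L[ℝ] ℝ} {U : Set E} {g : E' → E' →L[ℝ] E' →L[ℝ] ℝ} {U' : Set E'}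
  {f : E' → E} (h : IsIsometricOn G U g U' f) {y : E'} (hy : y ∈ U')

include h hy

theorem contDiffAt : ContDiffAt ℝ ∞ f y := h.smooth.contDiffAt (h.source.isOpen.mem_nhds hy)

theorem contDiffAt_fderiv (v : E') : ContDiffAt ℝ ∞ (fun z => fderiv ℝ f z v) y :=
  ((h.contDiffAt hy).fderiv_right (m := ∞) (by simp)).clm_apply contDiffAt_const

theorem covAlong_fderiv_symm (u v : E') :
    covAlong G f u (fun z => fderiv ℝ f z v) y = covAlong G f v (fun z => fderiv ℝ f z u) y := by
  rw [covAlong, covAlong, fderiv_fderiv_comm (h.contDiffAt hy) u v,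
    h.target.conn_symm (h.mapsTo hy)]

theorem fderiv_metric (u v w : E') : fderiv ℝ g y u v w =
    G (f y) (covAlong G f u (fun z => fderiv ℝ f z v) y) (fderiv ℝ f y w)
      + G (f y) (fderiv ℝ f y v) (covAlong G f u (fun z => fderiv ℝ f z w) y) := by
  rw [← fderiv_form_along h.target ((h.contDiffAt hy).differentiableAt (by simp)) (h.mapsTo hy)
    ((h.contDiffAt_fderiv hy v).differentiableAt (by simp))
    ((h.contDiffAt_fderiv hy w).differentiableAt (by simp))]
  have hd : DifferentiableAt ℝ g y := (h.source.contDiffAt hy).differentiableAt (by simp)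
  have e1 : (fun z => G (f z) (fderiv ℝ f z v) (fderiv ℝ f z w)) =ᶠ[nhds y] fun z => g z v w :=
    (h.source.eventually_mem hy).mono fun z hz => h.isometric z hz v w
  rw [e1.fderiv_eq]
  have := ((hd.hasFDerivAt.clm_apply (hasFDerivAt_const v y)).clm_apply (hasFDerivAt_const w y))
  rw [this.fderiv]; simp

/-- The tangential part of the ambient connection is the Levi-Civita connection. -/
theorem form_covAlong_fderiv (u v w : E') :
    G (f y) (covAlong G f u (fun z => fderiv ℝ f z v) y) (fderiv ℝ f y w)
      = g y (conn g y u v) w := by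
  rw [h.source.form_conn hy, h.fderiv_metric hy, h.fderiv_metric hy, h.fderiv_metric hy]
  rw [h.covAlong_fderiv_symm hy w u, h.covAlong_fderiv_symm hy w v, h.covAlong_fderiv_symm hy v u]
  have hs := h.target.symm (f y) (h.mapsTo hy)
  rw [hs (fderiv ℝ f y v), hs (fderiv ℝ f y u)]
  ring

theorem sff_symm (u v : E') : sff G g f y u v = sff G g f y v u := by
  rw [sff, sff, h.covAlong_fderiv_symm hy, h.source.conn_symm hy]

/-- The second fundamental form is normal. -/
theorem form_sff_fderiv (u v w : E') : G (f y) (sff G g f y u v) (fderiv ℝ f y w) = 0 := by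
  rw [sff, map_sub, sub_apply, h.form_covAlong_fderiv hy, h.isometric y hy, sub_self]

/-- The Gauss equation. -/
theorem gauss (u v w x : E') :
    g y (curv g y u v w) x =
      G (f y) (curv G (f y) (fderiv ℝ f y u) (fderiv ℝ f y v) (fderiv ℝ f y w)) (fderiv ℝ f y x)
      + G (f y) (sff G g f y v w) (sff G g f y u x)
      - G (f y) (sff G g f y u w) (sff G g f y v x) := by
  have hfy := h.mapsTo hy
  have hs := h.target.symm (f y) hfy
  -- differentiate the equation of the tangential part once more
  have key : ∀ a b, G (f y) (covAlong G f a (covAlong G f b (fun z => fderiv ℝ f z w)) y)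
        (fderiv ℝ f y x)
      + G (f y) (covAlong G f b (fun z => fderiv ℝ f z w) y)
        (covAlong G f a (fun z => fderiv ℝ f z x) y)
      = g y (cov g a (cov g b (fun _ => w)) y) x
        + g y (conn g y b w) (conn g y a x) := by
    intro a b
    rw [← fderiv_form_along h.target ((h.contDiffAt hy).differentiableAt (by simp)) hfy
      (covAlong_differentiableAt h.target (h.contDiffAt hy) hfy (h.contDiffAt_fderiv hy w) b)
      ((h.contDiffAt_fderiv hy x).differentiableAt (by simp))]
    have e2 := h.source.fderiv_form hy
      (h.source.cov_differentiableAt hy (V := fun _ => w) contDiffAt_const b) (W := fun _ => x)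
      (by fun_prop) a
    rw [cov_const, cov_const] at e2
    rw [← e2]
    refine congrArg (fun L : E' →L[ℝ] ℝ => L a) (Filter.EventuallyEq.fderiv_eq ?_)
    refine (h.source.eventually_mem hy).mono fun z hz => ?_
    simp only [cov_const]
    exact h.form_covAlong_fderiv hz b w x
  have hS : ∀ a b c e, G (f y) (covAlong G f a (fun z => fderiv ℝ f z b) y)
        (covAlong G f c (fun z => fderiv ℝ f z e) y)
      = g y (conn g y a b) (conn g y c e) + G (f y) (sff G g f y a b) (sff G g f y c e) := by
    intro a b c e
    have e1 : ∀ a b, covAlong G f a (fun z => fderiv ℝ f z b) y =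
        sff G g f y a b + fderiv ℝ f y (conn g y a b) := fun a b => by simp [sff]
    rw [e1 a b, e1 c e]
    simp only [map_add, add_apply]
    rw [h.form_sff_fderiv hy, hs (fderiv ℝ f y (conn g y a b)) (sff G g f y c e),
      h.form_sff_fderiv hy, h.isometric y hy]
    ring
  have c1 := h.source.cov_comm hy (V := fun _ => w) contDiffAt_const u v
  have c2 := covAlong_comm h.target (h.contDiffAt hy) hfy (h.contDiffAt_fderiv hy w) u v
  rw [← c1, ← c2]
  have k1 := key u v
  have k2 := key v u
  rw [hS] at k1 k2
  simp only [map_sub, sub_apply]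
  linarith

end IsIsometricOn

end Gauss

/-! ### Covariant derivatives of endomorphism fields -/

section Endomorphisms

variable {E : Type*} [NormedAddCommGroup E] [NormedSpace ℝ E] [FiniteDimensional ℝ E]
  {G : E → E →L[ℝ] E →L[ℝ] ℝ} {U : Set E} {y : E}

/-- The covariant derivative `(∇_X P) Y` of a field of endomorphisms. -/
def covEnd (G : E → E →L[ℝ] E →L[ℝ] ℝ) (P : E → E →L[ℝ] E) (y : E) : E →L[ℝ] E →L[ℝ] E :=
  fderiv ℝ P y + ((ContinuousLinearMap.compL ℝ E E E).flip (P y)).comp (conn G y)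
    - (ContinuousLinearMap.compL ℝ E E E (P y)).comp (conn G y)

theorem covEnd_apply (G : E → E →L[ℝ] E →L[ℝ] ℝ) (P : E → E →L[ℝ] E) (y X Y : E) :
    covEnd G P y X Y = fderiv ℝ P y X Y + conn G y X (P y Y) - P y (conn G y X Y) := rfl

/-- The Leibniz rule `∇_X (P V) = (∇_X P) V + P ∇_X V`. -/
theorem cov_endo {P : E → E →L[ℝ] E} {V : E → E} (hP : DifferentiableAt ℝ P y)
    (hV : DifferentiableAt ℝ V y) (X : E) :
    cov G X (fun z => P z (V z)) y = covEnd G P y X (V y) + P y (cov G X V y) := by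
  rw [cov_apply, cov_apply, covEnd_apply, (hP.hasFDerivAt.clm_apply hV.hasFDerivAt).fderiv]
  simp only [add_apply, ContinuousLinearMap.comp_apply, ContinuousLinearMap.flip_apply, map_add]
  abel

theorem covEnd_congr {P Q : E → E →L[ℝ] E} (h : P =ᶠ[nhds y] Q) : covEnd G P y = covEnd G Q y := by
  simp only [covEnd, h.fderiv_eq, h.eq_of_nhds]

theorem covEnd_comp {P Q : E → E →L[ℝ] E} (hP : DifferentiableAt ℝ P y)
    (hQ : DifferentiableAt ℝ Q y) (X Y : E) :
    covEnd G (fun z => (P z).comp (Q z)) y X Y =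
      covEnd G P y X (Q y Y) + P y (covEnd G Q y X Y) := by
  simp only [covEnd_apply]
  rw [(hP.hasFDerivAt.clm_comp hQ.hasFDerivAt).fderiv]
  simp
  abel

theorem covEnd_add {P Q : E → E →L[ℝ] E} (hP : DifferentiableAt ℝ P y)
    (hQ : DifferentiableAt ℝ Q y) (X Y : E) :
    covEnd G (fun z => P z + Q z) y X Y = covEnd G P y X Y + covEnd G Q y X Y := by
  simp only [covEnd_apply]
  rw [fderiv_fun_add hP hQ]
  simp
  abel

theorem covEnd_neg (P : E → E →L[ℝ] E) (X Y : E) :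
    covEnd G (fun z => -P z) y X Y = -covEnd G P y X Y := by
  simp only [covEnd_apply]
  rw [fderiv_fun_neg]
  simp
  abel

theorem covEnd_const_smul {P : E → E →L[ℝ] E} (hP : DifferentiableAt ℝ P y) (a : ℝ) (X Y : E) :
    covEnd G (fun z => a • P z) y X Y = a • covEnd G P y X Y := by
  simp only [covEnd_apply]
  rw [fderiv_fun_const_smul hP]
  simp [smul_sub]

theorem covEnd_id (X Y : E) :
    covEnd G (fun _ => ContinuousLinearMap.id ℝ E) y X Y = 0 := by
  simp [covEnd_apply]

/-- The endomorphism field `X ↦ ∇_X ξ`. -/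
def gradField (G : E → E →L[ℝ] E →L[ℝ] ℝ) (ξ : E → E) (y : E) : E →L[ℝ] E :=
  fderiv ℝ ξ y + (conn G y).flip (ξ y)

theorem gradField_apply (G : E → E →L[ℝ] E →L[ℝ] ℝ) (ξ : E → E) (y X : E) :
    gradField G ξ y X = cov G X ξ y := by
  simp [gradField, cov_apply]

namespace IsMetricOn

variable (hG : IsMetricOn G U) (hy : y ∈ U)
include hG hy

/-- The covariant derivatives of adjoint fields are adjoint. -/
theorem covEnd_adjoint {P Q : E → E →L[ℝ] E} (hP : DifferentiableAt ℝ P y)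
    (hQ : DifferentiableAt ℝ Q y) (h : ∀ z ∈ U, ∀ u v, G z (P z u) v = G z u (Q z v)) (X Y Z : E) :
    G y (covEnd G P y X Y) Z = G y Y (covEnd G Q y X Z) := by
  have e : (fun z => G z (P z Y) Z) =ᶠ[nhds y] fun z => G z Y (Q z Z) :=
    (hG.eventually_mem hy).mono fun z hz => h z hz Y Z
  have h0 := congrArg (fun L : E →L[ℝ] ℝ => L X) e.fderiv_eq
  have h1 := hG.fderiv_form hy (V := fun z => P z Y) (W := fun _ => Z)
    (hP.clm_apply (by fun_prop)) (by fun_prop) X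
  have h2 := hG.fderiv_form hy (V := fun _ => Y) (W := fun z => Q z Z) (by fun_prop)
    (hQ.clm_apply (by fun_prop)) X
  rw [cov_endo hP (V := fun _ => Y) (by fun_prop)] at h1
  rw [cov_endo hQ (V := fun _ => Z) (by fun_prop)] at h2
  simp only [map_add, add_apply, cov_const] at h0 h1 h2
  rw [h y hy] at h1
  rw [← h y hy] at h2
  rw [h y hy] at h2
  have h3 := h y hy Y (conn G y X Z)
  linarith

/-- The covariant derivative of the field `η ⊗ ξ`, where `η = ⟨ξ, ·⟩`. -/
theorem covEnd_rankOne {ξ : E → E} (hξ : DifferentiableAt ℝ ξ y) (X Y : E) :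
    covEnd G (fun z => (G z (ξ z)).smulRight (ξ z)) y X Y =
      G y (gradField G ξ y X) Y • ξ y + G y (ξ y) Y • gradField G ξ y X := by
  have hd : DifferentiableAt ℝ G y := (hG.contDiffAt hy).differentiableAt (by simp)
  have hc : DifferentiableAt ℝ (fun z => G z (ξ z) Y) y :=
    (hd.clm_apply hξ).clm_apply (by fun_prop)
  have hP : DifferentiableAt ℝ (fun z => (G z (ξ z)).smulRight (ξ z)) y := by
    have := (((ContinuousLinearMap.smulRightL ℝ E E).differentiableAt).comp y
      (hd.clm_apply hξ)).clm_apply hξ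
    exact this
  have h1 := cov_endo (G := G) hP (V := fun _ => Y) (by fun_prop) X
  rw [cov_const] at h1
  have h2 : cov G X (fun z => ((G z (ξ z)).smulRight (ξ z)) Y) y =
      fderiv ℝ (fun z => G z (ξ z) Y) y X • ξ y + G y (ξ y) Y • cov G X ξ y := by
    have e : (fun z => ((G z (ξ z)).smulRight (ξ z)) Y) = fun z => G z (ξ z) Y • ξ z := by
      funext z; simp
    rw [e, cov_apply, cov_apply, fderiv_fun_smul hc hξ]
    simp only [add_apply, smul_apply, ContinuousLinearMap.smulRight_apply,
      map_smul, smul_add]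
    abel
  have h3 := hG.fderiv_form hy hξ (W := fun _ => Y) (by fun_prop) X
  rw [cov_const] at h3
  rw [h2, h3] at h1
  have h4 : covEnd G (fun z => (G z (ξ z)).smulRight (ξ z)) y X Y =
      (G y (cov G X ξ y) Y + G y (ξ y) (conn G y X Y)) • ξ y + G y (ξ y) Y • cov G X ξ y
        - ((G y (ξ y)).smulRight (ξ y)) (conn G y X Y) := by
    rw [h1]; abel
  rw [h4, gradField_apply, ContinuousLinearMap.smulRight_apply, add_smul]
  abel

omit hy in
theorem contDiffOn_gradField {ξ : E → E} (hξ : ContDiffOn ℝ ∞ ξ U) :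
    ContDiffOn ℝ ∞ (gradField G ξ) U := by
  intro z hz
  have h1 : ContDiffAt ℝ ∞ ξ z := hξ.contDiffAt (hG.isOpen.mem_nhds hz)
  have h2 : ContDiffAt ℝ ∞ (fun z => (conn G z).flip) z :=
    (ContinuousLinearMap.flipₗᵢ ℝ E E E).contDiff.contDiffAt.comp z (hG.contDiffAt_conn hz)
  exact ((h1.fderiv_right (m := ∞) (by simp)).add (h2.clm_apply h1)).contDiffWithinAt

/-- The Ricci identity `R(u, v)ξ = (∇_u A) v - (∇_v A) u` for `A = ∇ξ`. -/
theorem curv_gradField {ξ : E → E} (hξ : ContDiffOn ℝ ∞ ξ U) (u v : E) :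
    curv G y u v (ξ y) =
      covEnd G (gradField G ξ) y u v - covEnd G (gradField G ξ) y v u := by
  have h1 : ContDiffAt ℝ ∞ ξ y := hξ.contDiffAt (hG.isOpen.mem_nhds hy)
  have hA : DifferentiableAt ℝ (gradField G ξ) y :=
    ((hG.contDiffOn_gradField hξ).contDiffAt (hG.isOpen.mem_nhds hy)).differentiableAt (by simp)
  rw [← hG.cov_comm hy h1]
  have key : ∀ a b, cov G a (cov G b ξ) y = covEnd G (gradField G ξ) y a b
      + gradField G ξ y (conn G y a b) := by
    intro a b
    have e : cov G b ξ = fun z => gradField G ξ z b := by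
      funext z; rw [gradField_apply]
    rw [e, cov_endo hA (V := fun _ => b) (by fun_prop), cov_const]
  rw [key, key, hG.conn_symm hy u v]
  abel

end IsMetricOn

end Endomorphisms

/-! ### Linear algebra of contact metric structures -/

section ContactAlgebra

variable {V : Type*} [NormedAddCommGroup V] [NormedSpace ℝ V]

/-- An almost contact metric structure on a vector space with inner product `b`; the covector `η`
is `b ξ`. -/
structure IsAlmostContact (b : V →L[ℝ] V →L[ℝ] ℝ) (φ : V →L[ℝ] V) (ξ : V) : Prop where
  symm : ∀ u v, b u v = b v u
  pos : ∀ u, u ≠ 0 → 0 < b u u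
  φφ : ∀ v, φ (φ v) = -v + b ξ v • ξ
  norm : b ξ ξ = 1
  compat : ∀ u v, b u v = b (φ u) (φ v) + b ξ u * b ξ v

namespace IsAlmostContact

variable {b : V →L[ℝ] V →L[ℝ] ℝ} {φ : V →L[ℝ] V} {ξ : V} (h : IsAlmostContact b φ ξ)
include h

theorem ξ_ne_zero : ξ ≠ 0 := by
  rintro rfl
  simpa using h.norm

theorem φ_ξ : φ ξ = 0 := by
  have h1 : φ (φ ξ) = 0 := by rw [h.φφ, h.norm]; simp
  have h2 := h.φφ (φ ξ)
  rw [h1, map_zero] at h2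
  have h3 : φ ξ = b ξ (φ ξ) • ξ := by
    have := h2.symm
    rwa [neg_add_eq_zero] at this
  obtain ⟨a, ha⟩ : ∃ a : ℝ, φ ξ = a • ξ := ⟨_, h3⟩
  rw [ha, map_smul, ha, smul_smul, smul_eq_zero] at h1
  rcases h1 with h1 | h1
  · rw [ha, mul_self_eq_zero.mp h1, zero_smul]
  · exact absurd h1 h.ξ_ne_zero

theorem η_φ (u : V) : b ξ (φ u) = 0 := by
  have h1 : φ (φ (φ u)) = -φ u := by rw [h.φφ u, map_add, map_smul, h.φ_ξ]; simp
  rw [h.φφ (φ u)] at h1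
  have : b ξ (φ u) • ξ = 0 := by simpa using h1
  exact (smul_eq_zero.mp this).resolve_right h.ξ_ne_zero

theorem skew (u v : V) : b (φ u) v = -b u (φ v) := by
  rw [h.compat (φ u) v, h.η_φ, h.φφ]
  simp only [map_add, map_neg, map_smul, add_apply, neg_apply, smul_apply, smul_eq_mul]
  rw [h.η_φ]; ring

theorem skew_self (u : V) : b (φ u) u = 0 := by
  have := h.skew u u
  rw [h.symm u (φ u)] at this
  linarith

theorem φφ_of_horizontal {u : V} (hu : b ξ u = 0) : φ (φ u) = -u := by
  rw [h.φφ, hu]; simp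

theorem form_φφ {u v : V} (hu : b ξ u = 0) : b (φ u) (φ v) = b u v := by
  rw [h.compat u v, hu]; ring

theorem eq_zero_of_form {x : V} (hx : ∀ z, b x z = 0) : x = 0 :=
  eq_of_form_eq h.pos fun z => by rw [hx z]; simp

/-- `∇_ξ ξ = 0`: here `A = ∇ξ`, the first hypothesis says that `ξ` has constant length, and the second
one is `dη = Φ`. -/
theorem grad_ξ {A : V →L[ℝ] V} (hA1 : ∀ X, b (A X) ξ = 0)
    (hA2 : ∀ X Y, b (A X) Y - b (A Y) X = 2 * b X (φ Y)) : A ξ = 0 := by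
  refine h.eq_zero_of_form fun z => ?_
  have h1 := hA2 ξ z
  rw [hA1, h.η_φ] at h1
  linarith

/-- With `F = ∇φ` and `A = ∇ξ`, the pointwise identities of a contact metric structure give `∇_ξ φ = 0`
and `A φ + φ A = -2 φ²`. The identity `hF4` is `dΦ = 0`. The reason is that `∇_ξ φ` both commutes and
anticommutes with `φ`. -/
theorem covDeriv_ξ_eq_zero_and_anticomm {A : V →L[ℝ] V} {F : V →L[ℝ] V →L[ℝ] V}
    (hA1 : ∀ X, b (A X) ξ = 0)
    (hA2 : ∀ X Y, b (A X) Y - b (A Y) X = 2 * b X (φ Y))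
    (hF1 : ∀ X Y Z, b (F X Y) Z = -b Y (F X Z))
    (hF2 : ∀ X, F X ξ = -φ (A X))
    (hF3 : ∀ X Y, F X (φ Y) + φ (F X Y) = b (A X) Y • ξ + b ξ Y • A X)
    (hF4 : ∀ X Y Z, b (F X Y) Z + b (F Y Z) X + b (F Z X) Y = 0) :
    (∀ Y, F ξ Y = 0) ∧ ∀ Y, A (φ Y) + φ (A Y) = -(2 : ℝ) • φ (φ Y) := by
  have hAξ := h.grad_ξ hA1 hA2
  have hηA : ∀ X, b ξ (A X) = 0 := fun X => by rw [h.symm, hA1]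
  -- `∇_ξ φ` is the anticommutator of `φ` and `T = -A - φ`
  have hN : ∀ Y, F ξ Y = -(A (φ Y) + φ (A Y)) - (2 : ℝ) • φ (φ Y) := by
    intro Y
    refine eq_of_form_eq h.pos fun Z => ?_
    have h1 := hF4 ξ Y Z
    have h2 := hF1 Y Z ξ
    rw [hF2, map_neg] at h2
    rw [hF2] at h1
    have h3 := hA2 Z (φ Y)
    have h4 := h.skew (A Y) Z
    have h5 := h.skew (A Z) Y
    have h6 := h.symm Z (φ (A Y))
    have h7 := h.symm Z (φ (φ Y))
    have h8 := h.symm (A (φ Y)) Z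
    simp only [map_neg, map_sub, map_add, map_smul, neg_apply, add_apply, sub_apply, smul_apply,
      smul_eq_mul] at h1 h2 ⊢
    linarith
  have hanti : ∀ Y, F ξ (φ Y) = -φ (F ξ Y) := by
    intro Y
    have := hF3 ξ Y
    rw [hAξ] at this
    simp only [map_zero, zero_apply, zero_smul, smul_zero, add_zero] at this
    exact eq_neg_of_add_eq_zero_left this
  have hcomm : ∀ Y, F ξ (φ Y) = φ (F ξ Y) := by
    intro Y
    rw [hN, hN]
    simp only [map_sub, map_neg, map_add, map_smul]
    have e1 : A (φ (φ Y)) = -A Y := by rw [h.φφ, map_add, map_smul, hAξ]; simp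
    have e2 : φ (φ (A Y)) = -A Y := h.φφ_of_horizontal (hηA Y)
    rw [e1, e2]
    abel
  have hzero : ∀ Y, F ξ Y = 0 := by
    intro Y
    have h1 : φ (F ξ Y) = 0 := by
      have := (hcomm Y).symm.trans (hanti Y)
      have h2 : (2 : ℝ) • φ (F ξ Y) = 0 := by rw [two_smul]; nth_rewrite 1 [this]; simp
      exact (smul_eq_zero.mp h2).resolve_left (by norm_num)
    have h2 := h.φφ (F ξ Y)
    have h3 : b ξ (F ξ Y) = 0 := by
      rw [h.symm, hF1, hF2, hAξ]; simp
    rw [h1, map_zero, h3] at h2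
    simpa using h2.symm
  refine ⟨hzero, fun Y => ?_⟩
  have h1 := hN Y
  rw [hzero] at h1
  have h2 : A (φ Y) + φ (A Y) = -((-(A (φ Y) + φ (A Y)) - (2 : ℝ) • φ (φ Y)))
      - (2 : ℝ) • φ (φ Y) := by abel
  rw [h2, ← h1]
  simp

/-- The horizontal part of `F = ∇φ` vanishes. Here `T` is the symmetric endomorphism `φ h`, with
`T² = 1 - κ` on vectors orthogonal to `ξ`, and `D = ∇T`; `hD1` is the nullity condition, and `hD2`
is the derivative of `T² = 1 - κ`. If `κ = 1` then `T = 0` and `hD3` applies. If `κ < 1` then the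
horizontal vectors split into the eigenspaces of `T` for `±√(1 - κ)`, which `φ` interchanges, and
the eight combinations of eigenvectors are treated one by one. -/
theorem covDeriv_horizontal_eq_zero {T : V →L[ℝ] V} {F D : V →L[ℝ] V →L[ℝ] V} {κ : ℝ}
    (hT1 : ∀ X Y, b (T X) Y = b X (T Y)) (hT2 : ∀ X, T (φ X) = -φ (T X)) (hTξ : T ξ = 0)
    (hT3 : ∀ X, b ξ X = 0 → T (T X) = (1 - κ) • X)
    (hF1 : ∀ X Y Z, b (F X Y) Z = -b Y (F X Z))
    (hF3 : ∀ X Y Z, b ξ Y = 0 → b ξ Z = 0 → b (F X (φ Y)) Z = -b (φ (F X Y)) Z)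
    (hF4 : ∀ X Y Z, b (F X Y) Z + b (F Y Z) X + b (F Z X) Y = 0)
    (hD1 : ∀ X Y, b ξ X = 0 → b ξ Y = 0 → D X Y + F X Y = D Y X + F Y X)
    (hD2 : ∀ X Y Z, b ξ Y = 0 → b ξ Z = 0 → b (D X (T Y)) Z = -b (T (D X Y)) Z)
    (hD3 : κ = 1 → ∀ X Y, D X Y = 0)
    {X Y Z : V} (hX : b ξ X = 0) (hY : b ξ Y = 0) (hZ : b ξ Z = 0) : b (F X Y) Z = 0 := by
  have hηT : ∀ X, b ξ (T X) = 0 := fun X => by rw [← hT1, hTξ]; simp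
  -- by `dΦ = 0` and the nullity condition, `∇φ` is the skew part of `∇T`
  have hcod : ∀ X Y Z, b ξ X = 0 → b ξ Y = 0 →
      b (F Z X) Y = b (D X Y) Z - b (D Y X) Z := by
    intro X Y Z hX hY
    have h1 := congrArg (fun w => b w Z) (hD1 X Y hX hY)
    simp only [map_add, add_apply] at h1
    have h2 := hF4 X Y Z
    have h3 := hF1 Y Z X
    have h4 := h.symm Z (F Y X)
    linarith
  by_cases hX0 : X = 0
  · simp [hX0]
  have hκ : 0 ≤ 1 - κ := by
    have h1 := hT1 (T X) X
    rw [hT3 X hX, map_smul, smul_apply, smul_eq_mul] at h1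
    have h2 := h.pos X hX0
    have h3 : 0 ≤ b (T X) (T X) := by
      by_cases h0 : T X = 0
      · simp [h0]
      · exact (h.pos _ h0).le
    by_contra hlt
    push Not at hlt
    nlinarith
  rcases hκ.eq_or_lt with hκ | hκ
  · have h1 := hD3 (by linarith)
    have := hcod Y Z X hY hZ
    rw [this, h1, h1]; simp
  obtain ⟨l, hl, hl2⟩ : ∃ l : ℝ, 0 < l ∧ l ^ 2 = 1 - κ :=
    ⟨√(1 - κ), Real.sqrt_pos.mpr hκ, Real.sq_sqrt hκ.le⟩
  -- the four combinations of eigenvectors, for the eigenvalue `s` of the first one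
  have c1 : ∀ s : ℝ, s ≠ 0 → ∀ X Y Z, T X = s • X → T Y = s • Y → T Z = s • Z →
      b ξ X = 0 → b ξ Y = 0 → b ξ Z = 0 → b (F X Y) Z = 0 := by
    intro s hs X Y Z eX eY eZ hX hY hZ
    have ht : ∀ X Y Z, T Y = s • Y → T Z = s • Z → b ξ Y = 0 → b ξ Z = 0 → b (D X Y) Z = 0 := by
      intro X Y Z eY eZ hY hZ
      have h1 := hD2 X Y Z hY hZ
      rw [hT1, eY, eZ] at h1
      simp only [map_smul, smul_apply, smul_eq_mul] at h1
      have : s * b (D X Y) Z = 0 := by linarith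
      exact (mul_eq_zero.mp this).resolve_left hs
    rw [hcod Y Z X hY hZ, ht Y Z X eZ eX hZ hX, ht Z Y X eY eX hY hX, sub_zero]
  have eφ : ∀ (s : ℝ) X, T X = s • X → T (φ X) = (-s) • φ X := by
    intro s X eX
    rw [hT2, eX, map_smul, neg_smul]
  have hφ : ∀ X Y W, b ξ Y = 0 → b ξ W = 0 → b (F X (φ Y)) W = b (F X Y) (φ W) := by
    intro X Y W hY hW
    rw [hF3 X Y W hY hW, h.skew, neg_neg]
  have c2 : ∀ s : ℝ, s ≠ 0 → ∀ X Y Z, T X = s • X → T Y = (-s) • Y → T Z = (-s) • Z →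
      b ξ X = 0 → b ξ Y = 0 → b ξ Z = 0 → b (F X Y) Z = 0 := by
    intro s hs X Y Z eX eY eZ hX hY hZ
    have h1 := hφ X Y (φ Z) hY (h.η_φ Z)
    rw [h.φφ_of_horizontal hZ] at h1
    have h2 := c1 s hs X (φ Y) (φ Z) eX (by rw [eφ _ _ eY, neg_neg]) (by rw [eφ _ _ eZ, neg_neg])
      hX (h.η_φ Y) (h.η_φ Z)
    rw [h2] at h1
    simpa using h1.symm
  have c3 : ∀ s : ℝ, s ≠ 0 → ∀ X Y Z, T X = s • X → T Y = s • Y → T Z = (-s) • Z →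
      b ξ X = 0 → b ξ Y = 0 → b ξ Z = 0 → b (F X Y) Z = 0 := by
    intro s hs
    -- `⟨(∇_X φ) Y, φ W⟩` is symmetric in `X, Y` and skew in `Y, W`
    have hsym : ∀ X Y W, T X = s • X → T Y = s • Y → T W = s • W →
        b ξ X = 0 → b ξ Y = 0 → b ξ W = 0 → b (F X Y) (φ W) = b (F Y X) (φ W) := by
      intro X Y W eX eY eW hX hY hW
      have h1 := hF4 X Y (φ W)
      have h2 := c2 (-s) (neg_ne_zero.mpr hs) (φ W) X Y (eφ _ _ eW) (by rw [eX, neg_neg])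
        (by rw [eY, neg_neg]) (h.η_φ W) hX hY
      have h3 := hF1 Y (φ W) X
      have h4 := h.symm (φ W) (F Y X)
      linarith
    have hskew : ∀ X Y W, b ξ X = 0 → b ξ Y = 0 → b ξ W = 0 →
        b (F X Y) (φ W) = -b (F X W) (φ Y) := by
      intro X Y W hX hY hW
      have h1 := hφ X Y W hY hW
      have h2 := hF1 X (φ Y) W
      have h3 := h.symm (φ Y) (F X W)
      linarith
    intro X Y Z eX eY eZ hX hY hZ
    have eW : T (φ Z) = s • φ Z := by rw [eφ _ _ eZ, neg_neg]
    have hW := h.η_φ Z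
    have hZ' : Z = -φ (φ Z) := by rw [h.φφ_of_horizontal hZ, neg_neg]
    rw [hZ', map_neg, neg_eq_zero]
    have h1 := hsym X Y (φ Z) eX eY eW hX hY hW
    have h2 := hskew Y X (φ Z) hY hX hW
    have h3 := hsym Y (φ Z) X eY eW eX hY hW hX
    have h4 := hskew (φ Z) Y X hW hY hX
    have h5 := hsym (φ Z) X Y eW eX eY hW hX hY
    have h6 := hskew X (φ Z) Y hX hW hY
    linarith
  have c4 : ∀ s : ℝ, s ≠ 0 → ∀ X Y Z, T X = s • X → T Y = (-s) • Y → T Z = s • Z →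
      b ξ X = 0 → b ξ Y = 0 → b ξ Z = 0 → b (F X Y) Z = 0 := by
    intro s hs X Y Z eX eY eZ hX hY hZ
    rw [hF1, h.symm, c3 s hs X Z Y eX eZ eY hX hZ hY, neg_zero]
  -- decompose every vector as `(1/2l) ((l X + T X) + (l X - T X))`
  have hdec : ∀ X, X = (1 / (2 * l)) • ((l • X + T X) + (l • X - T X)) := by
    intro X
    have : (l • X + T X) + (l • X - T X) = (2 * l) • X := by rw [two_mul, add_smul]; abel
    rw [this, smul_smul]
    have : 1 / (2 * l) * (2 * l) = 1 := by field_simp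
    rw [this, one_smul]
  have hp : ∀ X, b ξ X = 0 → T (l • X + T X) = l • (l • X + T X) := by
    intro X hX
    rw [map_add, map_smul, hT3 X hX, ← hl2, smul_add, smul_smul, sq, add_comm]
  have hm : ∀ X, b ξ X = 0 → T (l • X - T X) = (-l) • (l • X - T X) := by
    intro X hX
    rw [map_sub, map_smul, hT3 X hX, ← hl2, smul_sub, smul_smul, sq, neg_smul, neg_mul, neg_smul]
    abel
  have hp' : ∀ X, b ξ X = 0 → b ξ (l • X + T X) = 0 := by
    intro X hX
    simp [hX, hηT]
  have hm' : ∀ X, b ξ X = 0 → b ξ (l • X - T X) = 0 := by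
    intro X hX
    simp [hX, hηT]
  have hl0 : l ≠ 0 := hl.ne'
  have hl0' : -l ≠ 0 := neg_ne_zero.mpr hl0
  have n : ∀ {x w : V}, T x = l • w → T x = (-(-l)) • w := fun e => by rw [e, neg_neg]
  have pX := hp X hX; have pY := hp Y hY; have pZ := hp Z hZ
  have mX := hm X hX; have mY := hm Y hY; have mZ := hm Z hZ
  have pX' := hp' X hX; have pY' := hp' Y hY; have pZ' := hp' Z hZ
  have mX' := hm' X hX; have mY' := hm' Y hY; have mZ' := hm' Z hZ
  rw [hdec X, hdec Y, hdec Z]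
  clear hdec hp hm hp' hm'
  generalize l • X + T X = x₁ at *
  generalize l • Y + T Y = y₁ at *
  generalize l • Z + T Z = z₁ at *
  generalize l • X - T X = x₂ at *
  generalize l • Y - T Y = y₂ at *
  generalize l • Z - T Z = z₂ at *
  simp only [map_smul, map_add, add_apply, smul_apply]
  rw [c1 l hl0 _ _ _ pX pY pZ pX' pY' pZ', c1 (-l) hl0' _ _ _ mX mY mZ mX' mY' mZ',
    c2 l hl0 _ _ _ pX mY mZ pX' mY' mZ', c2 (-l) hl0' _ _ _ mX (n pY) (n pZ) mX' pY' pZ',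
    c3 l hl0 _ _ _ pX pY mZ pX' pY' mZ', c3 (-l) hl0' _ _ _ mX mY (n pZ) mX' mY' pZ',
    c4 l hl0 _ _ _ pX mY pZ pX' mY' pZ', c4 (-l) hl0' _ _ _ mX (n pY) mZ mX' pY' mZ']
  simp

end IsAlmostContact

end ContactAlgebra

/-! ### Contact metric structures with `ξ` in the `(κ, μ)`-nullity distribution -/

section KappaMu

variable {E : Type*} [NormedAddCommGroup E] [NormedSpace ℝ E]

/-- The tensor `h = (1/2) 𝔏_ξ φ` in a coordinate domain, on coordinate-constant vector fields. -/
def lieHalf (φ : E → E →L[ℝ] E) (ξ : E → E) (y : E) : E →L[ℝ] E :=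
  (1 / 2 : ℝ) • (fderiv ℝ φ y (ξ y) - (fderiv ℝ ξ y).comp (φ y) + (φ y).comp (fderiv ℝ ξ y))

/-- `(φ, ξ, ⟨ξ, ·⟩, G)` is a `(κ, μ)`-contact metric structure on the coordinate domain `U`. -/
structure IsKappaMuOn (G : E → E →L[ℝ] E →L[ℝ] ℝ) (U : Set E) (φ : E → E →L[ℝ] E) (ξ : E → E)
    (κ μ : ℝ) : Prop where
  metric : IsMetricOn G U
  smooth_φ : ContDiffOn ℝ ∞ φ U
  smooth_ξ : ContDiffOn ℝ ∞ ξ U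
  almost : ∀ y ∈ U, IsAlmostContact (G y) (φ y) (ξ y)
  contact : ∀ y ∈ U, ∀ u v, (1 / 2 : ℝ) * (fderiv ℝ (fun z => G z (ξ z)) y u v
    - fderiv ℝ (fun z => G z (ξ z)) y v u) = G y u (φ y v)
  nullity : ∀ y ∈ U, ∀ u v, curv G y u v (ξ y) =
    κ • (G y (ξ y) v • u - G y (ξ y) u • v)
      + μ • (G y (ξ y) v • lieHalf φ ξ y u - G y (ξ y) u • lieHalf φ ξ y v)

namespace IsKappaMuOn

variable [FiniteDimensional ℝ E] {G : E → E →L[ℝ] E →L[ℝ] ℝ} {U : Set E} {φ : E → E →L[ℝ] E}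
  {ξ : E → E} {κ μ : ℝ} (hK : IsKappaMuOn G U φ ξ κ μ) {y : E} (hy : y ∈ U)

include hK hy

theorem φ_contDiffAt : ContDiffAt ℝ ∞ φ y :=
  hK.smooth_φ.contDiffAt (hK.metric.isOpen.mem_nhds hy)

theorem ξ_contDiffAt : ContDiffAt ℝ ∞ ξ y :=
  hK.smooth_ξ.contDiffAt (hK.metric.isOpen.mem_nhds hy)

theorem φ_diff : DifferentiableAt ℝ φ y := (hK.φ_contDiffAt hy).differentiableAt (by simp)

theorem ξ_diff : DifferentiableAt ℝ ξ y := (hK.ξ_contDiffAt hy).differentiableAt (by simp)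

theorem grad_contDiffAt : ContDiffAt ℝ ∞ (gradField G ξ) y :=
  (hK.metric.contDiffOn_gradField hK.smooth_ξ).contDiffAt (hK.metric.isOpen.mem_nhds hy)

theorem grad_diff : DifferentiableAt ℝ (gradField G ξ) y :=
  (hK.grad_contDiffAt hy).differentiableAt (by simp)

theorem form_grad_ξ (X : E) : G y (gradField G ξ y X) (ξ y) = 0 := by
  have e : (fun z => G z (ξ z) (ξ z)) =ᶠ[nhds y] fun _ => (1 : ℝ) :=
    (hK.metric.eventually_mem hy).mono fun z hz => (hK.almost z hz).norm
  have h1 := hK.metric.fderiv_form hy (hK.ξ_diff hy) (hK.ξ_diff hy) X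
  rw [e.fderiv_eq, hK.metric.symm y hy (ξ y)] at h1
  rw [gradField_apply]
  simp at h1
  linarith

/-- The contact condition `dη = Φ`, in terms of `∇ξ`. -/
theorem form_grad_sub (X Y : E) :
    G y (gradField G ξ y X) Y - G y (gradField G ξ y Y) X = 2 * G y X (φ y Y) := by
  have hd : DifferentiableAt ℝ G y := (hK.metric.contDiffAt hy).differentiableAt (by simp)
  have hη : DifferentiableAt ℝ (fun z => G z (ξ z)) y := hd.clm_apply (hK.ξ_diff hy)
  have h1 : ∀ a b, fderiv ℝ (fun z => G z (ξ z)) y a b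
      = G y (gradField G ξ y a) b + G y (ξ y) (conn G y a b) := by
    intro a b
    have h2 := hK.metric.fderiv_form hy (hK.ξ_diff hy) (W := fun _ => b) (by fun_prop) a
    rw [(hη.hasFDerivAt.clm_apply (hasFDerivAt_const b y)).fderiv] at h2
    simp only [cov_const] at h2
    rw [gradField_apply]
    simpa using h2
  have h3 := hK.contact y hy X Y
  rw [h1, h1, hK.metric.conn_symm hy Y X] at h3
  linarith

theorem form_covEnd_φ (X Y Z : E) :
    G y (covEnd G φ y X Y) Z = -G y Y (covEnd G φ y X Z) := by
  have h1 := hK.metric.covEnd_adjoint hy (hK.φ_diff hy) (Q := fun z => -φ z) (hK.φ_diff hy).neg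
    (fun z hz u v => by rw [(hK.almost z hz).skew]; simp) X Y Z
  rw [h1, covEnd_neg, map_neg]

theorem covEnd_φ_ξ (X : E) : covEnd G φ y X (ξ y) = -φ y (gradField G ξ y X) := by
  have e : (fun z => φ z (ξ z)) =ᶠ[nhds y] fun _ => (0 : E) :=
    (hK.metric.eventually_mem hy).mono fun z hz => (hK.almost z hz).φ_ξ
  have h1 := cov_endo (G := G) (hK.φ_diff hy) (hK.ξ_diff hy) X
  rw [cov_apply, e.fderiv_eq, e.eq_of_nhds] at h1
  rw [gradField_apply]
  exact eq_neg_of_add_eq_zero_left (by simpa using h1.symm)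

theorem rankOne_diff : DifferentiableAt ℝ (fun z => (G z (ξ z)).smulRight (ξ z)) y := by
  have hd : DifferentiableAt ℝ G y := (hK.metric.contDiffAt hy).differentiableAt (by simp)
  exact (((ContinuousLinearMap.smulRightL ℝ E E).differentiableAt).comp y
    (hd.clm_apply (hK.ξ_diff hy))).clm_apply (hK.ξ_diff hy)

/-- The covariant derivative of `φ² = -I + η ⊗ ξ`. -/
theorem covEnd_φ_φ (X Y : E) : covEnd G φ y X (φ y Y) + φ y (covEnd G φ y X Y) =
    G y (gradField G ξ y X) Y • ξ y + G y (ξ y) Y • gradField G ξ y X := by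
  rw [← covEnd_comp (hK.φ_diff hy) (hK.φ_diff hy), ← hK.metric.covEnd_rankOne hy (hK.ξ_diff hy)]
  have e : (fun z => (φ z).comp (φ z)) =ᶠ[nhds y]
      fun z => -ContinuousLinearMap.id ℝ E + (G z (ξ z)).smulRight (ξ z) := by
    refine (hK.metric.eventually_mem hy).mono fun z hz => ?_
    ext v
    simp [(hK.almost z hz).φφ]
  rw [covEnd_congr e, covEnd_add (P := fun _ => -ContinuousLinearMap.id ℝ E) (by fun_prop)
    (hK.rankOne_diff hy), covEnd_neg (fun _ => ContinuousLinearMap.id ℝ E), covEnd_id]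
  simp

/-- `dΦ = 0`, which follows from `Φ = dη`. It is derived from the first Bianchi identity and the Ricci
identity for `ξ`. -/
theorem covEnd_φ_cyclic (X Y Z : E) : G y (covEnd G φ y X Y) Z + G y (covEnd G φ y Y Z) X
    + G y (covEnd G φ y Z X) Y = 0 := by
  have hM := hK.metric
  have h1 : ∀ a b c, G y (covEnd G (gradField G ξ) y a b) c =
      G y b (covEnd G (gradField G ξ) y a c + (2 : ℝ) • covEnd G φ y a c) := by
    intro a b c
    have := hM.covEnd_adjoint hy (hK.grad_diff hy) (Q := fun z => gradField G ξ z + (2 : ℝ) • φ z)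
      ((hK.grad_diff hy).add ((hK.φ_diff hy).fun_const_smul 2)) (fun z hz u v => by
        have h2 := hK.form_grad_sub hz u v
        have h3 := hM.symm z hz u (gradField G ξ z v)
        simp only [add_apply, smul_apply, map_add, map_smul, smul_eq_mul]
        linarith) a b c
    rw [this, covEnd_add (hK.grad_diff hy) ((hK.φ_diff hy).fun_const_smul 2),
      covEnd_const_smul (hK.φ_diff hy)]
  -- the cyclic sum of `⟨R(Z, X)ξ, Y⟩` vanishes
  have hR : ∀ a b c, G y (curv G y a b (ξ y)) c = -G y (curv G y a b c) (ξ y) :=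
    fun a b c => hM.form_curv_skew hy a b (ξ y) c
  have hB := congrArg (fun v => G y v (ξ y)) (hM.curv_bianchi hy X Y Z)
  simp only [map_add, add_apply, map_zero, zero_apply] at hB
  have r1 := hR X Y Z
  have r2 := hR Y Z X
  have r3 := hR Z X Y
  rw [hM.curv_gradField hy hK.smooth_ξ] at r1 r2 r3
  have a1 := h1 X Y Z
  have a2 := h1 Y Z X
  have a3 := h1 Z X Y
  have f1 := hK.form_covEnd_φ hy X Z Y
  have f2 := hK.form_covEnd_φ hy Y X Z
  have f3 := hK.form_covEnd_φ hy Z Y X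
  have s1 := hM.symm y hy Y (covEnd G φ y X Z)
  have s2 := hM.symm y hy Z (covEnd G φ y Y X)
  have s3 := hM.symm y hy X (covEnd G φ y Z Y)
  have t1 := hM.symm y hy Y (covEnd G (gradField G ξ) y X Z)
  have t2 := hM.symm y hy Z (covEnd G (gradField G ξ) y Y X)
  have t3 := hM.symm y hy X (covEnd G (gradField G ξ) y Z Y)
  have u1 := hM.symm y hy Z (covEnd G φ y X Y)
  have u2 := hM.symm y hy X (covEnd G φ y Y Z)
  have u3 := hM.symm y hy Y (covEnd G φ y Z X)
  simp only [map_sub, map_add, sub_apply, map_smul, smul_eq_mul] at r1 r2 r3 a1 a2 a3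
  linarith

theorem grad_ξ : gradField G ξ y (ξ y) = 0 :=
  (hK.almost y hy).grad_ξ (hK.form_grad_ξ hy) (hK.form_grad_sub hy)

theorem covEnd_φ_ξ_left (Y : E) : covEnd G φ y (ξ y) Y = 0 :=
  ((hK.almost y hy).covDeriv_ξ_eq_zero_and_anticomm (hK.form_grad_ξ hy) (hK.form_grad_sub hy)
    (hK.form_covEnd_φ hy) (hK.covEnd_φ_ξ hy) (hK.covEnd_φ_φ hy) (hK.covEnd_φ_cyclic hy)).1 Y

theorem grad_φ_add (Y : E) : gradField G ξ y (φ y Y) + φ y (gradField G ξ y Y)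
    = -(2 : ℝ) • φ y (φ y Y) :=
  ((hK.almost y hy).covDeriv_ξ_eq_zero_and_anticomm (hK.form_grad_ξ hy) (hK.form_grad_sub hy)
    (hK.form_covEnd_φ hy) (hK.covEnd_φ_ξ hy) (hK.covEnd_φ_φ hy) (hK.covEnd_φ_cyclic hy)).2 Y

omit hK hy in
/-- The symmetric endomorphism `T = -∇ξ - φ`; it equals `φ h`. -/
def _root_.ContactGeometry.symGrad (G : E → E →L[ℝ] E →L[ℝ] ℝ) (φ : E → E →L[ℝ] E) (ξ : E → E)
    (y : E) : E →L[ℝ] E := -(gradField G ξ y + φ y)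

omit hK hy in
theorem symGrad_apply (X : E) : symGrad G φ ξ y X = -(gradField G ξ y X + φ y X) := rfl

theorem symGrad_diff : DifferentiableAt ℝ (symGrad G φ ξ) y :=
  ((hK.grad_diff hy).add (hK.φ_diff hy)).neg

theorem covEnd_symGrad (X Y : E) : covEnd G (symGrad G φ ξ) y X Y =
    -(covEnd G (gradField G ξ) y X Y + covEnd G φ y X Y) := by
  have := covEnd_neg (G := G) (y := y) (fun z => gradField G ξ z + φ z) X Y
  rw [covEnd_add (hK.grad_diff hy) (hK.φ_diff hy)] at this
  exact this

theorem symGrad_symm (X Y : E) : G y (symGrad G φ ξ y X) Y = G y X (symGrad G φ ξ y Y) := by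
  have h1 := hK.form_grad_sub hy X Y
  have h2 := (hK.almost y hy).skew X Y
  have h3 := hK.metric.symm y hy X (gradField G ξ y Y)
  simp only [symGrad_apply, map_neg, map_add, neg_apply, add_apply]
  linarith

theorem symGrad_ξ : symGrad G φ ξ y (ξ y) = 0 := by
  rw [symGrad_apply, hK.grad_ξ hy, (hK.almost y hy).φ_ξ]; simp

theorem symGrad_φ (X : E) : symGrad G φ ξ y (φ y X) = -φ y (symGrad G φ ξ y X) := by
  have h1 := hK.grad_φ_add hy X
  rw [symGrad_apply, symGrad_apply, map_neg, map_add, neg_neg,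
    eq_sub_of_add_eq h1, neg_smul, two_smul]
  abel

theorem η_symGrad (X : E) : G y (ξ y) (symGrad G φ ξ y X) = 0 := by
  rw [← hK.symGrad_symm hy, hK.symGrad_ξ hy]; simp

/-- `h = T φ` for `T = -∇ξ - φ`. -/
theorem lieHalf_eq (X : E) : lieHalf φ ξ y X = symGrad G φ ξ y (φ y X) := by
  have h1 := hK.covEnd_φ_ξ_left hy X
  rw [covEnd_apply] at h1
  have h2 := hK.grad_φ_add hy X
  have h3 : fderiv ℝ φ y (ξ y) X = φ y (conn G y (ξ y) X) - conn G y (ξ y) (φ y X) := by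
    rw [eq_sub_iff_add_eq]
    exact sub_eq_zero.mp h1
  have h4 : ∀ v, gradField G ξ y v = fderiv ℝ ξ y v + conn G y (ξ y) v := by
    intro v
    rw [hK.metric.conn_symm hy]
    rfl
  have h5 : (2 : ℝ) • lieHalf φ ξ y X = (2 : ℝ) • symGrad G φ ξ y (φ y X) := by
    have : (2 : ℝ) • lieHalf φ ξ y X
        = φ y (gradField G ξ y X) - gradField G ξ y (φ y X) := by
      rw [lieHalf, smul_apply, smul_smul]
      norm_num
      rw [h3, h4, h4, map_add]
      abel
    rw [this, eq_sub_of_add_eq' h2, symGrad_apply, neg_smul, two_smul, two_smul]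
    abel
  exact smul_right_injective E (two_ne_zero (α := ℝ)) h5

theorem φ_lieHalf (X : E) : φ y (lieHalf φ ξ y X) = symGrad G φ ξ y X := by
  rw [hK.lieHalf_eq hy, hK.symGrad_φ hy, map_neg, (hK.almost y hy).φφ_of_horizontal
    (hK.η_symGrad hy X), neg_neg]

theorem lieHalf_ξ : lieHalf φ ξ y (ξ y) = 0 := by
  rw [hK.lieHalf_eq hy, (hK.almost y hy).φ_ξ, map_zero]

theorem η_lieHalf (X : E) : G y (ξ y) (lieHalf φ ξ y X) = 0 := by
  rw [hK.lieHalf_eq hy, hK.η_symGrad hy]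

theorem lieHalf_φ (X : E) : lieHalf φ ξ y (φ y X) = -φ y (lieHalf φ ξ y X) := by
  rw [hK.lieHalf_eq hy, hK.lieHalf_eq hy, hK.symGrad_φ hy]

theorem lieHalf_symm (X Y : E) : G y (lieHalf φ ξ y X) Y = G y X (lieHalf φ ξ y Y) := by
  rw [hK.lieHalf_eq hy, hK.lieHalf_eq hy, hK.symGrad_φ hy X, ← hK.symGrad_symm hy,
    map_neg, neg_apply, (hK.almost y hy).skew, neg_neg]

/-- `∇_X ξ = -φ X - φ h X`. -/
theorem grad_eq (X : E) : gradField G ξ y X = -φ y X - φ y (lieHalf φ ξ y X) := by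
  rw [hK.φ_lieHalf hy, symGrad_apply]; abel

/-- `(φ h)² = (1 - κ) (I - η ⊗ ξ)`. The nullity condition evaluates `R(X, ξ)ξ`; in
`φ R(X, ξ)ξ + R(φ X, ξ)ξ` the terms with `μ` and with `∇_ξ (φ h)` cancel. -/
theorem symGrad_sq (X : E) : symGrad G φ ξ y (symGrad G φ ξ y X) =
    (1 - κ) • (X - G y (ξ y) X • ξ y) := by
  have hA := hK.almost y hy
  set T := symGrad G φ ξ y with hT
  -- the curvature `R(X, ξ)ξ`, computed from `∇ξ`
  have hR : ∀ X, X - G y (ξ y) X • ξ y - T (T X) + covEnd G (symGrad G φ ξ) y (ξ y) X =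
      κ • (X - G y (ξ y) X • ξ y) + μ • lieHalf φ ξ y X := by
    intro X
    have h1 := hK.nullity y hy X (ξ y)
    rw [hK.metric.curv_gradField hy hK.smooth_ξ, hA.norm, hK.lieHalf_ξ hy] at h1
    have h2 : covEnd G (gradField G ξ) y X (ξ y) = -gradField G ξ y (gradField G ξ y X) := by
      have e : (fun z => gradField G ξ z (ξ z)) =ᶠ[nhds y] fun _ => (0 : E) :=
        (hK.metric.eventually_mem hy).mono fun z hz => hK.grad_ξ hz
      have h3 := cov_endo (G := G) (hK.grad_diff hy) (hK.ξ_diff hy) X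
      rw [cov_apply, e.fderiv_eq, e.eq_of_nhds] at h3
      rw [gradField_apply]
      rw [gradField_apply]
      refine eq_neg_of_add_eq_zero_left ?_
      rw [gradField_apply] at h3
      simpa using h3.symm
    have h4 : covEnd G (gradField G ξ) y (ξ y) X = -covEnd G (symGrad G φ ξ) y (ξ y) X := by
      rw [hK.covEnd_symGrad hy, hK.covEnd_φ_ξ_left hy]; simp
    have h5 : ∀ v, gradField G ξ y v = -φ y v - T v := by
      intro v; rw [hT, symGrad_apply]; abel
    rw [h2, h4, h5 X, h5] at h1
    simp only [one_smul, smul_zero, sub_zero, map_sub, map_neg] at h1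
    rw [hK.symGrad_φ hy, hA.φφ] at h1
    rw [← h1]
    abel
  have hφ : ∀ X, φ y (T (T X)) = φ y X - κ • φ y X := by
    intro X
    have e1 := congrArg (φ y) (hR X)
    have e2 := hR (φ y X)
    have e3 : covEnd G (symGrad G φ ξ) y (ξ y) (φ y X)
        = -φ y (covEnd G (symGrad G φ ξ) y (ξ y) X) := by
      have e : (fun z => (symGrad G φ ξ z).comp (φ z)) =ᶠ[nhds y]
          fun z => -((φ z).comp (symGrad G φ ξ z)) := by
        refine (hK.metric.eventually_mem hy).mono fun z hz => ?_
        ext v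
        simp [hK.symGrad_φ hz]
      have h1 := congrArg (fun L => L (ξ y) X) (covEnd_congr (G := G) e)
      rw [covEnd_comp (hK.symGrad_diff hy) (hK.φ_diff hy),
        covEnd_neg (fun z => (φ z).comp (symGrad G φ ξ z)),
        covEnd_comp (hK.φ_diff hy) (hK.symGrad_diff hy), hK.covEnd_φ_ξ_left hy,
        hK.covEnd_φ_ξ_left hy] at h1
      simpa using h1
    have e4 : T (T (φ y X)) = φ y (T (T X)) := by
      rw [hT, hK.symGrad_φ hy, map_neg, hK.symGrad_φ hy, neg_neg]
    rw [e3, e4, hA.η_φ, hK.lieHalf_φ hy] at e2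
    simp only [map_add, map_sub, map_smul, hA.φ_ξ, smul_zero, sub_zero, zero_smul, smul_neg]
      at e1 e2
    have e5 := congrArg₂ (fun a b => a + b) e1 e2
    have e6 : (2 : ℝ) • (φ y X - φ y (T (T X))) = (2 : ℝ) • (κ • φ y X) := by
      rw [two_smul, two_smul]
      calc _ = _ := ?_
        _ = _ := e5
        _ = _ := ?_ <;> abel
    have e7 := smul_right_injective E (two_ne_zero (α := ℝ)) e6
    rw [← e7]; abel
  have h1 := congrArg (φ y) (hφ X)
  simp only [map_sub, map_smul] at h1
  rw [hA.φφ_of_horizontal (hK.η_symGrad hy _), hA.φφ] at h1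
  rw [neg_eq_iff_eq_neg] at h1
  rw [h1, sub_smul, one_smul, smul_add, smul_sub, smul_neg]
  abel

/-- `(∇_X φ) Y = ⟨X + h X, Y⟩ ξ - η(Y) (X + h X)`. -/
theorem covEnd_φ_eq (X Y : E) : covEnd G φ y X Y =
    G y (X + lieHalf φ ξ y X) Y • ξ y - G y (ξ y) Y • (X + lieHalf φ ξ y X) := by
  have hA := hK.almost y hy
  have hM := hK.metric
  have hzero : ∀ X Y Z, G y (ξ y) X = 0 → G y (ξ y) Y = 0 → G y (ξ y) Z = 0 →
      G y (covEnd G φ y X Y) Z = 0 := by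
    intro X Y Z hX hY hZ
    refine hA.covDeriv_horizontal_eq_zero (T := symGrad G φ ξ y)
      (D := covEnd G (symGrad G φ ξ) y) (κ := κ) (hK.symGrad_symm hy) (hK.symGrad_φ hy)
      (hK.symGrad_ξ hy) ?_ (hK.form_covEnd_φ hy) ?_ (hK.covEnd_φ_cyclic hy) ?_ ?_ ?_ hX hY hZ
    · intro X hX
      rw [hK.symGrad_sq hy, hX]; simp
    · intro X Y Z hY hZ
      have h1 := congrArg (fun v => G y v Z) (hK.covEnd_φ_φ hy X Y)
      simp only [map_add, add_apply, map_smul, smul_apply, hY, hZ] at h1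
      simp only [smul_eq_mul, mul_zero, zero_mul, add_zero] at h1
      linarith
    · intro X Y hX hY
      have h1 := hK.nullity y hy X Y
      rw [hX, hY, hM.curv_gradField hy hK.smooth_ξ] at h1
      have h2 : covEnd G (gradField G ξ) y X Y = covEnd G (gradField G ξ) y Y X := by
        rw [← sub_eq_zero, h1]; simp
      rw [hK.covEnd_symGrad hy, hK.covEnd_symGrad hy, h2]
      abel
    · intro X Y Z hY hZ
      have e : (fun z => (symGrad G φ ξ z).comp (symGrad G φ ξ z)) =ᶠ[nhds y]
          fun z => (1 - κ) • (ContinuousLinearMap.id ℝ E + -(G z (ξ z)).smulRight (ξ z)) := by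
        refine (hM.eventually_mem hy).mono fun z hz => ?_
        ext v
        simp [hK.symGrad_sq hz, sub_eq_add_neg]
      have h1 := congrArg (fun L => G y (L X Y) Z) (covEnd_congr (G := G) e)
      rw [covEnd_comp (hK.symGrad_diff hy) (hK.symGrad_diff hy), covEnd_const_smul
        (P := fun z => ContinuousLinearMap.id ℝ E + -(G z (ξ z)).smulRight (ξ z))
        ((differentiableAt_const _).add (hK.rankOne_diff hy).neg),
        covEnd_add (P := fun _ => ContinuousLinearMap.id ℝ E)
          (Q := fun z => -(G z (ξ z)).smulRight (ξ z)) (differentiableAt_const _) (hK.rankOne_diff hy).neg, covEnd_id,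
        covEnd_neg (fun z => (G z (ξ z)).smulRight (ξ z)),
        hM.covEnd_rankOne hy (hK.ξ_diff hy), hY] at h1
      simp only [map_add, add_apply, map_smul, smul_apply, map_neg, neg_apply, hZ, zero_smul,
        smul_eq_mul, mul_zero, add_zero, zero_add, neg_zero] at h1
      linarith
    · intro hκ X Y
      have e : symGrad G φ ξ =ᶠ[nhds y] fun _ => (0 : E →L[ℝ] E) := by
        refine (hM.eventually_mem hy).mono fun z hz => ?_
        ext v
        have h1 := hK.symGrad_sq hz v
        rw [hκ, sub_self, zero_smul] at h1
        have h2 := hK.symGrad_symm hz (symGrad G φ ξ z v) v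
        rw [h1] at h2
        by_contra h0
        have := hM.pos z hz _ h0
        simp at h2
        linarith
      rw [covEnd_congr e]
      simp [covEnd_apply]
  have hF2 := hK.covEnd_φ_ξ hy
  have hFξ := hK.covEnd_φ_ξ_left hy
  -- the values on `ξ`
  have hξ : ∀ X, covEnd G φ y X (ξ y) = G y (ξ y) X • ξ y - X - lieHalf φ ξ y X := by
    intro X
    rw [hF2, hK.grad_eq hy, map_sub, map_neg, hA.φφ, hA.φφ_of_horizontal (hK.η_lieHalf hy X)]
    abel
  refine eq_of_form_eq hA.pos fun Z => ?_
  have hdec : ∀ X, G y (ξ y) (X - G y (ξ y) X • ξ y) = 0 := by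
    intro X; simp [hA.norm]
  have h0 := hzero _ _ _ (hdec X) (hdec Y) (hdec Z)
  have hFs : G y (covEnd G φ y X Y) (ξ y) = G y Y (X + lieHalf φ ξ y X) - G y (ξ y) X * G y (ξ y) Y := by
    rw [hK.form_covEnd_φ hy, hξ, hA.symm (ξ y) Y]
    simp only [map_add, map_sub, map_smul, smul_eq_mul]
    ring
  simp only [map_sub, map_smul, sub_apply, smul_apply, smul_eq_mul, hFξ, hξ, hFs, zero_apply,
    map_zero, mul_zero, sub_zero, hA.norm] at h0
  have hs := hA.symm
  simp only [map_sub, map_add, map_smul, sub_apply, add_apply, smul_apply, smul_eq_mul] at h0 ⊢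
  have s1 := hs Y X
  have s2 := hs Y (lieHalf φ ξ y X)
  have s4 := hs (ξ y) X
  rw [s1, s2, ← s4] at h0
  have s3 : G y (lieHalf φ ξ y X) (ξ y) = 0 := by rw [hs, hK.η_lieHalf hy]
  linear_combination h0 + G y (ξ y) Z * G y (ξ y) Y * s3

end IsKappaMuOn

end KappaMu

/-! ### Sectional curvature of `(κ, μ)`-contact space forms -/

section Polarization

/-- A curvature-like form that is invariant under the complex structure `J` and has vanishing
holomorphic sectional curvature has vanishing sectional curvature: polarization gives
`R(x, y, y, x) = -3 R(x, Jy, Jy, x)`, and this relation is applied twice. -/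
theorem sectional_eq_zero_of_holomorphic {D : Type*} [AddCommGroup D] (R : D → D → D → D → ℝ)
    (J : D → D) (hadd : ∀ a a' b c d, R (a + a') b c d = R a b c d + R a' b c d)
    (h12 : ∀ a b c d, R a b c d = -R b a c d) (h34 : ∀ a b c d, R a b c d = -R a b d c)
    (hpair : ∀ a b c d, R a b c d = R c d a b)
    (hB : ∀ a b c d, R a b c d + R b c a d + R c a b d = 0)
    (hJadd : ∀ a b, J (a + b) = J a + J b) (hJJ : ∀ a, J (J a) = -a)
    (hJ : ∀ a b c d, R a b (J c) (J d) = R a b c d)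
    (hH : ∀ a, R a (J a) (J a) a = 0) (x y : D) : R x y y x = 0 := by
  have add2 : ∀ a b b' c d, R a (b + b') c d = R a b c d + R a b' c d := fun a b b' c d => by
    rw [h12, hadd, h12 b, h12 b']; ring
  have add3 : ∀ a b c c' d, R a b (c + c') d = R a b c d + R a b c' d := fun a b c c' d => by
    rw [hpair, hadd, hpair c, hpair c']
  have add4 : ∀ a b c d d', R a b c (d + d') = R a b c d + R a b c d' := fun a b c d d' => by
    rw [h34, add3, h34 a b d, h34 a b d']; ring
  have zero1 : ∀ b c d, R 0 b c d = 0 := fun b c d => by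
    have := hadd 0 0 b c d
    rw [add_zero] at this
    linarith
  have neg1 : ∀ a b c d, R (-a) b c d = -R a b c d := fun a b c d => by
    have := hadd a (-a) b c d
    rw [add_neg_cancel, zero1] at this
    linarith
  have neg2 : ∀ a b c d, R a (-b) c d = -R a b c d := fun a b c d => by
    rw [h12 a (-b), neg1, h12 a b]
  have neg3 : ∀ a b c d, R a b (-c) d = -R a b c d := fun a b c d => by
    rw [hpair, neg1, hpair c]
  have neg4 : ∀ a b c d, R a b c (-d) = -R a b c d := fun a b c d => by
    rw [h34 a b c (-d), neg3, h34 a b c d]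
  have J0 : J 0 = 0 := by
    have := hJadd 0 0
    rwa [add_zero, left_eq_add] at this
  have Jneg : ∀ a, J (-a) = -J a := fun a => by
    have := hJadd a (-a)
    rw [add_neg_cancel, J0] at this
    exact (neg_eq_of_add_eq_zero_right this.symm).symm
  have hJ' : ∀ a b c d, R a b (J c) d = -R a b c (J d) := fun a b c d => by
    rw [← hJ a b c (J d), hJJ, neg4, neg_neg]
  -- the part of `R(x ± y, J(x ± y), J(x ± y), x ± y)` that is quadratic in `x` and in `y`
  have key : ∀ x y, R x y y x + 3 * R x (J y) (J y) x = 0 := by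
    intro x y
    have hp := hH (x + y)
    have hm := hH (x + -y)
    simp only [hJadd, Jneg, hadd, add2, add3, add4, neg1, neg2, neg3, neg4] at hp hm
    have hx := hH x
    have hy := hH y
    have e1 : R x (J y) (J x) y = R x (J y) (J y) x := by
      rw [hJ', h34]; ring
    have e2 : R y (J x) (J y) x = R x (J y) (J y) x := by
      rw [hpair, h12, h34, neg_neg, e1]
    have e3 : R y (J x) (J x) y = R x (J y) (J y) x := by
      rw [hJ', hpair, h34, neg_neg, e1]
    have e4 : R x (J x) (J y) y = R x y y x + R x (J y) (J y) x := by
      have b1 := hB x (J x) (J y) y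
      have b2 : R (J x) (J y) x y = R x y x y := by rw [hpair, hJ, hpair]
      have b3 := h12 (J y) x (J x) y
      have b4 := h34 x y x y
      linarith
    have e5 : R y (J y) (J x) x = R x y y x + R x (J y) (J y) x := by
      rw [hpair, h12, h34, neg_neg, e4]
    linarith
  have k1 := key x y
  have k2 := key x (J y)
  rw [hJJ, neg2, neg3, neg_neg] at k2
  linarith

end Polarization

section SpaceForm

variable {V : Type*} [NormedAddCommGroup V] [NormedSpace ℝ V]

/-- On vectors orthogonal to `ξ`, the curvature form of a `(κ, μ)`-contact space form of constant
`φ`-sectional curvature `c`. -/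
def spaceFormCurv (b : V →L[ℝ] V →L[ℝ] ℝ) (φ h : V →L[ℝ] V) (c : ℝ) (X Y Z W : V) : ℝ :=
  (c + 3) / 4 * (b Y Z * b X W - b X Z * b Y W)
  + (c - 1) / 4 * (2 * b X (φ Y) * b (φ Z) W + b X (φ Z) * b (φ Y) W - b Y (φ Z) * b (φ X) W)
  + 1 / 2 * (b (h Y) Z * b (h X) W - b (h X) Z * b (h Y) W
    + b (φ (h X)) Z * b (φ (h Y)) W - b (φ (h Y)) Z * b (φ (h X)) W)
  + (b Y Z * b (h X) W - b X Z * b (h Y) W - b (h X) Z * b Y W + b (h Y) Z * b X W)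

end SpaceForm

namespace IsKappaMuOn

variable {E : Type*} [NormedAddCommGroup E] [NormedSpace ℝ E] [FiniteDimensional ℝ E]
  {G : E → E →L[ℝ] E →L[ℝ] ℝ} {U : Set E} {φ : E → E →L[ℝ] E}
  {ξ : E → E} {κ μ : ℝ} (hK : IsKappaMuOn G U φ ξ κ μ) {y : E} (hy : y ∈ U)

include hK hy

/-- The Ricci identity `R(X, Y) φ Z - φ R(X, Y) Z = (∇²φ)(X, Y)Z - (∇²φ)(Y, X)Z`, on vectors `Z`, `W`
orthogonal to `ξ`, with the known value of `∇φ` inserted. -/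
theorem form_curv_φ (X Y : E) {Z W : E} (hZ : G y (ξ y) Z = 0) (hW : G y (ξ y) W = 0) :
    G y (curv G y X Y (φ y Z)) W - G y (φ y (curv G y X Y Z)) W =
      (G y (Y + lieHalf φ ξ y Y) Z * G y (gradField G ξ y X) W
        - G y (gradField G ξ y X) Z * G y (Y + lieHalf φ ξ y Y) W)
      - (G y (X + lieHalf φ ξ y X) Z * G y (gradField G ξ y Y) W
        - G y (gradField G ξ y Y) Z * G y (X + lieHalf φ ξ y X) W) := by
  have hM := hK.metric
  have hξW : G y (ξ y) W = 0 := hW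
  have hd : DifferentiableAt ℝ G y := (hM.contDiffAt hy).differentiableAt (by simp)
  have hB : ∀ v, DifferentiableAt ℝ (fun z => v + lieHalf φ ξ z v) y := by
    intro v
    have h1 := ((hK.φ_contDiffAt hy).fderiv_right (m := ∞) (by simp)).clm_apply
      (hK.ξ_contDiffAt hy)
    have h2 := (hK.ξ_contDiffAt hy).fderiv_right (m := ∞) (by simp)
    have h3 := hK.φ_contDiffAt hy
    have h4 : ContDiffAt ℝ ∞ (lieHalf φ ξ) y := by
      unfold lieHalf
      exact ContDiffAt.const_smul (1 / 2 : ℝ) ((h1.sub (h2.clm_comp h3)).add (h3.clm_comp h2))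
    exact (differentiableAt_const v).add
      ((h4.differentiableAt (by simp)).clm_apply (differentiableAt_const v))
  have key : ∀ a c, G y (cov G a (cov G c (fun z => φ z Z)) y) W =
      G y (c + lieHalf φ ξ y c) Z * G y (gradField G ξ y a) W
      - (G y (gradField G ξ y a) Z + G y (ξ y) (conn G y a Z)) * G y (c + lieHalf φ ξ y c) W
      - G y (ξ y) (conn G y c Z) * G y (a + lieHalf φ ξ y a) W
      + G y (φ y (cov G a (cov G c (fun _ => Z)) y)) W := by
    intro a c
    have e1 : cov G c (fun z => φ z Z) =ᶠ[nhds y] fun z =>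
        (G z (c + lieHalf φ ξ z c) Z • ξ z - G z (ξ z) Z • (c + lieHalf φ ξ z c))
          + φ z (cov G c (fun _ => Z) z) := by
      refine (hM.eventually_mem hy).mono fun z hz => ?_
      simp only
      rw [cov_endo (hK.φ_diff hz) (differentiableAt_const Z), hK.covEnd_φ_eq hz]
    have d1 : DifferentiableAt ℝ (fun z => G z (c + lieHalf φ ξ z c) Z) y :=
      (hd.clm_apply (hB c)).clm_apply (differentiableAt_const Z)
    have d2 : DifferentiableAt ℝ (fun z => G z (ξ z) Z) y :=
      (hd.clm_apply (hK.ξ_diff hy)).clm_apply (differentiableAt_const Z)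
    have d3 : DifferentiableAt ℝ (cov G c (fun _ => Z)) y :=
      hM.cov_differentiableAt hy contDiffAt_const c
    have d4 := (hK.φ_diff hy).clm_apply d3
    have e2 : cov G a (cov G c (fun z => φ z Z)) y =
        (fderiv ℝ (fun z => G z (c + lieHalf φ ξ z c) Z) y a • ξ y
          + G y (c + lieHalf φ ξ y c) Z • cov G a ξ y)
        - (fderiv ℝ (fun z => G z (ξ z) Z) y a • (c + lieHalf φ ξ y c)
          + G y (ξ y) Z • cov G a (fun z => c + lieHalf φ ξ z c) y)
        + cov G a (fun z => φ z (cov G c (fun _ => Z) z)) y := by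
      simp only [cov_apply G a]
      rw [e1.fderiv_eq, e1.eq_of_nhds,
        fderiv_fun_add ((d1.fun_smul (hK.ξ_diff hy)).fun_sub (d2.fun_smul (hB c))) d4,
        fderiv_fun_sub (d1.fun_smul (hK.ξ_diff hy)) (d2.fun_smul (hB c)),
        fderiv_fun_smul d1 (hK.ξ_diff hy), fderiv_fun_smul d2 (hB c)]
      simp only [add_apply, sub_apply, smul_apply, ContinuousLinearMap.smulRight_apply, map_add,
        map_sub, map_smul, smul_add]
      abel
    have e3 := hM.fderiv_form hy (hK.ξ_diff hy) (W := fun _ => Z) (differentiableAt_const Z) a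
    rw [e2, cov_endo (hK.φ_diff hy) d3, hK.covEnd_φ_eq hy, e3, hZ, cov_const, cov_const,
      ← gradField_apply]
    simp only [map_add, map_sub, map_smul, add_apply, sub_apply, smul_apply, smul_eq_mul, hξW]
    ring
  have hφ : ContDiffAt ℝ ∞ (fun z => φ z Z) y := (hK.φ_contDiffAt hy).clm_apply contDiffAt_const
  rw [← hM.cov_comm hy hφ X Y, ← hM.cov_comm hy (V := fun _ => Z) contDiffAt_const X Y]
  simp only [map_sub, sub_apply]
  rw [key, key]
  ring

/-- The curvature of a `(κ, μ)`-contact space form on planes orthogonal to `ξ`: the difference `R` of the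
left hand side and `spaceFormCurv` is a curvature-like form on `ξ^⊥` that is invariant under
`J = φ`, by the Ricci identity for `φ`, and has vanishing holomorphic sectional curvature. -/
theorem form_curv_eq_spaceFormCurv {c : ℝ}
    (hc : ∀ u, G y u u = 1 → G y (ξ y) u = 0 → G y (curv G y u (φ y u) (φ y u)) u = c)
    {X Y : E} (hX : G y (ξ y) X = 0) (hY : G y (ξ y) Y = 0) :
    G y (curv G y X Y Y) X = spaceFormCurv (G y) (φ y) (lieHalf φ ξ y) c X Y Y X := by
  have hA := hK.almost y hy
  have hM := hK.metric
  let D := LinearMap.ker (G y (ξ y) : E →ₗ[ℝ] ℝ)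
  have hD : ∀ x : D, G y (ξ y) (x : E) = 0 := fun x => x.2
  let J : D → D := fun x => ⟨φ y x, hA.η_φ x⟩
  let R : D → D → D → D → ℝ := fun X Y Z W => G y (curv G y X Y Z) W
    - spaceFormCurv (G y) (φ y) (lieHalf φ ξ y) c X Y Z W
  have hh := hK.lieHalf_symm hy
  have hηh := hK.η_lieHalf hy
  have hs := hA.symm
  -- `⟨φ h ·, ·⟩` is symmetric
  have hφh : ∀ u v, G y (φ y (lieHalf φ ξ y u)) v = G y (φ y (lieHalf φ ξ y v)) u := by
    intro u v
    rw [hK.φ_lieHalf hy, hK.φ_lieHalf hy, hK.symGrad_symm hy, hs]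
  have hhs : ∀ u v, G y (lieHalf φ ξ y u) v = G y (lieHalf φ ξ y v) u := fun u v => by
    rw [hh, hs]
  have hφs : ∀ u v, G y u (φ y v) = -G y v (φ y u) := fun u v => by rw [hs, hA.skew]
  have key := sectional_eq_zero_of_holomorphic R J ?_ ?_ ?_ ?_ ?_ ?_ ?_ ?_ ?_ ⟨X, hX⟩ ⟨Y, hY⟩
  · exact sub_eq_zero.mp key
  · intro a a' b c d
    simp only [R, spaceFormCurv, curv, Submodule.coe_add, map_add, map_sub, add_apply, sub_apply]
    ring
  · intro a b c d
    simp only [R, spaceFormCurv]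
    rw [curv_antisymm, map_neg, neg_apply, hφs b a]
    ring
  · intro a b c d
    simp only [R, spaceFormCurv]
    rw [hM.form_curv_skew hy, hA.skew d c, hφs d c, hA.skew c d, hA.skew b c, hA.skew b d,
      hA.skew a c, hA.skew a d]
    ring
  · intro a b c d
    simp only [R, spaceFormCurv]
    rw [hM.form_curv_pair hy, hs d a, hs d b, hs c a, hs c b, hA.skew c d, hA.skew a b,
      hA.skew b d, hA.skew a d, hA.skew d b, hA.skew c b, hφs c b, hφs d b, hφs d a, hφs c a,
      hhs d a, hhs d b, hhs c a, hhs c b, hφh d a, hφh d b, hφh c a, hφh c b]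
    ring
  · intro a b c d
    have hB := congrArg (fun v => G y v d) (hM.curv_bianchi hy a b c)
    simp only [map_add, add_apply, map_zero, zero_apply] at hB
    simp only [R, spaceFormCurv]
    rw [hφs c a, hφs b a, hφs c b, hhs c a, hhs b a, hhs c b, hφh c a, hφh b a, hφh c b,
      hs b a, hs c a, hs c b]
    linear_combination hB
  · intro a b
    ext
    simp [J]
  · intro a
    ext
    simp only [J]
    exact hA.φφ_of_horizontal (hD a)
  · intro X Y Z W
    have h1 := hK.form_curv_φ hy X Y (hD Z) (hA.η_φ W)
    rw [hA.skew (curv G y X Y Z), hA.φφ_of_horizontal (hD W), map_neg, neg_neg] at h1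
    have e1 : ∀ u v, G y (φ y (lieHalf φ ξ y u)) (φ y v) = G y (lieHalf φ ξ y u) v :=
      fun u v => hA.form_φφ (hηh u)
    have e2 : ∀ u v, G y (lieHalf φ ξ y u) (φ y v) = -G y (φ y (lieHalf φ ξ y u)) v :=
      fun u v => by rw [hA.skew, neg_neg]
    simp only [R, J, spaceFormCurv]
    simp only [hK.grad_eq hy, map_add, map_sub, map_neg, add_apply, sub_apply, neg_apply, e1, e2]
      at h1
    rw [hA.form_φφ (hD X), hA.form_φφ (hD Y)] at h1
    simp only [e1, e2, hA.φφ_of_horizontal (hD Z), map_neg, neg_apply]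
    rw [hA.form_φφ (hD X), hA.form_φφ (hD Y)]
    rw [hA.skew X Z, hA.skew Y Z] at h1
    rw [hA.skew X W, hA.skew Y W, hA.skew Z W, hφs Z W]
    linear_combination h1
  · intro a
    by_cases ha : (a : E) = 0
    · simp [R, J, ha, spaceFormCurv, curv]
    have hpos := hM.pos y hy a ha
    obtain ⟨s, hs0, hs1⟩ : ∃ s : ℝ, s ≠ 0 ∧ s ^ 2 = G y a a :=
      ⟨√(G y a a), (Real.sqrt_pos.mpr hpos).ne', Real.sq_sqrt hpos.le⟩
    have h1 := hc (s⁻¹ • (a : E)) (by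
      simp only [map_smul, smul_apply, smul_eq_mul, ← hs1]; field_simp) (by
      rw [map_smul, hD a, smul_zero])
    have h2 : G y (curv G y a (φ y a) (φ y a)) a = c * s ^ 4 := by
      simp only [curv, map_smul, map_sub, map_add, smul_apply, add_apply, sub_apply, smul_eq_mul]
        at h1 ⊢
      field_simp at h1
      linarith
    simp only [R, J, spaceFormCurv]
    rw [h2]
    have e1 : ∀ u v, G y (φ y (lieHalf φ ξ y u)) (φ y v) = G y (lieHalf φ ξ y u) v :=
      fun u v => hA.form_φφ (hηh u)
    have e2 : ∀ u v, G y (lieHalf φ ξ y u) (φ y v) = -G y (φ y (lieHalf φ ξ y u)) v :=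
      fun u v => by rw [hA.skew, neg_neg]
    have e3 := hK.lieHalf_φ hy a
    have e4 := hA.skew_self a
    have e5 : G y a (φ y a) = 0 := by rw [hs, e4]
    simp only [e3, map_neg, neg_apply, e1, e2, hA.φφ_of_horizontal (hD a),
      hA.φφ_of_horizontal (hηh _), hA.form_φφ (hD a), e4, e5, neg_neg]
    rw [← hs1]
    ring

end IsKappaMuOn

/-! ### Orthonormal bases of a positive definite form -/

section Extension

/-- A family in a space with a positive definite form that is orthonormal on a set of indices
agrees on this set with an orthonormal basis. -/
theorem exists_orthonormal_extension {V : Type*} [AddCommGroup V] [Module ℝ V]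
    [FiniteDimensional ℝ V] (b : V → V → ℝ) (symm : ∀ x y, b x y = b y x)
    (add : ∀ x y z, b (x + y) z = b x z + b y z) (smul : ∀ (a : ℝ) x y, b (a • x) y = a * b x y)
    (pos : ∀ x, x ≠ 0 → 0 < b x x) {n : ℕ} (hn : Module.finrank ℝ V = n) (v : Fin n → V)
    (s : Set (Fin n)) (hv : ∀ i ∈ s, ∀ j ∈ s, b (v i) (v j) = if i = j then 1 else 0) :
    ∃ w : Fin n → V, (∀ i j, b (w i) (w j) = if i = j then 1 else 0) ∧ ∀ i ∈ s, w i = v i := by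
  let core : InnerProductSpace.Core ℝ V :=
    { inner := b
      conj_inner_symm := fun x y => by simpa using symm y x
      re_inner_nonneg := fun x => by
        by_cases hx : x = 0
        · have h0 : b 0 0 = 0 := by simpa using smul 0 (0 : V) 0
          simp [hx, h0]
        · simpa using (pos x hx).le
      add_left := add
      smul_left := fun x y r => by simpa using smul r x y
      definite := fun x hx => by
        by_contra h
        exact (pos x h).ne' hx }
  let _ : NormedAddCommGroup V := core.toNormedAddCommGroup
  let _ : InnerProductSpace ℝ V := InnerProductSpace.ofCore core.toCore
  have hin : ∀ x y : V, inner ℝ x y = b x y := fun _ _ => rfl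
  have hon : Orthonormal ℝ (s.domRestrict v) := by
    rw [orthonormal_iff_ite]
    intro i j
    rw [hin, Set.domRestrict_apply, Set.domRestrict_apply, hv i i.2 j j.2]
    simp [Subtype.ext_iff]
  obtain ⟨w, hw⟩ := hon.exists_orthonormalBasis_extension_of_card_eq (by simpa using hn)
  refine ⟨w, fun i j => ?_, hw⟩
  have := orthonormal_iff_ite.mp w.orthonormal i j
  rwa [hin] at this

end Extension

section Frames

variable {V W : Type*} [NormedAddCommGroup V] [NormedSpace ℝ V] [FiniteDimensional ℝ V]
  [NormedAddCommGroup W] [NormedSpace ℝ W]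

/-- `e` is an orthonormal family for the form `g`. -/
def IsON (g : V →L[ℝ] V →L[ℝ] ℝ) {k : ℕ} (e : Fin k → V) : Prop :=
  ∀ i j, g (e i) (e j) = if i = j then 1 else 0

namespace IsON

variable {g : V →L[ℝ] V →L[ℝ] ℝ} {n : ℕ} {e e' : Fin n → V}

theorem linearIndependent {k : ℕ} {e : Fin k → V} (he : IsON g e) : LinearIndependent ℝ e := by
  rw [Fintype.linearIndependent_iff]
  intro c hc i
  have := congrArg (fun x => g x (e i)) hc
  simpa [he _ i] using this

variable (hn : Module.finrank ℝ V = n) (he : IsON g e) (he' : IsON g e')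
include hn he

theorem expand (x : V) : x = ∑ k, g x (e k) • e k := by
  have hcard : Fintype.card (Fin n) = Module.finrank ℝ V := by simpa using hn.symm
  have hx : x ∈ Submodule.span ℝ (Set.range e) := by
    rw [he.linearIndependent.span_eq_top_of_card_eq_finrank' hcard]
    trivial
  obtain ⟨c, rfl⟩ := (Submodule.mem_span_range_iff_exists_fun ℝ).mp hx
  refine Finset.sum_congr rfl fun k _ => ?_
  congr 1
  simp [he _ k]

theorem parseval (x y : V) : g x y = ∑ k, g x (e k) * g (e k) y := by
  conv_lhs => rw [expand hn he x]
  simp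

theorem eq_zero (x : V) (hx : ∀ k, g x (e k) = 0) : x = 0 := by
  rw [expand hn he x]
  simp [hx]

include he'

/-- The trace of a bilinear map does not depend on the orthonormal basis. -/
theorem trace_eq {X : Type*} [AddCommGroup X] [Module ℝ X] (hs : ∀ x y, g x y = g y x)
    (B : V →ₗ[ℝ] V →ₗ[ℝ] X) : ∑ i, B (e i) (e i) = ∑ i, B (e' i) (e' i) := by
  have h1 : ∀ i, B (e i) (e i) =
      ∑ k, ∑ l, (g (e i) (e' k) * g (e i) (e' l)) • B (e' k) (e' l) := by
    intro i
    conv_lhs => rw [expand hn he' (e i)]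
    simp only [map_sum, LinearMap.sum_apply, Finset.smul_sum, smul_smul, map_smul,
      LinearMap.smul_apply]
    rw [Finset.sum_comm]
    exact Finset.sum_congr rfl fun k _ => Finset.sum_congr rfl fun l _ => by rw [mul_comm]
  simp_rw [h1]
  rw [Finset.sum_comm]
  refine Finset.sum_congr rfl fun k _ => ?_
  rw [Finset.sum_comm]
  have h2 : ∀ l, ∑ i, (g (e i) (e' k) * g (e i) (e' l)) • B (e' k) (e' l) =
      (if k = l then (1 : ℝ) else 0) • B (e' k) (e' l) := by
    intro l
    rw [← Finset.sum_smul, ← he' k l, parseval hn he (e' k) (e' l)]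
    simp_rw [hs (e' k)]
  simp_rw [h2]
  simp

end IsON

/-! ### The inequality for the second fundamental form -/

variable (b : W →L[ℝ] W →L[ℝ] ℝ) (s : V →L[ℝ] V →L[ℝ] W)

/-- `∑_{i,j} |s(e_i, e_j)|²`. -/
def sqSum {n : ℕ} (e : Fin n → V) : ℝ := ∑ i, ∑ j, b (s (e i) (e j)) (s (e i) (e j))

/-- The contribution `⟨s(u, u), s(v, v)⟩ - |s(u, v)|²` of the second fundamental form to the sectional
curvature. -/
def gaussTerm (u v : V) : ℝ := b (s u u) (s v v) - b (s u v) (s u v)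

variable {b s} {g : V →L[ℝ] V →L[ℝ] ℝ} {n : ℕ}

theorem sqSum_eq (hn : Module.finrank ℝ V = n) (hs : ∀ x y, g x y = g y x) {e e' : Fin n → V}
    (he : IsON g e) (he' : IsON g e') : sqSum b s e = sqSum b s e' := by
  have h1 : ∀ x, ∑ j, b (s x (e j)) (s x (e j)) = ∑ j, b (s x (e' j)) (s x (e' j)) := by
    intro x
    let B : V →ₗ[ℝ] V →ₗ[ℝ] ℝ := LinearMap.mk₂ ℝ (fun y z => b (s x y) (s x z))
      (by intros; simp) (by intros; simp) (by intros; simp) (by intros; simp)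
    exact IsON.trace_eq hn he he' hs B
  have h2 : ∀ y, ∑ i, b (s (e i) y) (s (e i) y) = ∑ i, b (s (e' i) y) (s (e' i) y) := by
    intro y
    let B : V →ₗ[ℝ] V →ₗ[ℝ] ℝ := LinearMap.mk₂ ℝ (fun x z => b (s x y) (s z y))
      (by intros; simp) (by intros; simp) (by intros; simp) (by intros; simp)
    exact IsON.trace_eq hn he he' hs B
  simp only [sqSum, h1]
  rw [Finset.sum_comm]
  simp only [h2]
  rw [Finset.sum_comm]

theorem trace_sff_eq (hn : Module.finrank ℝ V = n) (hs : ∀ x y, g x y = g y x) {e e' : Fin n → V}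
    (he : IsON g e) (he' : IsON g e') : ∑ i, s (e i) (e i) = ∑ i, s (e' i) (e' i) := by
  let B : V →ₗ[ℝ] V →ₗ[ℝ] W := LinearMap.mk₂ ℝ (fun x z => s x z)
      (by intros; simp) (by intros; simp) (by intros; simp) (by intros; simp)
  exact IsON.trace_eq hn he he' hs B

/-- The Gauss term depends only on the plane. -/
theorem gaussTerm_eq (hb : ∀ x y, b x y = b y x) (hss : ∀ x y, s x y = s y x) {u v : V}
    {α β γ δ : ℝ}
    (h1 : α ^ 2 + β ^ 2 = 1) (h2 : γ ^ 2 + δ ^ 2 = 1) (h3 : α * γ + β * δ = 0) :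
    gaussTerm b s (α • u + β • v) (γ • u + δ • v) = gaussTerm b s u v := by
  have hdet : (α * δ - β * γ) ^ 2 = 1 := by
    have : (α * δ - β * γ) ^ 2 = (α ^ 2 + β ^ 2) * (γ ^ 2 + δ ^ 2) - (α * γ + β * δ) ^ 2 := by ring
    rw [this, h1, h2, h3]; ring
  have : gaussTerm b s (α • u + β • v) (γ • u + δ • v)
      = (α * δ - β * γ) ^ 2 * gaussTerm b s u v := by
    simp only [gaussTerm, map_add, map_smul, add_apply, smul_apply, smul_eq_mul]
    rw [hss v u, hb (s v v) (s u u), hb (s u v) (s u u), hb (s u v) (s v v)]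
    ring
  rw [this, hdet, one_mul]

/-- The difference `(1/2) (∑ |s(e_i, e_j)|² - |tr s|² / (n - 1)) + ⟨s(u, u), s(v, v)⟩ - |s(u, v)|²` of the
two sides of the inequality. -/
def defect (b : W →L[ℝ] W →L[ℝ] ℝ) (s : V →L[ℝ] V →L[ℝ] W) (e : Fin n → V) (u v : V) : ℝ :=
  1 / 2 * (sqSum b s e - 1 / ((n : ℝ) - 1) * b (∑ i, s (e i) (e i)) (∑ i, s (e i) (e i)))
    + gaussTerm b s u v

/-- The Cauchy-Schwarz inequality for a sum of `k` vectors. -/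
theorem form_sum_le (hb : ∀ x y, b x y = b y x) (hpos : ∀ x, x ≠ 0 → 0 < b x x) {ι : Type*}
    (t : Finset ι) (w : ι → W) :
    b (∑ i ∈ t, w i) (∑ i ∈ t, w i) ≤ t.card * ∑ i ∈ t, b (w i) (w i) := by
  have hnn : ∀ x, 0 ≤ b x x := fun x => by
    by_cases hx : x = 0
    · simp [hx]
    · exact (hpos x hx).le
  have h1 : b (∑ i ∈ t, w i) (∑ i ∈ t, w i) = ∑ i ∈ t, ∑ j ∈ t, b (w i) (w j) := by
    simp [map_sum]
    rw [Finset.sum_comm]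
  have h2 : ∀ i j, b (w i) (w j) ≤ 1 / 2 * (b (w i) (w i) + b (w j) (w j)) := by
    intro i j
    have := hnn (w i - w j)
    simp only [map_sub, sub_apply] at this
    rw [hb (w j) (w i)] at this
    linarith
  rw [h1]
  calc _ ≤ ∑ i ∈ t, ∑ j ∈ t, 1 / 2 * (b (w i) (w i) + b (w j) (w j)) :=
        Finset.sum_le_sum fun i _ => Finset.sum_le_sum fun j _ => h2 i j
    _ = _ := by
        simp only [← Finset.mul_sum, Finset.sum_add_distrib, Finset.sum_const, nsmul_eq_mul]
        ring

theorem _root_.Fin.sum_univ_add_three {M : Type*} [AddCommMonoid M] {k : ℕ} (f : Fin (k + 3) → M) :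
    ∑ i, f i = f 0 + f 1 + ∑ i : Fin (k + 1), f i.succ.succ := by
  rw [Fin.sum_univ_succ, Fin.sum_univ_succ, ← add_assoc]
  rfl

/-- The defect in an adapted basis: the plane is spanned by `e 0`, `e 1`, and `s` vanishes on the
last vector `ξ` of the basis. Because of this, the trace is a sum of `n - 2` vectors only, namely
`s(e 0, e 0) + s(e 1, e 1)` and `s(e i, e i)` for `2 ≤ i < n - 1`. The Cauchy-Schwarz inequality with
`n - 2` in place of `n - 1` is strict unless all of them vanish, which gives the equality case. -/
theorem defect_adapted (hb : ∀ x y, b x y = b y x) (hpos : ∀ x, x ≠ 0 → 0 < b x x)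
    (hss : ∀ x y, s x y = s y x) (k : ℕ) (e : Fin (k + 3) → V)
    (hlast : s (e (Fin.last _)) (e (Fin.last _)) = 0) :
    0 ≤ defect b s e (e 0) (e 1) ∧ (defect b s e (e 0) (e 1) = 0 ↔
      s (e 0) (e 0) + s (e 1) (e 1) = 0 ∧
        ∀ i j : Fin (k + 3), 2 ≤ i.val → s (e i) (e j) = 0) := by
  have hnn : ∀ x, 0 ≤ b x x := fun x => by
    by_cases hx : x = 0
    · simp [hx]
    · exact (hpos x hx).le
  have hzero : ∀ x, b x x = 0 → x = 0 := fun x hx => by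
    by_contra h
    exact (hpos x h).ne' hx
  set m := s (e 0) (e 0) + s (e 1) (e 1) with hm
  -- the vectors `s(e_i, e_j)` with `i ≥ 2`
  let q : Fin (k + 1) → Fin (k + 3) := fun i => i.succ.succ
  have htr : ∑ i, s (e i) (e i) = m + ∑ i, s (e (q i)) (e (q i)) := by
    rw [Fin.sum_univ_add_three]
  have htr' : m + ∑ i, s (e (q i)) (e (q i))
      = m + ∑ i : Fin k, s (e (q i.castSucc)) (e (q i.castSucc)) := by
    rw [Fin.sum_univ_castSucc]
    have : q (Fin.last k) = Fin.last _ := rfl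
    rw [this, hlast, add_zero]
  -- the trace is a sum of `k + 1` vectors, as one of the `k + 2` vectors vanishes
  have hCS : b (∑ i, s (e i) (e i)) (∑ i, s (e i) (e i)) ≤
      (k + 1 : ℝ) * (b m m + ∑ i, b (s (e (q i)) (e (q i))) (s (e (q i)) (e (q i)))) := by
    have h1 := form_sum_le hb hpos (Finset.univ : Finset (Fin (k + 1)))
      (Fin.cons m fun i : Fin k => s (e (q i.castSucc)) (e (q i.castSucc)))
    rw [Fin.sum_univ_succ, Fin.sum_univ_succ] at h1
    simp only [Fin.cons_zero, Fin.cons_succ, Finset.card_univ, Fintype.card_fin] at h1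
    rw [htr, htr', Fin.sum_univ_castSucc]
    have : q (Fin.last k) = Fin.last _ := rfl
    rw [this, hlast]
    push_cast at h1
    simpa using h1
  -- `d`, `r`, `o` collect the squares of the diagonal terms and of the off-diagonal ones
  set d := ∑ i, b (s (e (q i)) (e (q i))) (s (e (q i)) (e (q i))) with hd
  set r := ∑ i, ∑ j, if q i = j then 0 else b (s (e (q i)) (e j)) (s (e (q i)) (e j)) with hr
  set o := ∑ i, (b (s (e 0) (e (q i))) (s (e 0) (e (q i)))
    + b (s (e 1) (e (q i))) (s (e 1) (e (q i)))) with ho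
  have hsq : sqSum b s e = b (s (e 0) (e 0)) (s (e 0) (e 0)) + b (s (e 1) (e 1)) (s (e 1) (e 1))
      + 2 * b (s (e 0) (e 1)) (s (e 0) (e 1)) + o + d + r := by
    have h0 : ∀ i, ∑ j, b (s (e i) (e j)) (s (e i) (e j)) =
        b (s (e i) (e 0)) (s (e i) (e 0)) + b (s (e i) (e 1)) (s (e i) (e 1))
          + ∑ j, b (s (e i) (e (q j))) (s (e i) (e (q j))) := by
      intro i
      rw [Fin.sum_univ_add_three]
    have h1 : ∀ i, ∑ j, b (s (e (q i)) (e j)) (s (e (q i)) (e j)) =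
        b (s (e (q i)) (e (q i))) (s (e (q i)) (e (q i)))
          + ∑ j, if q i = j then 0 else b (s (e (q i)) (e j)) (s (e (q i)) (e j)) := by
      intro i
      rw [← Finset.add_sum_erase _ _ (Finset.mem_univ (q i)),
        ← Finset.add_sum_erase _ (fun j => if q i = j then 0 else _) (Finset.mem_univ (q i))]
      simp only [if_true, zero_add]
      congr 1
      refine Finset.sum_congr rfl fun j hj => ?_
      rw [if_neg (Finset.ne_of_mem_erase hj).symm]
    have h2 : sqSum b s e = (∑ j, b (s (e 0) (e j)) (s (e 0) (e j)))
        + (∑ j, b (s (e 1) (e j)) (s (e 1) (e j)))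
        + ∑ i, ∑ j, b (s (e (q i)) (e j)) (s (e (q i)) (e j)) := by
      rw [sqSum, Fin.sum_univ_add_three]
    rw [h2, h0 0, h0 1]
    simp_rw [h1]
    rw [Finset.sum_add_distrib, ho, Finset.sum_add_distrib, hss (e 1) (e 0)]
    ring
  have hmm : b m m = b (s (e 0) (e 0)) (s (e 0) (e 0)) + b (s (e 1) (e 1)) (s (e 1) (e 1))
      + 2 * b (s (e 0) (e 0)) (s (e 1) (e 1)) := by
    rw [hm]
    simp only [map_add, add_apply]
    rw [hb (s (e 1) (e 1)) (s (e 0) (e 0))]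
    ring
  have hk : (0 : ℝ) < k + 2 := by positivity
  set t := b (∑ i, s (e i) (e i)) (∑ i, s (e i) (e i)) with ht
  have hdef : defect b s e (e 0) (e 1) = 1 / 2 * (b m m + d - 1 / (k + 2) * t) + 1 / 2 * (o + r) := by
    rw [defect, hsq, gaussTerm, hmm]
    have : (((k + 3 : ℕ) : ℝ) - 1) = k + 2 := by push_cast; ring
    rw [this]
    ring
  have hd0 : 0 ≤ d := Finset.sum_nonneg fun i _ => hnn _
  have hr0 : 0 ≤ r := Finset.sum_nonneg fun i _ => Finset.sum_nonneg fun j _ => by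
    split_ifs
    · exact le_rfl
    · exact hnn _
  have ho0 : 0 ≤ o := Finset.sum_nonneg fun i _ => add_nonneg (hnn _) (hnn _)
  have hm0 := hnn m
  have hlow : 1 / (k + 2) * (b m m + d) ≤ b m m + d - 1 / (k + 2) * t := by
    have h1 : 1 / (k + 2 : ℝ) * t ≤ 1 / (k + 2) * ((k + 1) * (b m m + d)) :=
      mul_le_mul_of_nonneg_left hCS (by positivity)
    have h2 : 1 / (k + 2 : ℝ) * ((k + 1) * (b m m + d))
        = (b m m + d) - 1 / (k + 2) * (b m m + d) := by
      field_simp; ring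
    linarith
  have hfrac : 0 < 1 / (k + 2 : ℝ) := by positivity
  refine ⟨?_, ?_, ?_⟩
  · rw [hdef]
    have : 0 ≤ 1 / (k + 2 : ℝ) * (b m m + d) := by positivity
    linarith
  · intro h0
    rw [hdef] at h0
    have h1 : 0 ≤ 1 / (k + 2 : ℝ) * (b m m + d) := by positivity
    have h2 : 1 / (k + 2 : ℝ) * (b m m + d) = 0 := by linarith
    have h3 : b m m + d = 0 := (mul_eq_zero.mp h2).resolve_left hfrac.ne'
    have h4 : b m m = 0 := by linarith
    have h5 : d = 0 := by linarith
    have h6 : r = 0 := by linarith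
    refine ⟨hzero m h4, fun i j hi => hzero _ ?_⟩
    obtain ⟨l, rfl⟩ : ∃ l, q l = i := ⟨⟨i.val - 2, by omega⟩, by ext; simp [q]; omega⟩
    by_cases hj : q l = j
    · rw [← hj]
      exact (Finset.sum_eq_zero_iff_of_nonneg fun i _ => hnn _).mp h5 l (Finset.mem_univ l)
    · have h7 := (Finset.sum_eq_zero_iff_of_nonneg fun i _ => Finset.sum_nonneg fun j _ => by
        split_ifs
        · exact le_rfl
        · exact hnn _).mp h6 l (Finset.mem_univ l)
      have h8 := (Finset.sum_eq_zero_iff_of_nonneg fun j _ => by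
        split_ifs
        · exact le_rfl
        · exact hnn _).mp h7 j (Finset.mem_univ j)
      rwa [if_neg hj] at h8
  · rintro ⟨h1, h2⟩
    have hq : ∀ i, 2 ≤ (q i).val := fun i => by simp [q]
    have e1 : d = 0 := Finset.sum_eq_zero fun i _ => by rw [h2 _ _ (hq i)]; simp
    have e2 : r = 0 := Finset.sum_eq_zero fun i _ => Finset.sum_eq_zero fun j _ => by
      rw [h2 _ _ (hq i)]; simp
    have e3 : o = 0 := Finset.sum_eq_zero fun i _ => by
      rw [hss (e 0), hss (e 1), h2 _ _ (hq i), h2 _ _ (hq i)]; simp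
    have e4 : t = 0 := by
      rw [ht, htr, h1]
      have : ∑ i, s (e (q i)) (e (q i)) = 0 := Finset.sum_eq_zero fun i _ => h2 _ _ (hq i)
      rw [this]; simp
    rw [hdef, e1, e2, e3, e4, h1]
    simp

end Frames

/-! ### The equality case -/

section Equality

variable {V W : Type*} [NormedAddCommGroup V] [NormedSpace ℝ V] [FiniteDimensional ℝ V]
  [NormedAddCommGroup W] [NormedSpace ℝ W] [FiniteDimensional ℝ W]
  {g : V →L[ℝ] V →L[ℝ] ℝ} {b : W →L[ℝ] W →L[ℝ] ℝ} {L : V →L[ℝ] W} {s : V →L[ℝ] V →L[ℝ] W}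
  {n N : ℕ}

theorem isON_pair {e : Fin 2 → V} (h0 : g (e 0) (e 0) = 1) (h1 : g (e 1) (e 1) = 1)
    (h01 : g (e 0) (e 1) = 0) (h10 : g (e 1) (e 0) = 0) : IsON g e := by
  intro i j
  fin_cases i <;> fin_cases j <;> simp_all

/-- Planes with orthonormal bases `u` and `f 0, f 1` that coincide have the same defect. -/
theorem defect_eq_of_span_eq (hn : Module.finrank ℝ V = n) (hg : ∀ x y, g x y = g y x)
    (hb : ∀ x y, b x y = b y x) (hss : ∀ x y, s x y = s y x) {e f : Fin n → V}
    (he : IsON g e) (hf : IsON g f) {u : Fin 2 → V} (hu : IsON g u) {i j : Fin n} (hij : i ≠ j)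
    (hspan : Submodule.span ℝ (Set.range u) = Submodule.span ℝ {f i, f j}) :
    defect b s e (u 0) (u 1) = defect b s f (f i) (f j) := by
  have hmem : ∀ l, ∃ α β : ℝ, α • f i + β • f j = u l := fun l => by
    have h1 : u l ∈ Submodule.span ℝ {f i, f j} := by
      rw [← hspan]
      exact Submodule.subset_span ⟨l, rfl⟩
    exact Submodule.mem_span_pair.mp h1
  obtain ⟨α, β, h0⟩ := hmem 0
  obtain ⟨γ, δ, h1⟩ := hmem 1
  have u00 := hu 0 0
  have u11 := hu 1 1
  have u01 := hu 0 1
  rw [← h0] at u00 u01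
  rw [← h1] at u11 u01
  have fii := hf i i
  have fjj := hf j j
  have fij := hf i j
  have fji := hf j i
  rw [if_pos rfl] at fii fjj
  rw [if_neg hij] at fij
  rw [if_neg hij.symm] at fji
  simp only [map_add, map_smul, add_apply, smul_apply, smul_eq_mul, fii, fjj, fij, fji, if_true]
    at u00 u11 u01
  rw [if_neg (by decide)] at u01
  rw [defect, defect, sqSum_eq hn hg he hf, trace_sff_eq hn hg he hf, ← h0, ← h1,
    gaussTerm_eq hb hss (by linarith) (by linarith) (by linarith)]

/-- An orthonormal basis of the image of `L` followed by one of its orthogonal complement. -/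
theorem isON_append (hb : ∀ x y, b x y = b y x) (hL : ∀ x y, b (L x) (L y) = g x y)
    {e : Fin n → V} (he : IsON g e)
    {ν : Fin (N - n) → W} (hν : IsON b ν) (hνL : ∀ r v, b (ν r) (L v) = 0) :
    IsON b (fun i : Fin N => if h : i.val < n then L (e ⟨i, h⟩) else ν ⟨i - n, by omega⟩) := by
  intro i j
  by_cases hi : i.val < n <;> by_cases hj : j.val < n
  · simp only [hi, hj, dif_pos, hL]
    rw [he ⟨i, hi⟩ ⟨j, hj⟩]
    simp only [Fin.ext_iff]
  · simp only [hi, hj, dif_pos, dif_neg, not_false_eq_true]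
    rw [hb, hνL, if_neg (by rintro rfl; exact hj hi)]
  · simp only [hi, hj, dif_pos, dif_neg, not_false_eq_true]
    rw [hνL, if_neg (by rintro rfl; exact hi hj)]
  · simp only [hi, hj, dif_neg, not_false_eq_true]
    rw [hν]
    simp only [Fin.ext_iff]
    congr 1
    rw [eq_iff_iff]
    omega

/-- A normal vector that is orthogonal to a normal frame vanishes. -/
theorem eq_zero_of_normal (hN : Module.finrank ℝ W = N) (hb : ∀ x y, b x y = b y x)
    (hL : ∀ x y, b (L x) (L y) = g x y)
    {e : Fin n → V} (he : IsON g e)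
    {ν : Fin (N - n) → W} (hν : IsON b ν) (hνL : ∀ r v, b (ν r) (L v) = 0) {x : W}
    (hx : ∀ v, b x (L v) = 0) (hxν : ∀ r, b x (ν r) = 0) : x = 0 := by
  refine IsON.eq_zero hN (isON_append hb hL he hν hνL) x fun k => ?_
  by_cases hk : k.val < n
  · simp [hk, hx]
  · simp [hk, hxν]

/-- The normal space of the image of `L` has an orthonormal basis of `N - n` vectors. -/
theorem exists_normal_frame (hn : Module.finrank ℝ V = n) (hN : Module.finrank ℝ W = N)
    (hb : ∀ x y, b x y = b y x) (hpos : ∀ x, x ≠ 0 → 0 < b x x)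
    (hgpos : ∀ x, x ≠ 0 → 0 < g x x)
    (hL : ∀ x y, b (L x) (L y) = g x y) {e : Fin n → V} (he : IsON g e) :
    ∃ ν : Fin (N - n) → W, IsON b ν ∧ ∀ r v, b (ν r) (L v) = 0 := by
  have hinj : Function.Injective (L : V →ₗ[ℝ] W) := by
    rw [← LinearMap.ker_eq_bot, LinearMap.ker_eq_bot']
    intro v hv
    by_contra h
    have h1 := hgpos v h
    have h2 : L v = 0 := hv
    rw [← hL, h2] at h1
    simp at h1
  have hle : n ≤ N := by
    rw [← hn, ← hN]
    exact LinearMap.finrank_le_finrank_of_injective hinj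
  obtain ⟨w, hw, hwe⟩ := exists_orthonormal_extension (fun x y => b x y) hb
    (fun x y z => by simp) (fun a x y => by simp) hpos hN
    (fun i : Fin N => if h : i.val < n then L (e ⟨i, h⟩) else 0) {i | i.val < n}
    (fun i hi j hj => by
      have hi' : i.val < n := hi
      have hj' : j.val < n := hj
      simp only [hi', hj', dif_pos, hL]
      rw [he ⟨i, hi'⟩ ⟨j, hj'⟩]
      simp only [Fin.ext_iff])
  refine ⟨fun r => w ⟨n + r, by omega⟩, fun i j => ?_, fun r v => ?_⟩
  · simp only [hw, Fin.ext_iff]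
    congr 1
    rw [eq_iff_iff]
    omega
  · rw [IsON.expand hn he v, map_sum, map_sum]
    refine Finset.sum_eq_zero fun k _ => ?_
    have h1 : w ⟨k, by omega⟩ = L (e k) := by
      rw [hwe ⟨k, by omega⟩ k.2]
      simp
    rw [map_smul, map_smul, ← h1, hw, if_neg (by simp [Fin.ext_iff]; omega), smul_zero]

/-- The shape operator of `ν` in the frame `f` is a block matrix. -/
theorem shape_eq_blockMatrix {k : ℕ} (hss : ∀ x y, s x y = s y x) {f : Fin (k + 3) → V}
    (h01 : s (f 0) (f 0) + s (f 1) (f 1) = 0)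
    (h2 : ∀ i j : Fin (k + 3), 2 ≤ i.val → s (f i) (f j) = 0) (w : W) :
    Matrix.of (fun i j => b (s (f i) (f j)) w)
      = blockMatrix (k + 3) (b (s (f 0) (f 0)) w) (b (s (f 0) (f 1)) w) := by
  ext i j
  simp only [blockMatrix, Matrix.of_apply]
  have h11 : s (f 1) (f 1) = -s (f 0) (f 0) := (neg_eq_of_add_eq_zero_right h01).symm
  have hc : ∀ i : Fin (k + 3), i = 0 ∨ i = 1 ∨ 2 ≤ i.val := by
    intro i
    by_cases h0 : i.val = 0
    · exact Or.inl (Fin.ext h0)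
    · by_cases h1 : i.val = 1
      · exact Or.inr (Or.inl (Fin.ext (by simpa using h1)))
      · exact Or.inr (Or.inr (by omega))
  rcases hc i with rfl | rfl | hi
  · rcases hc j with rfl | rfl | hj
    · simp
    · simp
    · rw [hss, h2 _ _ hj]
      have n0 : j.val ≠ 0 := by omega
      have n1 : j.val ≠ 1 := by omega
      simp [n0, n1]
  · rcases hc j with rfl | rfl | hj
    · simp [hss (f 1) (f 0)]
    · simp [h11]
    · rw [hss, h2 _ _ hj]
      have n0 : j.val ≠ 0 := by omega
      have n1 : j.val ≠ 1 := by omega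
      simp [n0, n1]
  · rw [h2 _ _ hi]
    have n0 : i.val ≠ 0 := by omega
    have n1 : i.val ≠ 1 := by omega
    simp [n0, n1]

/-- A rotation of an orthonormal pair that makes the off-diagonal entry `⟨s(u 0, u 1), w⟩` vanish. The
angle is half of the argument of `(⟨s(u 0, u 0), w⟩ - ⟨s(u 1, u 1), w⟩) / 2 + i ⟨s(u 0, u 1), w⟩`. -/
theorem exists_rotation (hss : ∀ x y, s x y = s y x)
    {u : Fin 2 → V} (hu : IsON g u) (w : W) :
    ∃ u' : Fin 2 → V, IsON g u' ∧
      Submodule.span ℝ (Set.range u) = Submodule.span ℝ {u' 0, u' 1} ∧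
      b (s (u' 0) (u' 1)) w = 0 := by
  set p := (b (s (u 0) (u 0)) w - b (s (u 1) (u 1)) w) / 2 with hp
  set q := b (s (u 0) (u 1)) w with hq
  set z : ℂ := ⟨p, q⟩ with hz
  set θ := Complex.arg z / 2 with hθ
  set C := Real.cos θ with hC
  set S := Real.sin θ with hS
  have hCS : C ^ 2 + S ^ 2 = 1 := by rw [hC, hS]; exact Real.cos_sq_add_sin_sq θ
  have h2θ : Complex.arg z = 2 * θ := by rw [hθ]; ring
  have e1 : ‖z‖ * Real.cos (2 * θ) = p := by rw [← h2θ]; exact Complex.norm_mul_cos_arg z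
  have e2 : ‖z‖ * Real.sin (2 * θ) = q := by rw [← h2θ]; exact Complex.norm_mul_sin_arg z
  have e3 : q * (C ^ 2 - S ^ 2) - 2 * p * (C * S) = 0 := by
    have h1 : C ^ 2 - S ^ 2 = Real.cos (2 * θ) := by rw [Real.cos_two_mul']
    have h2 : 2 * (C * S) = Real.sin (2 * θ) := by rw [Real.sin_two_mul, hC, hS]; ring
    have h3 : q * (C ^ 2 - S ^ 2) - 2 * p * (C * S)
        = q * Real.cos (2 * θ) - p * Real.sin (2 * θ) := by rw [← h1, ← h2]; ring
    rw [h3, ← e1, ← e2]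
    ring
  have u00 := hu 0 0
  have u11 := hu 1 1
  have u01 := hu 0 1
  have u10 := hu 1 0
  rw [if_pos rfl] at u00 u11
  rw [if_neg (by decide)] at u01 u10
  refine ⟨![C • u 0 + S • u 1, (-S) • u 0 + C • u 1], ?_, ?_, ?_⟩
  · refine isON_pair ?_ ?_ ?_ ?_ <;>
      simp only [Matrix.cons_val_zero, Matrix.cons_val_one, map_add, map_smul, add_apply,
        smul_apply, smul_eq_mul, u00, u11, u01, u10] <;> linarith
  · apply le_antisymm
    · rw [Submodule.span_le]
      rintro _ ⟨l, rfl⟩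
      refine Submodule.mem_span_pair.mpr ?_
      have hl : l = 0 ∨ l = 1 := by omega
      rcases hl with rfl | rfl
      · refine ⟨C, -S, ?_⟩
        simp only [Matrix.cons_val_zero, Matrix.cons_val_one]
        calc _ = (C ^ 2 + S ^ 2) • u 0 := by module
          _ = _ := by rw [hCS, one_smul]
      · refine ⟨S, C, ?_⟩
        simp only [Matrix.cons_val_zero, Matrix.cons_val_one]
        calc _ = (C ^ 2 + S ^ 2) • u 1 := by module
          _ = _ := by rw [hCS, one_smul]
    · rw [Submodule.span_le]
      have m0 : u 0 ∈ Submodule.span ℝ (Set.range u) := Submodule.subset_span ⟨0, rfl⟩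
      have m1 : u 1 ∈ Submodule.span ℝ (Set.range u) := Submodule.subset_span ⟨1, rfl⟩
      rintro x (rfl | rfl)
      · exact Submodule.add_mem _ (Submodule.smul_mem _ _ m0) (Submodule.smul_mem _ _ m1)
      · exact Submodule.add_mem _ (Submodule.smul_mem _ _ m0) (Submodule.smul_mem _ _ m1)
  · simp only [Matrix.cons_val_zero, Matrix.cons_val_one, map_add, map_smul, add_apply,
      smul_apply, smul_eq_mul]
    rw [hss (u 1) (u 0), ← hq]
    have : b (s (u 0) (u 0)) w - b (s (u 1) (u 1)) w = 2 * p := by rw [hp]; ring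
    linear_combination e3 - C * S * this

/-- The defect is nonnegative, and it vanishes exactly for the shape operators of the equality
case. The first two basis vectors span the plane and are rotated so that the shape operator of the
first normal vector is diagonal. -/
theorem defect_nonneg_and_eq_zero_iff (hn3 : 3 ≤ n) (hn : Module.finrank ℝ V = n)
    (hN : Module.finrank ℝ W = N)
    (hg : ∀ x y, g x y = g y x) (hgpos : ∀ x, x ≠ 0 → 0 < g x x)
    (hb : ∀ x y, b x y = b y x) (hpos : ∀ x, x ≠ 0 → 0 < b x x)
    (hL : ∀ x y, b (L x) (L y) = g x y)
    (hss : ∀ x y, s x y = s y x) (hsL : ∀ x y v, b (s x y) (L v) = 0)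
    {ζ : V} (hζ : g ζ ζ = 1) (hsζ : s ζ ζ = 0) {e : Fin n → V} (he : IsON g e)
    {u : Fin 2 → V} (hu : IsON g u) (huζ : ∀ l, g (u l) ζ = 0) :
    0 ≤ defect b s e (u 0) (u 1) ∧ (defect b s e (u 0) (u 1) = 0 ↔
      ∃ (f : Fin n → V) (ν : Fin (N - n) → W), IsON g f ∧ IsON b ν ∧ (∀ r v, b (ν r) (L v) = 0) ∧
        f ⟨n - 1, by omega⟩ = ζ ∧
        Submodule.span ℝ (Set.range u) = Submodule.span ℝ {f ⟨0, by omega⟩, f ⟨1, by omega⟩} ∧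
        (∀ r, r.val = 0 → ∃ a : ℝ,
          Matrix.of (fun i j => b (s (f i) (f j)) (ν r)) = blockMatrix n a 0) ∧
        (∀ r, 0 < r.val → ∃ c' d' : ℝ,
          Matrix.of (fun i j => b (s (f i) (f j)) (ν r)) = blockMatrix n c' d')) := by
  obtain ⟨k, rfl⟩ : ∃ k, n = k + 3 := ⟨n - 3, by omega⟩
  have i0 : (⟨0, by omega⟩ : Fin (k + 3)) = 0 := rfl
  have i1 : (⟨1, by omega⟩ : Fin (k + 3)) = 1 := rfl
  have il : (⟨k + 3 - 1, by omega⟩ : Fin (k + 3)) = Fin.last _ := rfl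
  have h01 : (0 : Fin (k + 3)) ≠ 1 := by simp
  rw [i0, i1, il]
  obtain ⟨ν, hν, hνL⟩ := exists_normal_frame hn hN hb hpos hgpos hL he
  -- the first normal vector; there is none if `N = n`, and then any value does
  let w : W := if h : 0 < N - (k + 3) then ν ⟨0, h⟩ else 0
  obtain ⟨u', hu', hspan, hw⟩ := exists_rotation (b := b) hss hu w
  have hζu : ∀ x ∈ Submodule.span ℝ (Set.range u), g x ζ = 0 := by
    intro x hx
    induction hx using Submodule.span_induction with
    | mem x hx => obtain ⟨l, rfl⟩ := hx; exact huζ l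
    | zero => simp
    | add x y _ _ hx hy => simp [hx, hy]
    | smul a x _ hx => simp [hx]
  have h0ζ : g (u' 0) ζ = 0 := hζu _ (by rw [hspan]; exact Submodule.subset_span (by simp))
  have h1ζ : g (u' 1) ζ = 0 := hζu _ (by rw [hspan]; exact Submodule.subset_span (by simp))
  -- an orthonormal basis that begins with `u'` and ends with `ζ`
  have hl0 : Fin.last (k + 2) ≠ (0 : Fin (k + 3)) := by simp [Fin.ext_iff]
  have hl1 : Fin.last (k + 2) ≠ (1 : Fin (k + 3)) := by simp [Fin.ext_iff]
  obtain ⟨f, hf, hfe⟩ := exists_orthonormal_extension (fun x y => g x y) hg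
    (fun x y z => by simp) (fun a x y => by simp) hgpos hn
    (fun i : Fin (k + 3) => if i = 0 then u' 0 else if i = 1 then u' 1 else ζ)
    {0, 1, Fin.last _} (by
      have a00 := hu' 0 0
      have a11 := hu' 1 1
      have a01 := hu' 0 1
      have a10 := hu' 1 0
      have z0 : g ζ (u' 0) = 0 := by rw [hg, h0ζ]
      have z1 : g ζ (u' 1) = 0 := by rw [hg, h1ζ]
      rw [if_pos rfl] at a00 a11
      rw [if_neg (by decide)] at a01 a10
      rintro i (rfl | rfl | rfl) j (rfl | rfl | rfl) <;>
        simp [hl0.symm, hl1.symm, h01.symm, *])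
  have f0 : f 0 = u' 0 := by simpa using hfe 0 (by simp)
  have f1 : f 1 = u' 1 := by simpa [h01.symm] using hfe 1 (by simp)
  have fl : f (Fin.last _) = ζ := by simpa [hl0, hl1] using hfe (Fin.last _) (by simp)
  have hspan' : Submodule.span ℝ (Set.range u) = Submodule.span ℝ {f 0, f 1} := by
    rw [f0, f1, hspan]
  have hdef := defect_eq_of_span_eq hn hg hb hss he hf hu h01 hspan'
  have had := defect_adapted hb hpos hss k f (by rw [fl, hsζ])
  rw [hdef]
  refine ⟨had.1, ?_, ?_⟩
  · intro h0
    obtain ⟨c1, c2⟩ := had.2.mp h0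
    refine ⟨f, ν, hf, hν, hνL, fl, hspan', ?_, ?_⟩
    · intro r hr
      have h1 : 0 < N - (k + 3) := by omega
      have h2 : w = ν r := by
        simp only [w, h1, dif_pos]
        congr 1
        exact Fin.ext hr.symm
      have h3 : b (s (f 0) (f 1)) (ν r) = 0 := by rw [f0, f1, ← h2, hw]
      refine ⟨b (s (f 0) (f 0)) (ν r), ?_⟩
      rw [shape_eq_blockMatrix hss c1 c2, h3]
    · intro r _
      exact ⟨_, _, shape_eq_blockMatrix hss c1 c2 (ν r)⟩
  · rintro ⟨f', ν', hf', hν', hνL', fl', hspan'', hr0, hr1⟩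
    have hdef' := defect_eq_of_span_eq hn hg hb hss he hf' hu h01 hspan''
    have had' := defect_adapted hb hpos hss k f' (by rw [fl', hsζ])
    rw [← hdef, hdef', had'.2]
    have hall : ∀ r, ∃ c' d' : ℝ,
        Matrix.of (fun i j => b (s (f' i) (f' j)) (ν' r)) = blockMatrix (k + 3) c' d' := by
      intro r
      rcases Nat.eq_zero_or_pos r.val with h | h
      · obtain ⟨a, ha⟩ := hr0 r h
        exact ⟨a, 0, ha⟩
      · exact hr1 r h
    constructor
    · refine eq_zero_of_normal hN hb hL hf' hν' hνL' (fun v => by simp [hsL]) fun r => ?_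
      obtain ⟨c', d', h⟩ := hall r
      have h0 := congrFun (congrFun h 0) 0
      have h1 := congrFun (congrFun h 1) 1
      simp only [blockMatrix, Matrix.of_apply] at h0 h1
      simp at h0 h1
      simp [h0, h1]
    · intro i j hi
      refine eq_zero_of_normal hN hb hL hf' hν' hνL' (fun v => hsL _ _ v) fun r => ?_
      obtain ⟨c', d', h⟩ := hall r
      have h0 := congrFun (congrFun h i) j
      simp only [blockMatrix, Matrix.of_apply] at h0
      have n0 : i.val ≠ 0 := by omega
      have n1 : i.val ≠ 1 := by omega
      rw [h0]
      simp [n0, n1]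

end Equality

/-! ### Planes in general position in a `(κ, μ)`-contact space form -/

namespace IsKappaMuOn

variable {E : Type*} [NormedAddCommGroup E] [NormedSpace ℝ E] [FiniteDimensional ℝ E]
  {G : E → E →L[ℝ] E →L[ℝ] ℝ} {U : Set E} {φ : E → E →L[ℝ] E}
  {ξ : E → E} {κ μ : ℝ} (hK : IsKappaMuOn G U φ ξ κ μ) {y : E} (hy : y ∈ U)

include hK hy

/-- The value of `⟨R(X, Y)Y, X⟩` when `X`, `Y` need not be orthogonal to `ξ`: their horizontal parts
`X₀`, `Y₀` contribute `spaceFormCurv`, and the nullity condition gives the terms with `ξ`. -/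
theorem form_curv_self_eq {c : ℝ}
    (hc : ∀ u, G y u u = 1 → G y (ξ y) u = 0 → G y (curv G y u (φ y u) (φ y u)) u = c)
    (X Y : E) :
    G y (curv G y X Y Y) X =
      (c + 3) / 4 * (G y X X * G y Y Y - G y X Y ^ 2)
      + (4 * κ - c - 3) / 4 * (G y (ξ y) Y ^ 2 * G y X X
          - 2 * (G y (ξ y) X * G y (ξ y) Y) * G y X Y + G y (ξ y) X ^ 2 * G y Y Y)
      + 3 * (c - 1) / 4 * G y X (φ y Y) ^ 2
      + 1 / 2 * (G y (lieHalf φ ξ y X) X * G y (lieHalf φ ξ y Y) Y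
          - G y (lieHalf φ ξ y X) Y ^ 2 + G y (φ y (lieHalf φ ξ y X)) Y ^ 2
          - G y (φ y (lieHalf φ ξ y X)) X * G y (φ y (lieHalf φ ξ y Y)) Y)
      + (G y Y Y * G y (lieHalf φ ξ y X) X + G y X X * G y (lieHalf φ ξ y Y) Y
          - 2 * G y X Y * G y (lieHalf φ ξ y X) Y)
      + (μ - 1) * (G y (ξ y) Y ^ 2 * G y (lieHalf φ ξ y X) X
          - 2 * (G y (ξ y) X * G y (ξ y) Y) * G y (lieHalf φ ξ y X) Y
          + G y (ξ y) X ^ 2 * G y (lieHalf φ ξ y Y) Y) := by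
  have hA := hK.almost y hy
  have hM := hK.metric
  have hs := hA.symm
  set h := lieHalf φ ξ y with hh
  set a := G y (ξ y) X with ha
  set d := G y (ξ y) Y with hd
  set X₀ := X - a • ξ y with hX₀
  set Y₀ := Y - d • ξ y with hY₀
  have hX : X = X₀ + a • ξ y := by rw [hX₀]; module
  have hY : Y = Y₀ + d • ξ y := by rw [hY₀]; module
  have hXξ : G y (ξ y) X₀ = 0 := by rw [hX₀]; simp [hA.norm, ← ha]
  have hYξ : G y (ξ y) Y₀ = 0 := by rw [hY₀]; simp [hA.norm, ← hd]
  have hnull0 : curv G y Y₀ X₀ (ξ y) = 0 := by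
    rw [hK.nullity y hy, hXξ, hYξ]
    simp
  have smulr : ∀ (u v w : E) (t : ℝ), curv G y u v (t • w) = t • curv G y u v w := by
    intro u v w t
    simp only [curv, map_smul, smul_sub, smul_add]
  have skew := hM.form_curv_skew hy
  -- the horizontal part
  have h1 : G y (curv G y X Y Y₀) X₀ = G y (curv G y Y₀ X₀ X₀) Y₀ := by
    -- `R(Y₀, X₀)ξ = 0`, so that the components along `ξ` drop out
    rw [hM.form_curv_pair hy]
    conv_lhs => rw [hX, hM.curv_add_right hy, smulr, hnull0, smul_zero, add_zero, hY]
    rw [map_add, map_smul, skew Y₀ X₀ X₀ (ξ y), hnull0]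
    simp
  have h2 : G y (curv G y X Y Y) X = G y (curv G y Y₀ X₀ X₀) Y₀
      + d * G y (curv G y X Y (ξ y)) X₀ - a * G y (curv G y X Y (ξ y)) Y₀ := by
    rw [← h1]
    calc G y (curv G y X Y Y) X
        = G y (curv G y X Y (Y₀ + d • ξ y)) (X₀ + a • ξ y) := by rw [← hX, ← hY]
      _ = _ := by
        rw [hM.curv_add_right hy, smulr]
        simp only [map_add, map_smul, add_apply, smul_apply, smul_eq_mul]
        rw [hM.form_curv_self hy, skew X Y Y₀ (ξ y)]
        ring
  have hηh : ∀ v, G y (ξ y) (h v) = 0 := hK.η_lieHalf hy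
  have hhs : ∀ u v, G y (h u) v = G y (h v) u := fun u v => by
    rw [hh, hK.lieHalf_symm hy, hs]
  have hφh : ∀ u v, G y (φ y (h u)) v = G y (φ y (h v)) u := by
    intro u v
    rw [hh, hK.φ_lieHalf hy, hK.φ_lieHalf hy, hK.symGrad_symm hy, hs]
  have hhξ : h (ξ y) = 0 := hK.lieHalf_ξ hy
  have hn : ∀ v, G y (curv G y X Y (ξ y)) v =
      κ * (d * G y X v - a * G y Y v) + μ * (d * G y (h X) v - a * G y (h Y) v) := by
    intro v
    rw [hK.nullity y hy, ← hh, ← ha, ← hd]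
    simp
  have hhηl : ∀ v, G y (h v) (ξ y) = 0 := fun v => by rw [hs, hηh]
  have hXr : ∀ v, G y v X₀ = G y v X - a * G y v (ξ y) := fun v => by rw [hX₀]; simp
  have hYr : ∀ v, G y v Y₀ = G y v Y - d * G y v (ξ y) := fun v => by rw [hY₀]; simp
  have hXh : h X₀ = h X := by rw [hX₀]; simp [hhξ]
  have hYh : h Y₀ = h Y := by rw [hY₀]; simp [hhξ]
  have hXφ : φ y X₀ = φ y X := by rw [hX₀]; simp [hA.φ_ξ]
  have hYφ : φ y Y₀ = φ y Y := by rw [hY₀]; simp [hA.φ_ξ]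
  have hξr : ∀ v, G y v (ξ y) = G y (ξ y) v := fun v => hs _ _
  rw [h2, hn, hn, hK.form_curv_eq_spaceFormCurv hy hc hYξ hXξ, spaceFormCurv, ← hh, hXh, hYh, hXφ,
    hYφ]
  have e1 : G y X₀ X₀ = G y X X - a ^ 2 := by
    rw [hXr, hs, hXr, hξr X₀, hXξ, hξr X]; ring
  have e2 : G y Y₀ Y₀ = G y Y Y - d ^ 2 := by
    rw [hYr, hs, hYr, hξr Y₀, hYξ, hξr Y]; ring
  have e3 : G y Y₀ X₀ = G y X Y - a * d := by
    rw [hXr, hs, hYr, hξr Y₀, hYξ, hξr X]; ring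
  have e4 : G y X₀ Y₀ = G y X Y - a * d := by rw [hs, e3]
  have e5 : G y Y₀ (φ y X) = - G y X (φ y Y) := by
    rw [hs, hYr, hξr, hA.η_φ, hA.skew]; ring
  have e6 : G y (φ y X) Y₀ = - G y X (φ y Y) := by rw [hs, e5]
  have e8 : G y (φ y Y) Y₀ = 0 := by rw [hYr, hξr, hA.η_φ, hA.skew_self]; ring
  simp only [e1, e2, e3, e4, e5, e6, e8]
  simp only [hXr, hYr, hhηl, hξr (φ y _), hA.η_φ, hξr X, hξr Y, ← ha, ← hd]
  rw [hφh Y X, hhs Y X, hs Y X]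
  ring

end IsKappaMuOn

/-! ### Sums of sectional curvatures over an orthonormal basis -/

theorem sum_Ioi_eq_half {n : ℕ} (K : Fin n → Fin n → ℝ) (hsymm : ∀ i j, K i j = K j i)
    (hdiag : ∀ i, K i i = 0) :
    ∑ i, ∑ j ∈ Finset.Ioi i, K i j = 1 / 2 * ∑ i, ∑ j, K i j := by
  have h1 : ∀ i, ∑ j, K i j = ∑ j ∈ Finset.Ioi i, K i j + ∑ j ∈ Finset.Iio i, K i j := by
    intro i
    have : (Finset.univ : Finset (Fin n)) = insert i (Finset.Ioi i ∪ Finset.Iio i) := by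
      ext j
      simp
      omega
    rw [this, Finset.sum_insert (by simp), hdiag, zero_add, Finset.sum_union]
    rw [Finset.disjoint_left]
    intro j
    simp
    exact le_of_lt
  have h2 : ∑ i, ∑ j ∈ Finset.Iio i, K i j = ∑ i, ∑ j ∈ Finset.Ioi i, K i j := by
    rw [Finset.sum_comm' (t' := Finset.univ) (s' := fun j => Finset.Ioi j)]
    · exact Finset.sum_congr rfl fun i _ => Finset.sum_congr rfl fun j _ => hsymm _ _
    · simp
  simp only [h1, Finset.sum_add_distrib, h2]
  ring

/-- The sum of the values of `form_curv_self_eq` over an orthonormal basis `e`, with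
`η i = ⟨ξ, e i⟩`, `Φ i j = ⟨e i, φ (e j)⟩`, `H i j = ⟨h (e i), e j⟩`, `P i j = ⟨φ h (e i), e j⟩`. The
hypotheses say that `ξ` is a unit vector in the span of `e` and that `h ξ = 0`. -/
theorem sum_contact_terms {n : ℕ} {c κ μ : ℝ} (η : Fin n → ℝ) (Φ H P : Fin n → Fin n → ℝ)
    (hη : ∑ i, η i ^ 2 = 1) (hH : ∑ i, ∑ j, η i * η j * H i j = 0) :
    ∑ i, ∑ j, ((c + 3) / 4 * (1 - (if i = j then 1 else 0))
      + (4 * κ - c - 3) / 4 * (η j ^ 2 - 2 * (η i * η j) * (if i = j then 1 else 0) + η i ^ 2)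
      + 3 * (c - 1) / 4 * Φ i j ^ 2
      + 1 / 2 * (H i i * H j j - H i j ^ 2 + P i j ^ 2 - P i i * P j j)
      + (H i i + H j j - 2 * (if i = j then 1 else 0) * H i j)
      + (μ - 1) * (η j ^ 2 * H i i - 2 * (η i * η j) * H i j + η i ^ 2 * H j j))
    = (c + 3) / 4 * (n ^ 2 - n) + (4 * κ - c - 3) / 2 * (n - 1)
      + 3 * (c - 1) / 4 * ∑ i, ∑ j, Φ i j ^ 2
      + 1 / 2 * ((∑ i, H i i) ^ 2 - ∑ i, ∑ j, H i j ^ 2 + ∑ i, ∑ j, P i j ^ 2 - (∑ i, P i i) ^ 2)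
      + 2 * (n + μ - 2) * ∑ i, H i i := by
  have hH' : ∑ i, ∑ j, 2 * (η i * η j) * H i j = 0 := by
    simp only [mul_assoc, ← Finset.mul_sum] at hH ⊢
    rw [hH, mul_zero]
  simp only [Finset.sum_add_distrib, Finset.sum_sub_distrib, ← Finset.mul_sum, ← Finset.sum_mul,
    hη, hH', Finset.sum_const, Finset.card_univ, Fintype.card_fin, nsmul_eq_mul, mul_ite, mul_zero,
    ite_mul, zero_mul, Finset.sum_ite_eq, Finset.mem_univ, if_true, mul_one]
  have : ∑ i, η i * η i = 1 := by simpa only [pow_two] using hη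
  rw [this]
  ring

theorem sum_gaussTerm {V W : Type*} [NormedAddCommGroup V] [NormedSpace ℝ V]
    [NormedAddCommGroup W] [NormedSpace ℝ W]
    (b : W →L[ℝ] W →L[ℝ] ℝ) (s : V →L[ℝ] V →L[ℝ] W) {n : ℕ} (e : Fin n → V) :
    ∑ i, ∑ j, gaussTerm b s (e i) (e j) =
      b (∑ i, s (e i) (e i)) (∑ i, s (e i) (e i)) - sqSum b s e := by
  simp only [gaussTerm, Finset.sum_sub_distrib, sqSum, map_sum, sum_apply]
  rw [Finset.sum_comm]

/-! ### Isometric immersions tangent to `ξ` -/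

namespace IsIsometricOn

variable {E E' : Type*} [NormedAddCommGroup E] [NormedSpace ℝ E]
  [NormedAddCommGroup E'] [NormedSpace ℝ E'] [FiniteDimensional ℝ E] [FiniteDimensional ℝ E']
  {G : E → E →L[ℝ] E →L[ℝ] ℝ} {U : Set E} {g : E' → E' →L[ℝ] E' →L[ℝ] ℝ} {U' : Set E'}
  {f : E' → E} {y : E'}

/-- The second fundamental form as a bilinear map. -/
def _root_.ContactGeometry.sffL (G : E → E →L[ℝ] E →L[ℝ] ℝ) (g : E' → E' →L[ℝ] E' →L[ℝ] ℝ)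
    (f : E' → E) (y : E') : E' →L[ℝ] E' →L[ℝ] E :=
  fderiv ℝ (fderiv ℝ f) y + (conn G (f y)).bilinearComp (fderiv ℝ f y) (fderiv ℝ f y)
    - (ContinuousLinearMap.compL ℝ E' E' E (fderiv ℝ f y)).comp (conn g y)

variable (h : IsIsometricOn G U g U' f) (hy : y ∈ U')
include h hy

theorem sffL_apply (u v : E') : sffL G g f y u v = sff G g f y u v := by
  rw [sff, covAlong, fderiv_fderiv_apply (h.contDiffAt hy)]
  rfl

/-- The Gauss equation for sectional curvatures. -/
theorem gauss_sectional (u v : E') :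
    g y (curv g y u v v) u =
      G (f y) (curv G (f y) (fderiv ℝ f y u) (fderiv ℝ f y v) (fderiv ℝ f y v)) (fderiv ℝ f y u)
      + gaussTerm (G (f y)) (sffL G g f y) u v := by
  rw [h.gauss hy, gaussTerm, h.sffL_apply hy, h.sffL_apply hy, h.sffL_apply hy,
    h.sff_symm hy v u, h.target.symm (f y) (h.mapsTo hy) (sff G g f y u u)]
  ring

variable {φ : E → E →L[ℝ] E} {ξ : E → E} {κ μ : ℝ}

/-- If `ξ` is tangent to the submanifold then `σ(ξ, ξ) = 0`, because `∇̃_ξ ξ = 0`. -/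
theorem sffL_structure_eq_zero (hK : IsKappaMuOn G U φ ξ κ μ)
    (htan : ∀ z ∈ U', ∃ v, fderiv ℝ f z v = ξ (f z)) {ζ : E'} (hζ : fderiv ℝ f y ζ = ξ (f y)) :
    sffL G g f y ζ ζ = 0 := by
  have hfy := h.mapsTo hy
  have hf := h.contDiffAt hy
  have hf' : ContDiffAt ℝ ∞ (fderiv ℝ f) y := hf.fderiv_right (m := ∞) (by simp)
  have hξf : ContDiffAt ℝ ∞ (fun z => ξ (f z)) y := (hK.ξ_contDiffAt hfy).comp y hf
  -- the tangent vector field whose image is `ξ`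
  let Z : E' → E' := fun z => (g z).inverse ((G (f z) (ξ (f z))).comp (fderiv ℝ f z))
  have hZ : ∀ z ∈ U', ∀ v, fderiv ℝ f z v = ξ (f z) → Z z = v := by
    intro z hz v hv
    refine eq_of_form_eq (h.source.pos z hz) fun w => ?_
    rw [apply_inverse_of_pos (g z) (h.source.pos z hz), ← h.isometric z hz, hv]
    rfl
  have hZs : ContDiffAt ℝ ∞ Z y := by
    have h1 : ContDiffAt ℝ ∞ (fun z => (g z).inverse) y := by
      obtain ⟨e, he⟩ := exists_equiv_of_pos (g y) (h.source.pos y hy)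
      have := contDiffAt_map_inverse (𝕜 := ℝ) (n := ∞) e
      rw [he] at this
      exact this.comp y (h.source.contDiffAt hy)
    have h2 : ContDiffAt ℝ ∞ (fun z => G (f z)) y := (h.target.contDiffAt hfy).comp y hf
    exact h1.clm_apply ((h2.clm_apply hξf).clm_comp hf')
  have hev : (fun z => ξ (f z)) =ᶠ[nhds y] fun z => fderiv ℝ f z (Z z) := by
    filter_upwards [h.source.isOpen.mem_nhds hy] with z hz
    obtain ⟨v, hv⟩ := htan z hz
    rw [hZ z hz v hv, hv]
  have hd1 : fderiv ℝ (fun z => ξ (f z)) y ζ = fderiv ℝ ξ (f y) (fderiv ℝ f y ζ) := by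
    have := fderiv_fun_comp (𝕜 := ℝ) y (hK.ξ_diff hfy) (hf.differentiableAt (by simp))
    rw [this]
    rfl
  have hd2 : fderiv ℝ (fun z => fderiv ℝ f z (Z z)) y ζ =
      fderiv ℝ (fderiv ℝ f) y ζ (Z y) + fderiv ℝ f y (fderiv ℝ Z y ζ) := by
    rw [fderiv_clm_apply (hf'.differentiableAt (by simp)) (hZs.differentiableAt (by simp))]
    simp [add_comm]
  have hg := hK.grad_ξ hfy
  rw [gradField, add_apply, ContinuousLinearMap.flip_apply, ← hζ, ← hd1, hev.fderiv_eq, hd2,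
    hZ y hy ζ hζ, hζ] at hg
  have key : sffL G g f y ζ ζ =
      -(fderiv ℝ f y (fderiv ℝ Z y ζ + conn g y ζ ζ)) := by
    have : sffL G g f y ζ ζ = fderiv ℝ (fderiv ℝ f) y ζ ζ
        + conn G (f y) (fderiv ℝ f y ζ) (fderiv ℝ f y ζ) - fderiv ℝ f y (conn g y ζ ζ) := rfl
    rw [this, hζ, map_add, ← sub_eq_zero, ← hg]
    abel
  by_contra hne
  have hpos := h.target.pos (f y) hfy _ hne
  have h0 : G (f y) (sffL G g f y ζ ζ) (sffL G g f y ζ ζ) = 0 := by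
    have h1 := h.form_sff_fderiv hy ζ ζ (fderiv ℝ Z y ζ + conn g y ζ ζ)
    rw [← h.sffL_apply hy, ← neg_eq_iff_eq_neg.mpr key, map_neg, neg_eq_zero] at h1
    exact h1
  exact hpos.ne' h0

/-- The Gauss equation, summed over an orthonormal basis: the invariant `τ - K(u₀ ∧ u₁)` is the
right hand side of the inequality minus the defect of the second fundamental form. -/
theorem scalar_sub_sectional_eq (hK : IsKappaMuOn G U φ ξ κ μ) {c : ℝ}
    (hc : ∀ u, G (f y) u u = 1 → G (f y) (ξ (f y)) u = 0 →
      G (f y) (curv G (f y) u (φ (f y) u) (φ (f y) u)) u = c)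
    {n : ℕ} (hn : Module.finrank ℝ E' = n) (hn1 : (n : ℝ) - 1 ≠ 0)
    {ζ : E'} (hζ : fderiv ℝ f y ζ = ξ (f y)) {e : Fin n → E'} (he : IsON (g y) e)
    {u : Fin 2 → E'} (hu : IsON (g y) u) (huζ : ∀ l, g y (u l) ζ = 0)
    {H P Φ : E' → E' → ℝ}
    (hH : ∀ v w, H v w = G (f y) (fderiv ℝ f y v) (lieHalf φ ξ (f y) (fderiv ℝ f y w)))
    (hP : ∀ v w, P v w = G (f y) (fderiv ℝ f y v)
      (φ (f y) (lieHalf φ ξ (f y) (fderiv ℝ f y w))))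
    (hΦ : ∀ v w, Φ v w = G (f y) (fderiv ℝ f y v) (φ (f y) (fderiv ℝ f y w))) :
    ∑ i, ∑ j ∈ Finset.Ioi i, g y (curv g y (e i) (e j) (e j)) (e i)
        - g y (curv g y (u 0) (u 1) (u 1)) (u 0) =
      ((n : ℝ) - 2) / (2 * ((n : ℝ) - 1)) * G (f y) (∑ i, sffL G g f y (e i) (e i))
          (∑ i, sffL G g f y (e i) (e i))
        + 1 / 8 * (n : ℝ) * (c + 3) * ((n : ℝ) - 3) + ((n : ℝ) - 1) * κ
        + 3 * (c - 1) / 8 * (∑ i, ∑ j, Φ (e i) (e j) ^ 2 - 2 * Φ (u 0) (u 1) ^ 2)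
        + (μ + (n : ℝ) - 2) * ∑ i, H (e i) (e i)
        - 1 / 2 * (2 * (H (u 0) (u 0) + H (u 1) (u 1))
            + (H (u 0) (u 0) * H (u 1) (u 1) - H (u 0) (u 1) * H (u 1) (u 0))
            - (P (u 0) (u 0) * P (u 1) (u 1) - P (u 0) (u 1) * P (u 1) (u 0)))
        + 1 / 4 * (∑ i, ∑ j, P (e i) (e j) ^ 2 - ∑ i, ∑ j, H (e i) (e j) ^ 2
            - (∑ i, P (e i) (e i)) ^ 2 + (∑ i, H (e i) (e i)) ^ 2)
        - defect (G (f y)) (sffL G g f y) e (u 0) (u 1) := by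
  have hfy := h.mapsTo hy
  have hA := hK.almost _ hfy
  have hs := hA.symm
  have hgs := h.source.symm y hy
  have hiso := h.isometric y hy
  have hHl : ∀ v w, G (f y) (lieHalf φ ξ (f y) (fderiv ℝ f y v)) (fderiv ℝ f y w) = H v w :=
    fun v w => by rw [hH, hK.lieHalf_symm hfy]
  have hPl : ∀ v w, G (f y) (φ (f y) (lieHalf φ ξ (f y) (fderiv ℝ f y v))) (fderiv ℝ f y w)
      = P v w := fun v w => by
    rw [hP, hK.φ_lieHalf hfy, hK.φ_lieHalf hfy, hK.symGrad_symm hfy]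
  have hHs : ∀ v w, H v w = H w v := fun v w => by rw [hH, hs, hHl]
  have hPs : ∀ v w, P v w = P w v := fun v w => by rw [hP, hs, hPl]
  have hη : ∀ v, G (f y) (ξ (f y)) (fderiv ℝ f y v) = g y ζ v := fun v => by rw [← hζ, hiso]
  have hK' : ∀ v w, g y (curv g y v w w) v = _ := fun v w => by
    rw [h.gauss_sectional hy, hK.form_curv_self_eq hfy hc, hHl, hHl, hHl, hPl, hPl, hPl, hη, hη,
      hiso, hiso, hiso, ← hΦ]
  rw [sum_Ioi_eq_half]
  rotate_left
  · intro i j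
    rw [h.source.form_curv_pair hy]
  · intro i
    exact h.source.form_curv_self hy _ _ _
  have hζζ : g y ζ ζ = 1 := by rw [← hiso, hζ, hA.norm]
  have s1 : ∑ i, g y ζ (e i) ^ 2 = 1 := by
    rw [← hζζ, IsON.parseval hn he ζ ζ]
    exact Finset.sum_congr rfl fun i _ => by rw [hgs (e i), pow_two]
  have s2 : ∑ i, ∑ j, g y ζ (e i) * g y ζ (e j) * H (e i) (e j) = 0 := by
    have h0 : H ζ ζ = 0 := by rw [hH, hζ, hK.lieHalf_ξ hfy, map_zero]
    rw [← h0, hH]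
    conv_rhs => rw [IsON.expand hn he ζ]
    simp only [map_sum, map_smul, sum_apply, smul_apply, smul_eq_mul, hH, Finset.mul_sum]
    rw [Finset.sum_comm]
    exact Finset.sum_congr rfl fun i _ => Finset.sum_congr rfl fun j _ => by ring
  have hsum := sum_contact_terms (c := c) (κ := κ) (μ := μ) (fun i => g y ζ (e i))
    (fun i j => Φ (e i) (e j)) (fun i j => H (e i) (e j)) (fun i j => P (e i) (e j)) s1 s2
  have hgt := sum_gaussTerm (G (f y)) (sffL G g f y) e
  have hsum' := congrArg₂ (· + ·) hsum hgt
  simp only [← Finset.sum_add_distrib] at hsum'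
  have hterm : ∀ i j, g y (curv g y (e i) (e j) (e j)) (e i) = _ := fun i j => by
    rw [hK' (e i) (e j), he i i, he j j, he i j, if_pos rfl, if_pos rfl]
  have huu := hK' (u 0) (u 1)
  rw [hu 0 0, hu 1 1, hu 0 1, if_pos rfl, if_pos rfl, if_neg (by decide), hgs ζ, hgs ζ, huζ,
    huζ] at huu
  simp only [hterm]
  rw [huu, defect, hHs (u 1) (u 0), hPs (u 1) (u 0)]
  -- the entries of the identity matrix
  have hpow : ∀ i j : Fin n, ((if i = j then 1 else 0 : ℝ)) ^ 2 = if i = j then 1 else 0 := by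
    intro i j
    split_ifs <;> simp
  simp only [hpow, one_mul, mul_one]
  rw [hsum']
  field_simp
  ring

end IsIsometricOn

/-! ### Coordinate expressions -/

section Charts

variable {d : ℕ} {N : Type*} [TopologicalSpace N] [ChartedSpace (Euc d) N]
  [IsManifold (𝓡 d) ∞ N] {x₀ : N} {y : Euc d}

theorem pt_mem (hy : y ∈ (extChartAt (𝓡 d) x₀).target) : pt x₀ y ∈ (chartAt (Euc d) x₀).source := by
  rw [← extChartAt_source (𝓡 d)]
  exact (extChartAt (𝓡 d) x₀).map_target hy

/-- Mathlib differentiates the inverse of a chart within the range of the model; this range is the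
whole space here. -/
theorem frame_eq (x₀ : N) (y : Euc d) : frame x₀ y =
    mfderivWithin 𝓘(ℝ, Euc d) (𝓡 d) (extChartAt (𝓡 d) x₀).symm (Set.range (𝓡 d)) y := by
  rw [frame, ModelWithCorners.range_eq_univ, mfderivWithin_univ]

theorem coframe_frame (hy : y ∈ (extChartAt (𝓡 d) x₀).target) (u : Euc d) :
    coframe x₀ y (frame x₀ y u) = u := by
  rw [frame_eq]
  exact congrArg (fun A : Euc d →L[ℝ] Euc d => A u)
    (mfderiv_extChartAt_comp_mfderivWithin_extChartAt_symm (I := 𝓡 d) hy)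

theorem frame_coframe (hy : y ∈ (extChartAt (𝓡 d) x₀).target)
    (u : TangentSpace (𝓡 d) (pt x₀ y)) : frame x₀ y (coframe x₀ y u) = u := by
  rw [frame_eq]
  exact congrArg (fun A : Euc d →L[ℝ] Euc d => A u)
    (mfderivWithin_extChartAt_symm_comp_mfderiv_extChartAt (I := 𝓡 d) hy)

theorem symmL_eq_frame (hy : y ∈ (extChartAt (𝓡 d) x₀).target) :
    (trivializationAt (Euc d) (TangentSpace (𝓡 d)) x₀).symmL ℝ (pt x₀ y) = frame x₀ y := by
  rw [frame_eq]
  let Fr : Euc d → (Euc d →L[ℝ] Euc d) := fun z =>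
    mfderivWithin 𝓘(ℝ, Euc d) (𝓡 d) (extChartAt (𝓡 d) x₀).symm (Set.range (𝓡 d)) z
  have h1 := TangentBundle.symmL_trivializationAt (I := 𝓡 d) (pt_mem hy)
  have h2 : Fr (extChartAt (𝓡 d) x₀ (pt x₀ y)) = Fr y := by
    rw [pt, (extChartAt (𝓡 d) x₀).right_inv hy]
  exact h1.trans h2

theorem continuousLinearMapAt_eq_coframe (hy : y ∈ (extChartAt (𝓡 d) x₀).target) :
    (trivializationAt (Euc d) (TangentSpace (𝓡 d)) x₀).continuousLinearMapAt ℝ (pt x₀ y)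
      = coframe x₀ y :=
  TangentBundle.continuousLinearMapAt_trivializationAt (I := 𝓡 d) (pt_mem hy)

theorem contMDiffOn_pt (x₀ : N) : ContMDiffOn 𝓘(ℝ, Euc d) (𝓡 d) ∞ (pt x₀)
    (extChartAt (𝓡 d) x₀).target := contMDiffOn_extChartAt_symm x₀

theorem contDiffOn_comp_pt {F : Type*} [NormedAddCommGroup F] [NormedSpace ℝ F] {f : N → F}
    (hf : ContMDiffOn (𝓡 d) 𝓘(ℝ, F) ∞ f (chartAt (Euc d) x₀).source) :
    ContDiffOn ℝ ∞ (fun y => f (pt x₀ y)) (extChartAt (𝓡 d) x₀).target :=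
  contMDiffOn_iff_contDiffOn.mp (hf.comp (contMDiffOn_pt x₀) fun _ hy => pt_mem hy)

/-- The components of a smooth vector field are smooth. -/
theorem contDiffOn_vectorField {ξ : ∀ x : N, TangentSpace (𝓡 d) x}
    (hξ : ContMDiff (𝓡 d) (𝓡 d).tangent ∞ (fun x : N => (⟨x, ξ x⟩ : TangentBundle (𝓡 d) N)))
    (x₀ : N) :
    ContDiffOn ℝ ∞ (fun y => coframe x₀ y (ξ (pt x₀ y))) (extChartAt (𝓡 d) x₀).target := by
  let e := trivializationAt (Euc d) (TangentSpace (𝓡 d)) x₀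
  have h1 : ContMDiffOn (𝓡 d) 𝓘(ℝ, Euc d) ∞ (fun x => (e ⟨x, ξ x⟩).2) e.baseSet :=
    e.contMDiffOn_section_baseSet_iff.mp hξ.contMDiffOn
  refine (contDiffOn_comp_pt h1).congr fun y hy => ?_
  rw [← continuousLinearMapAt_eq_coframe hy]
  exact e.continuousLinearMapAt_apply_of_mem ℝ (pt_mem hy) _

/-- The components of a smooth field of endomorphisms are smooth. -/
theorem contDiffOn_endomorphism {φ : ∀ x : N, TangentSpace (𝓡 d) x →L[ℝ] TangentSpace (𝓡 d) x}
    (hφ : ContMDiff (𝓡 d) ((𝓡 d).prod 𝓘(ℝ, Euc d →L[ℝ] Euc d)) ∞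
      (fun x : N => TotalSpace.mk' (Euc d →L[ℝ] Euc d)
        (E := fun x : N => TangentSpace (𝓡 d) x →L[ℝ] TangentSpace (𝓡 d) x) x (φ x)))
    (x₀ : N) :
    ContDiffOn ℝ ∞ (fun y => (((coframe x₀ y).comp (φ (pt x₀ y))).comp (frame x₀ y) :
      Euc d →L[ℝ] Euc d)) (extChartAt (𝓡 d) x₀).target := by
  let e := trivializationAt (Euc d →L[ℝ] Euc d)
    (fun x : N => TangentSpace (𝓡 d) x →L[ℝ] TangentSpace (𝓡 d) x) x₀
  have h1 : ContMDiffOn (𝓡 d) 𝓘(ℝ, Euc d →L[ℝ] Euc d) ∞ (fun x => (e ⟨x, φ x⟩).2) e.baseSet :=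
    e.contMDiffOn_section_baseSet_iff.mp hφ.contMDiffOn
  have hb : e.baseSet = (chartAt (Euc d) x₀).source := by
    simp [e, hom_trivializationAt_baseSet]
  rw [hb] at h1
  refine (contDiffOn_comp_pt h1).congr fun y hy => ?_
  rw [hom_trivializationAt_apply]
  simp only [ContinuousLinearMap.inCoordinates]
  rw [continuousLinearMapAt_eq_coframe hy, symmL_eq_frame hy]
  rfl

/-- The components of a smooth metric are smooth. -/
theorem contDiffOn_metric (g : Metric d N) (x₀ : N) :
    ContDiffOn ℝ ∞ (g.loc x₀) (extChartAt (𝓡 d) x₀).target := by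
  let e := trivializationAt (Euc d →L[ℝ] Euc d →L[ℝ] ℝ)
    (fun x : N => TangentSpace (𝓡 d) x →L[ℝ] TangentSpace (𝓡 d) x →L[ℝ] ℝ) x₀
  have h1 : ContMDiffOn (𝓡 d) 𝓘(ℝ, Euc d →L[ℝ] Euc d →L[ℝ] ℝ) ∞ (fun x => (e ⟨x, g.inner x⟩).2)
      e.baseSet := e.contMDiffOn_section_baseSet_iff.mp g.contMDiff.contMDiffOn
  have hb : e.baseSet = (chartAt (Euc d) x₀).source := by
    simp [e, hom_trivializationAt_baseSet]
  rw [hb] at h1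
  refine (contDiffOn_comp_pt h1).congr fun y hy => ?_
  ext u v
  rw [hom_trivializationAt_apply]
  simp only [ContinuousLinearMap.inCoordinates]
  rw [Metric.loc_apply, ← symmL_eq_frame hy]
  have h2 := Trivialization.continuousLinearMapAt_apply_of_mem (R := ℝ)
    (trivializationAt (Euc d →L[ℝ] ℝ) (fun x : N => TangentSpace (𝓡 d) x →L[ℝ] ℝ) x₀)
    (b := pt x₀ y) (by simpa [hom_trivializationAt_baseSet] using pt_mem hy)
  refine Eq.trans ?_ (congrArg (fun A : Euc d →L[ℝ] ℝ => A v) (h2 _).symm)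
  change _ = ContinuousLinearMap.inCoordinates (Euc d) (TangentSpace (𝓡 d)) ℝ (Trivial N ℝ) x₀
    (pt x₀ y) x₀ (pt x₀ y) _ v
  simp [ContinuousLinearMap.inCoordinates]

theorem isMetricOn_loc (g : Metric d N) (x₀ : N) :
    IsMetricOn (g.loc x₀) (extChartAt (𝓡 d) x₀).target where
  isOpen := isOpen_extChartAt_target x₀
  smooth := contDiffOn_metric g x₀
  symm y _ u v := by
    rw [Metric.loc_apply, Metric.loc_apply]
    exact g.symm _ _ _
  pos y hy u hu := by
    rw [Metric.loc_apply]
    refine g.pos _ _ fun h => hu ?_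
    rw [← coframe_frame hy u, h, map_zero]

end Charts

/-! ### Contact metric structures in a chart -/

section Coordinates

variable {d : ℕ} {G : Euc d → Euc d →L[ℝ] Euc d →L[ℝ] ℝ} {U : Set (Euc d)}

/-- `curvature` differentiates `z ↦ Γ_z(v, w)` and `curv` the bilinear map `Γ` itself. -/
theorem curvature_eq_curv (hG : IsMetricOn G U) {y : Euc d} (hy : y ∈ U) (u v w : Euc d) :
    curvature G y u v w = curv G y u v w := by
  have h1 : ∀ a b : Euc d, fderiv ℝ (fun z => christoffel G z a w) y b
      = fderiv ℝ (conn G) y b a w := by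
    intro a b
    have hd : DifferentiableAt ℝ (conn G) y := (hG.contDiffAt_conn hy).differentiableAt (by simp)
    have h2 : HasFDerivAt (fun z => conn G z a w)
        (((ContinuousLinearMap.apply ℝ (Euc d) w).comp
          (ContinuousLinearMap.apply ℝ (Euc d →L[ℝ] Euc d) a)).comp (fderiv ℝ (conn G) y)) y :=
      ((ContinuousLinearMap.apply ℝ (Euc d) w).comp
        (ContinuousLinearMap.apply ℝ (Euc d →L[ℝ] Euc d) a)).hasFDerivAt.comp y hd.hasFDerivAt
    have h3 : fderiv ℝ (fun z => christoffel G z a w) y = _ := h2.fderiv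
    rw [h3]
    rfl
  rw [curvature, curv, h1, h1]
  rfl

end Coordinates

namespace AlmostContactMetric

variable {m : ℕ} {N : Type*} [TopologicalSpace N]
  [ChartedSpace (Euc (2 * m + 1)) N] [IsManifold (𝓡 (2 * m + 1)) ∞ N]
  (S : AlmostContactMetric m N) {κ μ c : ℝ}

theorem φ_ξ (x : N) : S.φ x (S.ξ x) = 0 := by
  have h0 : S.φ x (S.φ x (S.ξ x)) = 0 := by
    rw [S.φ_sq, S.η_ξ, one_smul, neg_add_cancel]
  have h1 : S.φ x (S.ξ x) = S.η x (S.φ x (S.ξ x)) • S.ξ x := by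
    have := S.φ_sq x (S.φ x (S.ξ x))
    rw [h0, map_zero] at this
    exact (neg_add_eq_zero.mp this.symm)
  have h2 : S.η x (S.φ x (S.ξ x)) * S.η x (S.φ x (S.ξ x)) = 0 := by
    have h3 := congrArg (S.η x) h0
    rw [h1, map_smul, map_smul, smul_eq_mul, map_zero] at h3
    exact h3
  rw [h1, mul_self_eq_zero.mp h2, zero_smul]

/-- `η` is the 1-form dual to `ξ`. -/
theorem inner_ξ (x : N) (v : TangentSpace (𝓡 (2 * m + 1)) x) :
    S.g.inner x (S.ξ x) v = S.η x v := by
  rw [S.compatible, S.φ_ξ, S.η_ξ, map_zero]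
  simp

variable {x₀ : N} {y : Euc (2 * m + 1)}

theorem frame_φLoc (hy : y ∈ (extChartAt (𝓡 (2 * m + 1)) x₀).target) (v : Euc (2 * m + 1)) :
    frame x₀ y (S.φLoc x₀ y v) = S.φ (pt x₀ y) (frame x₀ y v) :=
  frame_coframe hy _

theorem frame_ξLoc (hy : y ∈ (extChartAt (𝓡 (2 * m + 1)) x₀).target) :
    frame x₀ y (S.ξLoc x₀ y) = S.ξ (pt x₀ y) :=
  frame_coframe hy _

theorem ηLoc_eq (hy : y ∈ (extChartAt (𝓡 (2 * m + 1)) x₀).target) :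
    S.ηLoc x₀ y = S.g.loc x₀ y (S.ξLoc x₀ y) := by
  ext v
  rw [Metric.loc_apply, S.frame_ξLoc hy, S.inner_ξ]
  rfl

theorem isAlmostContact_loc (hy : y ∈ (extChartAt (𝓡 (2 * m + 1)) x₀).target) :
    IsAlmostContact (S.g.loc x₀ y) (S.φLoc x₀ y) (S.ξLoc x₀ y) where
  symm := (isMetricOn_loc S.g x₀).symm y hy
  pos := (isMetricOn_loc S.g x₀).pos y hy
  φφ v := by
    have h1 : S.φLoc x₀ y (S.φLoc x₀ y v)
        = coframe x₀ y (S.φ (pt x₀ y) (frame x₀ y (S.φLoc x₀ y v))) := rfl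
    rw [h1, S.frame_φLoc hy, S.φ_sq, map_add, map_neg, map_smul, coframe_frame hy,
      ← S.ηLoc_eq hy]
    rfl
  norm := by
    rw [Metric.loc_apply, S.frame_ξLoc hy, S.inner_ξ, S.η_ξ]
  compat u v := by
    rw [← S.ηLoc_eq hy, Metric.loc_apply, Metric.loc_apply, S.frame_φLoc hy, S.frame_φLoc hy,
      S.compatible]
    rfl

theorem IsKappaMuContact.isKappaMuOn (hS : S.IsKappaMuContact κ μ) (x₀ : N) :
    IsKappaMuOn (S.g.loc x₀) (extChartAt (𝓡 (2 * m + 1)) x₀).target (S.φLoc x₀) (S.ξLoc x₀) κ μ where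
  metric := isMetricOn_loc S.g x₀
  smooth_φ := contDiffOn_endomorphism S.smooth_φ x₀
  smooth_ξ := contDiffOn_vectorField S.smooth_ξ x₀
  almost y hy := S.isAlmostContact_loc hy
  contact y hy u v := by
    have h1 : (fun z => S.g.loc x₀ z (S.ξLoc x₀ z)) =ᶠ[nhds y] S.ηLoc x₀ := by
      filter_upwards [(isOpen_extChartAt_target x₀).mem_nhds hy] with z hz
      rw [S.ηLoc_eq hz]
    rw [h1.fderiv_eq]
    exact hS.1 x₀ y hy u v
  nullity y hy u v := by
    have h1 := hS.2 x₀ y hy u v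
    rw [curvature_eq_curv (isMetricOn_loc S.g x₀) hy,
      (isMetricOn_loc S.g x₀).symm y hy u, (isMetricOn_loc S.g x₀).symm y hy v] at h1
    exact h1

theorem IsKappaMuSpaceForm.form_curv_φ (hS : S.IsKappaMuSpaceForm κ μ c)
    (hy : y ∈ (extChartAt (𝓡 (2 * m + 1)) x₀).target) (u : Euc (2 * m + 1))
    (hu : S.g.loc x₀ y u u = 1) (hξ : S.g.loc x₀ y (S.ξLoc x₀ y) u = 0) :
    S.g.loc x₀ y (curv (S.g.loc x₀) y u (S.φLoc x₀ y u) (S.φLoc x₀ y u)) u = c := by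
  rw [← curvature_eq_curv (isMetricOn_loc S.g x₀) hy]
  exact hS.2 x₀ y hy u hu (by rw [(isMetricOn_loc S.g x₀).symm y hy, hξ])

end AlmostContactMetric

/-! ### Coordinate expressions at the centre of a chart

At `p` the differential of the chart at `p` is the identity of `T_pN`, which is `Euc d` by definition.
The point `pt p (extChartAt (𝓡 d) p p)` equals `p`, but not definitionally; sections of the bundles are
therefore regarded as functions with values in fixed spaces before this equation is used. -/

section Centre

variable {d : ℕ} {N : Type*} [TopologicalSpace N] [ChartedSpace (Euc d) N]
  [IsManifold (𝓡 d) ∞ N] (p : N)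

theorem pt_centre : pt p (extChartAt (𝓡 d) p p) = p :=
  (extChartAt (𝓡 d) p).left_inv (mem_extChartAt_source p)

theorem frame_centre (v : Euc d) : (frame p (extChartAt (𝓡 d) p p) v : Euc d) = v := by
  rw [frame_eq]
  exact congrArg (fun A : Euc d →L[ℝ] Euc d => A v)
    (mfderivWithin_range_extChartAt_symm (I := 𝓡 d) (x := p))

theorem coframe_centre (v : Euc d) : (coframe p (extChartAt (𝓡 d) p p) v : Euc d) = v := by
  have := coframe_frame (mem_extChartAt_target (I := 𝓡 d) p) v
  conv_rhs => rw [← this]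
  exact congrArg (fun w : Euc d => coframe p (extChartAt (𝓡 d) p p) w) (frame_centre p v).symm

theorem loc_centre (g : Metric d N) (u v : TangentSpace (𝓡 d) p) :
    g.loc p (extChartAt (𝓡 d) p p) u v = g.inner p u v := by
  let g' : N → Euc d →L[ℝ] Euc d →L[ℝ] ℝ := fun q => g.inner q
  have h1 : g' (pt p (extChartAt (𝓡 d) p p)) = g' p := congrArg g' (pt_centre p)
  calc g.loc p (extChartAt (𝓡 d) p p) u v
      = g' (pt p (extChartAt (𝓡 d) p p)) (frame p (extChartAt (𝓡 d) p p) u)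
          (frame p (extChartAt (𝓡 d) p p) v) := rfl
    _ = g' p u v := by
        rw [h1]
        exact congrArg₂ (fun a b : Euc d => g' p a b) (frame_centre p u) (frame_centre p v)

end Centre

namespace AlmostContactMetric

variable {m : ℕ} {N : Type*} [TopologicalSpace N]
  [ChartedSpace (Euc (2 * m + 1)) N] [IsManifold (𝓡 (2 * m + 1)) ∞ N]
  (S : AlmostContactMetric m N) (p : N)

theorem φLoc_centre (v : TangentSpace (𝓡 (2 * m + 1)) p) :
    S.φLoc p (extChartAt (𝓡 (2 * m + 1)) p p) v = S.φ p v := by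
  let φ' : N → Euc (2 * m + 1) →L[ℝ] Euc (2 * m + 1) := fun q => S.φ q
  have h1 : φ' (pt p (extChartAt (𝓡 (2 * m + 1)) p p)) = φ' p := congrArg φ' (pt_centre p)
  calc S.φLoc p (extChartAt (𝓡 (2 * m + 1)) p p) v
      = coframe p (extChartAt (𝓡 (2 * m + 1)) p p) (φ' (pt p (extChartAt (𝓡 (2 * m + 1)) p p))
          (frame p (extChartAt (𝓡 (2 * m + 1)) p p) v)) := rfl
    _ = φ' p v := by
        rw [coframe_centre, h1]
        exact congrArg (fun a : Euc (2 * m + 1) => φ' p a) (frame_centre p v)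

theorem ξLoc_centre : S.ξLoc p (extChartAt (𝓡 (2 * m + 1)) p p) = S.ξ p := by
  let ξ' : N → Euc (2 * m + 1) := fun q => S.ξ q
  have h1 : ξ' (pt p (extChartAt (𝓡 (2 * m + 1)) p p)) = ξ' p := congrArg ξ' (pt_centre p)
  exact (coframe_centre p _).trans h1

end AlmostContactMetric

/-! ### Submanifolds in charts -/

namespace Submanifold

variable {m : ℕ} {N : Type*} [TopologicalSpace N]
  [ChartedSpace (Euc (2 * m + 1)) N] [IsManifold (𝓡 (2 * m + 1)) ∞ N]
  {S : AlmostContactMetric m N} {n : ℕ} {M : Type*} [TopologicalSpace M]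
  [ChartedSpace (Euc n) M] [IsManifold (𝓡 n) ∞ M] (F : Submanifold S n M) (p : M)

/-- The coordinates in the chart at `p` of the points that `f` maps into the domain of the chart at
`f p`. -/
def domain : Set (Euc n) :=
  (extChartAt (𝓡 n) p).target ∩
    (extChartAt (𝓡 n) p).symm ⁻¹' (F.f ⁻¹' (extChartAt (𝓡 (2 * m + 1)) (F.f p)).source)

theorem isOpen_domain : IsOpen (F.domain p) :=
  (continuousOn_extChartAt_symm p).isOpen_inter_preimage (isOpen_extChartAt_target p)
    ((isOpen_extChartAt_source (F.f p)).preimage F.smooth.continuous)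

theorem centre_mem_domain : extChartAt (𝓡 n) p p ∈ F.domain p := by
  refine ⟨mem_extChartAt_target p, ?_⟩
  simp

variable {p} {z : Euc n}

theorem fLoc_mem (hz : z ∈ F.domain p) :
    F.fLoc p z ∈ (extChartAt (𝓡 (2 * m + 1)) (F.f p)).target :=
  (extChartAt (𝓡 (2 * m + 1)) (F.f p)).map_source hz.2

theorem pt_fLoc (hz : z ∈ F.domain p) : pt (F.f p) (F.fLoc p z) = F.f (pt p z) :=
  (extChartAt (𝓡 (2 * m + 1)) (F.f p)).left_inv hz.2

theorem contDiffOn_fLoc : ContDiffOn ℝ ∞ (F.fLoc p) (F.domain p) := by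
  refine contMDiffOn_iff_contDiffOn.mp ?_
  have h1 : ContMDiffOn 𝓘(ℝ, Euc n) (𝓡 (2 * m + 1)) ∞ (fun z => F.f (pt p z)) (F.domain p) :=
    F.smooth.comp_contMDiffOn ((contMDiffOn_pt p).mono Set.inter_subset_left)
  exact (contMDiffOn_extChartAt (n := ∞) (x := F.f p)).comp h1 fun z hz => by
    rw [← extChartAt_source (𝓡 (2 * m + 1))]
    exact hz.2

/-- The chain rule: `d f` in coordinates. -/
theorem frame_fderiv_fLoc (hz : z ∈ F.domain p) (u : Euc n) :
    (frame (F.f p) (F.fLoc p z) (fderiv ℝ (F.fLoc p) z u) : Euc (2 * m + 1)) =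
      F.df (pt p z) (frame p z u) := by
  have hd1 : MDifferentiableAt 𝓘(ℝ, Euc n) 𝓘(ℝ, Euc (2 * m + 1)) (F.fLoc p) z :=
    ((F.contDiffOn_fLoc.contDiffAt ((F.isOpen_domain p).mem_nhds hz)).differentiableAt
      (by simp)).mdifferentiableAt
  have hd2 : MDifferentiableAt 𝓘(ℝ, Euc (2 * m + 1)) (𝓡 (2 * m + 1)) (pt (F.f p)) (F.fLoc p z) :=
    ((contMDiffOn_pt (F.f p)).contMDiffAt
      ((isOpen_extChartAt_target (F.f p)).mem_nhds (F.fLoc_mem hz))).mdifferentiableAt (by simp)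
  have hd3 : MDifferentiableAt 𝓘(ℝ, Euc n) (𝓡 n) (pt p) z :=
    ((contMDiffOn_pt p).contMDiffAt
      ((isOpen_extChartAt_target p).mem_nhds hz.1)).mdifferentiableAt (by simp)
  have hd4 : MDifferentiableAt (𝓡 n) (𝓡 (2 * m + 1)) F.f (pt p z) :=
    F.smooth.mdifferentiableAt (by simp)
  have hev : (pt (F.f p)) ∘ (F.fLoc p) =ᶠ[nhds z] F.f ∘ (pt p) := by
    filter_upwards [(F.isOpen_domain p).mem_nhds hz] with w hw
    exact F.pt_fLoc hw
  have h1 := mfderiv_comp z hd2 hd1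
  have h2 := mfderiv_comp z hd4 hd3
  have h3 := hev.mfderiv_eq (I := 𝓘(ℝ, Euc n)) (I' := 𝓡 (2 * m + 1))
  rw [mfderiv_eq_fderiv] at h1
  have h1' : (mfderiv 𝓘(ℝ, Euc n) (𝓡 (2 * m + 1)) ((pt (F.f p)) ∘ (F.fLoc p)) z u :
      Euc (2 * m + 1)) = frame (F.f p) (F.fLoc p z) (fderiv ℝ (F.fLoc p) z u) := by
    rw [h1]
    rfl
  have h2' : (mfderiv 𝓘(ℝ, Euc n) (𝓡 (2 * m + 1)) (F.f ∘ (pt p)) z u :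
      Euc (2 * m + 1)) = F.df (pt p z) (frame p z u) := by
    rw [h2]
    rfl
  rw [← h1', ← h2']
  exact congrArg (fun A : Euc n →L[ℝ] Euc (2 * m + 1) => A u) h3

/-- The immersion, in the charts at `p` and `f p`, is isometric. -/
theorem isIsometricOn : IsIsometricOn (S.g.loc (F.f p))
    (extChartAt (𝓡 (2 * m + 1)) (F.f p)).target (F.g.loc p) (F.domain p) (F.fLoc p) where
  target := isMetricOn_loc S.g (F.f p)
  source :=
    { isOpen := F.isOpen_domain p
      smooth := (isMetricOn_loc F.g p).smooth.mono Set.inter_subset_left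
      symm := fun y hy => (isMetricOn_loc F.g p).symm y hy.1
      pos := fun y hy => (isMetricOn_loc F.g p).pos y hy.1 }
  smooth := F.contDiffOn_fLoc
  mapsTo _ hz := F.fLoc_mem hz
  isometric z hz u v := by
    let g' : N → Euc (2 * m + 1) →L[ℝ] Euc (2 * m + 1) →L[ℝ] ℝ := fun q => S.g.inner q
    have h1 : g' (pt (F.f p) (F.fLoc p z)) = g' (F.f (pt p z)) := congrArg g' (F.pt_fLoc hz)
    rw [Metric.loc_apply F.g, ← F.isometric]
    have h2 := F.frame_fderiv_fLoc hz u
    have h3 := F.frame_fderiv_fLoc hz v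
    calc _ = g' (pt (F.f p) (F.fLoc p z)) (frame (F.f p) (F.fLoc p z) (fderiv ℝ (F.fLoc p) z u))
          (frame (F.f p) (F.fLoc p z) (fderiv ℝ (F.fLoc p) z v)) := rfl
      _ = g' (F.f (pt p z)) (F.df (pt p z) (frame p z u)) (F.df (pt p z) (frame p z v)) := by
        rw [h1]
        exact congrArg₂ (fun a b : Euc (2 * m + 1) => g' (F.f (pt p z)) a b) h2 h3
      _ = _ := rfl

/-- `ξ` is tangent to the submanifold, in coordinates. -/
theorem exists_fderiv_fLoc_eq_ξLoc (hz : z ∈ F.domain p) :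
    ∃ v, fderiv ℝ (F.fLoc p) z v = S.ξLoc (F.f p) (F.fLoc p z) := by
  obtain ⟨v, hv⟩ := F.ξ_tangent (pt p z)
  let ξ' : N → Euc (2 * m + 1) := fun q => S.ξ q
  have h1 : ξ' (pt (F.f p) (F.fLoc p z)) = ξ' (F.f (pt p z)) := congrArg ξ' (F.pt_fLoc hz)
  refine ⟨coframe p z v, ?_⟩
  rw [← coframe_frame (F.fLoc_mem hz) (fderiv ℝ (F.fLoc p) z (coframe p z v))]
  refine congrArg (fun w : Euc (2 * m + 1) => coframe (F.f p) (F.fLoc p z) w) ?_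
  refine (F.frame_fderiv_fLoc hz _).trans ?_
  rw [frame_coframe hz.1]
  exact (show (F.df (pt p z) v : Euc (2 * m + 1)) = ξ' (F.f (pt p z)) from hv).trans h1.symm

variable (p)

theorem fLoc_centre : F.fLoc p (extChartAt (𝓡 n) p p)
    = extChartAt (𝓡 (2 * m + 1)) (F.f p) (F.f p) := by
  rw [fLoc, (extChartAt (𝓡 n) p).left_inv (mem_extChartAt_source p)]

/-- The differential of `f` at `p` is by definition the derivative of `f` in the charts at `p`, `f p`. -/
theorem fderiv_fLoc_centre (v : Euc n) :
    fderiv ℝ (F.fLoc p) (extChartAt (𝓡 n) p p) v = F.df p v := by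
  have h1 := (F.smooth.mdifferentiable (by simp) p).mfderiv
  have h2 : fderivWithin ℝ (writtenInExtChartAt (𝓡 n) (𝓡 (2 * m + 1)) p F.f) (Set.range (𝓡 n))
      (extChartAt (𝓡 n) p p) = fderiv ℝ (F.fLoc p) (extChartAt (𝓡 n) p p) := by
    rw [ModelWithCorners.range_eq_univ, fderivWithin_univ]
    rfl
  exact congrArg (fun A : Euc n →L[ℝ] Euc (2 * m + 1) => A v) (h1.trans h2).symm

/-- The metric of the ambient space at `f p`, in coordinates. -/
theorem loc_fLoc_centre (u v : Euc (2 * m + 1)) :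
    S.g.loc (F.f p) (F.fLoc p (extChartAt (𝓡 n) p p)) u v = S.g.inner (F.f p) u v := by
  rw [F.fLoc_centre]
  exact loc_centre _ _ _ _

theorem σ_eq (u v : Euc n) : F.σ p u v =
    sffL (S.g.loc (F.f p)) (F.g.loc p) (F.fLoc p) (extChartAt (𝓡 n) p p) u v := by
  rw [F.isIsometricOn.sffL_apply (F.centre_mem_domain p)]
  rfl

/-- `tangential` is the adjoint of `df`. -/
theorem inner_tangential (v : TangentSpace (𝓡 n) p)
    (w : TangentSpace (𝓡 (2 * m + 1)) (F.f p)) :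
    F.g.inner p v (F.tangential p w) = S.g.inner (F.f p) (F.df p v) w := by
  rw [F.g.symm, S.g.symm]
  let b : Euc n →L[ℝ] Euc n →L[ℝ] ℝ := F.g.inner p
  exact congrArg (fun l : Euc n →L[ℝ] ℝ => l v)
    (apply_inverse_of_pos b (F.g.pos p) ((S.g.inner (F.f p) w).comp (F.df p)))

end Submanifold

/-! ### The invariants in coordinates -/

namespace Submanifold

variable {m : ℕ} {N : Type*} [TopologicalSpace N]
  [ChartedSpace (Euc (2 * m + 1)) N] [IsManifold (𝓡 (2 * m + 1)) ∞ N]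
  {S : AlmostContactMetric m N} {n : ℕ} {M : Type*} [TopologicalSpace M]
  [ChartedSpace (Euc n) M] [IsManifold (𝓡 n) ∞ M] (F : Submanifold S n M) (p : M)

theorem orthonormal_iff {k : ℕ} (e : Fin k → Euc n) :
    F.g.Orthonormal p e ↔ IsON (F.g.loc p (extChartAt (𝓡 n) p p)) e :=
  forall_congr' fun i => forall_congr' fun j =>
    have h := loc_centre p F.g (e i) (e j)
    ⟨fun h' => h.trans h', fun h' => h.symm.trans h'⟩

theorem orthonormal_normal_iff {k : ℕ} (ν : Fin k → Euc (2 * m + 1)) :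
    S.g.Orthonormal (F.f p) ν ↔ IsON (S.g.loc (F.f p) (F.fLoc p (extChartAt (𝓡 n) p p))) ν :=
  forall_congr' fun i => forall_congr' fun j => by
    rw [← F.loc_fLoc_centre]

theorem isNormalFrame_iff (ν : Fin (2 * m + 1 - n) → Euc (2 * m + 1)) :
    F.IsNormalFrame p ν ↔ IsON (S.g.loc (F.f p) (F.fLoc p (extChartAt (𝓡 n) p p))) ν ∧
      ∀ r v, S.g.loc (F.f p) (F.fLoc p (extChartAt (𝓡 n) p p)) (ν r)
        (fderiv ℝ (F.fLoc p) (extChartAt (𝓡 n) p p) v) = 0 := by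
  refine and_congr (F.orthonormal_normal_iff p ν) (forall_congr' fun r => forall_congr' fun v => ?_)
  have h := F.loc_fLoc_centre p (ν r) (fderiv ℝ (F.fLoc p) (extChartAt (𝓡 n) p p) v)
  have h' := h.trans (congrArg (fun w : Euc (2 * m + 1) => S.g.inner (F.f p) (ν r) w)
    (F.fderiv_fLoc_centre p v))
  exact ⟨fun h0 => h'.trans h0, fun h0 => h'.symm.trans h0⟩

theorem K_eq (u v : Euc n) : F.g.K p u v = F.g.loc p (extChartAt (𝓡 n) p p)
    (curv (F.g.loc p) (extChartAt (𝓡 n) p p) u v v) u := by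
  rw [← curvature_eq_curv (isMetricOn_loc F.g p) (mem_extChartAt_target p)]
  rfl

theorem opMatrix_P_apply {k : ℕ} (e : Fin k → Euc n) (i j : Fin k) :
    F.opMatrix p (F.P p) e i j =
      S.g.loc (F.f p) (F.fLoc p (extChartAt (𝓡 n) p p))
        (fderiv ℝ (F.fLoc p) (extChartAt (𝓡 n) p p) (e i))
        (S.φLoc (F.f p) (F.fLoc p (extChartAt (𝓡 n) p p))
          (fderiv ℝ (F.fLoc p) (extChartAt (𝓡 n) p p) (e j))) := by
  rw [F.loc_fLoc_centre, F.fLoc_centre, fderiv_fLoc_centre, fderiv_fLoc_centre]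
  refine (F.inner_tangential p _ _).trans ?_
  exact congrArg (fun w : Euc (2 * m + 1) => S.g.inner (F.f p) (F.df p (e i)) w)
    (S.φLoc_centre (F.f p) _).symm

theorem opMatrix_hT_apply {k : ℕ} (e : Fin k → Euc n) (i j : Fin k) :
    F.opMatrix p (F.hT p) e i j =
      S.g.loc (F.f p) (F.fLoc p (extChartAt (𝓡 n) p p))
        (fderiv ℝ (F.fLoc p) (extChartAt (𝓡 n) p p) (e i))
        (lieHalf (S.φLoc (F.f p)) (S.ξLoc (F.f p)) (F.fLoc p (extChartAt (𝓡 n) p p))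
          (fderiv ℝ (F.fLoc p) (extChartAt (𝓡 n) p p) (e j))) := by
  rw [F.loc_fLoc_centre, F.fLoc_centre, fderiv_fLoc_centre, fderiv_fLoc_centre]
  exact F.inner_tangential p _ _

theorem opMatrix_φhT_apply {k : ℕ} (e : Fin k → Euc n) (i j : Fin k) :
    F.opMatrix p (F.φhT p) e i j =
      S.g.loc (F.f p) (F.fLoc p (extChartAt (𝓡 n) p p))
        (fderiv ℝ (F.fLoc p) (extChartAt (𝓡 n) p p) (e i))
        (S.φLoc (F.f p) (F.fLoc p (extChartAt (𝓡 n) p p))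
          (lieHalf (S.φLoc (F.f p)) (S.ξLoc (F.f p)) (F.fLoc p (extChartAt (𝓡 n) p p))
          (fderiv ℝ (F.fLoc p) (extChartAt (𝓡 n) p p) (e j)))) := by
  rw [F.loc_fLoc_centre, F.fLoc_centre, fderiv_fLoc_centre, fderiv_fLoc_centre]
  refine (F.inner_tangential p _ _).trans ?_
  exact congrArg (fun w : Euc (2 * m + 1) => S.g.inner (F.f p) (F.df p (e i)) w)
    (S.φLoc_centre (F.f p) _).symm

theorem meanCurvatureSq_eq (e : Fin n → Euc n) :
    F.meanCurvatureSq p e = (1 / (n : ℝ)) ^ 2 *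
      S.g.loc (F.f p) (F.fLoc p (extChartAt (𝓡 n) p p))
        (∑ i, sffL (S.g.loc (F.f p)) (F.g.loc p) (F.fLoc p) (extChartAt (𝓡 n) p p) (e i) (e i))
        (∑ i, sffL (S.g.loc (F.f p)) (F.g.loc p) (F.fLoc p) (extChartAt (𝓡 n) p p) (e i) (e i)) := by
  simp only [← σ_eq]
  rw [F.loc_fLoc_centre]
  simp only [meanCurvatureSq, meanCurvature]
  rw [map_smul, map_smul, smul_apply, smul_eq_mul, smul_eq_mul, pow_two, mul_assoc]
  rfl

theorem shapeMatrix_eq (e : Fin n → Euc n) (ν : Euc (2 * m + 1)) :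
    F.shapeMatrix p e ν = Matrix.of fun i j =>
      S.g.loc (F.f p) (F.fLoc p (extChartAt (𝓡 n) p p))
        (sffL (S.g.loc (F.f p)) (F.g.loc p) (F.fLoc p) (extChartAt (𝓡 n) p p) (e i) (e j)) ν := by
  ext i j
  rw [Matrix.of_apply, F.loc_fLoc_centre, ← σ_eq]
  rfl

theorem ξLoc_fLoc_centre :
    S.ξLoc (F.f p) (F.fLoc p (extChartAt (𝓡 n) p p)) = S.ξ (F.f p) := by
  rw [F.fLoc_centre]
  exact S.ξLoc_centre _

/-- The tangent vector `ζ` of `M` with `df ζ = ξ` is dual to the restriction of `η`. -/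
theorem form_ζ {ζ : Euc n} (hζ : fderiv ℝ (F.fLoc p) (extChartAt (𝓡 n) p p) ζ =
    S.ξLoc (F.f p) (F.fLoc p (extChartAt (𝓡 n) p p))) (v : Euc n) :
    F.g.loc p (extChartAt (𝓡 n) p p) v ζ = S.η (F.f p) (F.df p v) := by
  rw [← F.isIsometricOn.isometric _ (F.centre_mem_domain p), hζ, F.fderiv_fLoc_centre]
  refine (F.loc_fLoc_centre p _ _).trans ((S.g.symm _ _ _).trans ?_)
  refine (congrArg (fun w : Euc (2 * m + 1) => S.g.inner (F.f p) w (F.df p v))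
    (F.ξLoc_fLoc_centre p)).trans (S.inner_ξ _ _)

/-- The difference of the two sides of the inequality is the defect of the second fundamental form. -/
theorem scalar_sub_K_eq {κ μ c : ℝ} (hn : 3 ≤ n) (hS : S.IsKappaMuSpaceForm κ μ c)
    (e : Fin n → Euc n) (he : F.g.Orthonormal p e)
    (u : Fin 2 → Euc n) (hu : F.g.Orthonormal p u) (huη : ∀ l, S.η (F.f p) (F.df p (u l)) = 0) :
    F.g.scalar p e - F.g.K p (u 0) (u 1) =
      (n : ℝ) ^ 2 * ((n : ℝ) - 2) / (2 * ((n : ℝ) - 1)) * F.meanCurvatureSq p e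
        + 1 / 8 * (n : ℝ) * (c + 3) * ((n : ℝ) - 3) + ((n : ℝ) - 1) * κ
        + 3 * (c - 1) / 8 * (F.opNormSq p (F.P p) e - 2 * F.opMatrix p (F.P p) u 0 1 ^ 2)
        + (μ + (n : ℝ) - 2) * (F.opMatrix p (F.hT p) e).trace
        - 1 / 2 * (2 * (F.opMatrix p (F.hT p) u).trace + (F.opMatrix p (F.hT p) u).det
            - (F.opMatrix p (F.φhT p) u).det)
        + 1 / 4 * (F.opNormSq p (F.φhT p) e - F.opNormSq p (F.hT p) e
            - (F.opMatrix p (F.φhT p) e).trace ^ 2 + (F.opMatrix p (F.hT p) e).trace ^ 2)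
        - defect (S.g.loc (F.f p) (F.fLoc p (extChartAt (𝓡 n) p p)))
          (sffL (S.g.loc (F.f p)) (F.g.loc p) (F.fLoc p) (extChartAt (𝓡 n) p p)) e (u 0) (u 1) := by
  have hn3 : (3 : ℝ) ≤ n := by exact_mod_cast hn
  have hn1 : (n : ℝ) - 1 ≠ 0 := by linarith
  have hn0 : (n : ℝ) ≠ 0 := by linarith
  have hy := F.centre_mem_domain p
  obtain ⟨ζ, hζ⟩ := F.exists_fderiv_fLoc_eq_ξLoc hy
  have key := F.isIsometricOn.scalar_sub_sectional_eq hy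
    (AlmostContactMetric.IsKappaMuContact.isKappaMuOn S hS.1 (F.f p))
    (AlmostContactMetric.IsKappaMuSpaceForm.form_curv_φ S hS (F.fLoc_mem hy))
    finrank_euclideanSpace_fin hn1 hζ ((F.orthonormal_iff p e).mp he)
    ((F.orthonormal_iff p u).mp hu) (fun l => (F.form_ζ p hζ (u l)).trans (huη l))
    (fun _ _ => rfl) (fun _ _ => rfl) (fun _ _ => rfl)
  simp only [← F.K_eq] at key
  simp only [opNormSq, Matrix.trace, Matrix.diag_apply, Matrix.det_fin_two, Fin.sum_univ_two,
    F.opMatrix_P_apply, F.opMatrix_hT_apply, F.opMatrix_φhT_apply, F.meanCurvatureSq_eq]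
  refine key.trans ?_
  field_simp

end Submanifold

end ContactGeometry

end

set_option maxSynthPendingDepth 3

theorem theorem3p2 {m n : ℕ} (hn : 3 ≤ n)
    {N : Type*} [TopologicalSpace N] [ChartedSpace (Euc (2 * m + 1)) N]
    [IsManifold (𝓡 (2 * m + 1)) ∞ N]
    {M : Type*} [TopologicalSpace M] [ChartedSpace (Euc n) M] [IsManifold (𝓡 n) ∞ M]
    (S : AlmostContactMetric m N) (κ μ c : ℝ) (hS : S.IsKappaMuSpaceForm κ μ c)
    (F : Submanifold S n M) (p : M)
    -- an orthonormal basis of `T_pM`, with which the invariants are computed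
    (e : Fin n → TangentSpace (𝓡 n) p) (he : F.g.Orthonormal p e)
    -- a plane section `Pl ⊆ 𝒟_p` and an orthonormal basis of it
    (Pl : Submodule ℝ (TangentSpace (𝓡 n) p)) (hPl : ∀ v ∈ Pl, S.η (F.f p) (F.df p v) = 0)
    (u : Fin 2 → TangentSpace (𝓡 n) p) (hu : F.g.Orthonormal p u)
    (huPl : Submodule.span ℝ (Set.range u) = Pl) :
    let lhs : ℝ := F.g.scalar p e - F.g.K p (u 0) (u 1)
    let α : ℝ := (F.g.inner p (u 0) (F.P p (u 1))) ^ 2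
    let rhs : ℝ :=
      (n : ℝ) ^ 2 * ((n : ℝ) - 2) / (2 * ((n : ℝ) - 1)) * F.meanCurvatureSq p e
        + 1 / 8 * (n : ℝ) * (c + 3) * ((n : ℝ) - 3) + ((n : ℝ) - 1) * κ
        + 3 * (c - 1) / 8 * (F.opNormSq p (F.P p) e - 2 * α)
        + (μ + (n : ℝ) - 2) * (F.opMatrix p (F.hT p) e).trace
        - 1 / 2 * (2 * (F.opMatrix p (F.hT p) u).trace + (F.opMatrix p (F.hT p) u).det
            - (F.opMatrix p (F.φhT p) u).det)
        + 1 / 4 * (F.opNormSq p (F.φhT p) e - F.opNormSq p (F.hT p) e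
            - (F.opMatrix p (F.φhT p) e).trace ^ 2 + (F.opMatrix p (F.hT p) e).trace ^ 2)
    lhs ≤ rhs ∧
      (lhs = rhs ↔
        ∃ (b : Fin n → TangentSpace (𝓡 n) p)
          (ν : Fin (2 * m + 1 - n) → TangentSpace (𝓡 (2 * m + 1)) (F.f p)),
          F.g.Orthonormal p b ∧ F.IsNormalFrame p ν ∧
          F.df p (b ⟨n - 1, by omega⟩) = S.ξ (F.f p) ∧
          Pl = Submodule.span ℝ {b ⟨0, by omega⟩, b ⟨1, by omega⟩} ∧
          (∀ r, r.val = 0 → ∃ a : ℝ, F.shapeMatrix p b (ν r) = blockMatrix n a 0) ∧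
          (∀ r, 0 < r.val → ∃ c' d' : ℝ, F.shapeMatrix p b (ν r) = blockMatrix n c' d')) := by
  intro lhs α rhs
  have hn3 : (3 : ℝ) ≤ n := by exact_mod_cast hn
  have hfr : Module.finrank ℝ (Euc n) = n := finrank_euclideanSpace_fin
  have hfr' : Module.finrank ℝ (Euc (2 * m + 1)) = 2 * m + 1 := finrank_euclideanSpace_fin
  have huη : ∀ l, S.η (F.f p) (F.df p (u l)) = 0 := fun l =>
    hPl _ (huPl ▸ Submodule.subset_span ⟨l, rfl⟩)
  have hI := F.isIsometricOn (p := p)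
  have hy := F.centre_mem_domain p
  have hK := AlmostContactMetric.IsKappaMuContact.isKappaMuOn S hS.1 (F.f p)
  have hfy := hI.mapsTo hy
  obtain ⟨ζ, hζ⟩ := F.exists_fderiv_fLoc_eq_ξLoc hy
  have hζ1 : F.g.loc p (extChartAt (𝓡 n) p p) ζ ζ = 1 := by
    rw [← hI.isometric _ hy, hζ, (hK.almost _ hfy).norm]
  have hss : ∀ x z, sffL (S.g.loc (F.f p)) (F.g.loc p) (F.fLoc p) (extChartAt (𝓡 n) p p) x z
      = sffL (S.g.loc (F.f p)) (F.g.loc p) (F.fLoc p) (extChartAt (𝓡 n) p p) z x := fun x z => by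
    rw [hI.sffL_apply hy, hI.sffL_apply hy, hI.sff_symm hy]
  have hdef := defect_nonneg_and_eq_zero_iff hn hfr hfr' (hI.source.symm _ hy)
    (hI.source.pos _ hy) (hI.target.symm _ hfy) (hI.target.pos _ hfy) (hI.isometric _ hy) hss
    (fun x z v => by rw [hI.sffL_apply hy, hI.form_sff_fderiv hy]) hζ1
    (hI.sffL_structure_eq_zero hy hK (fun z hz => F.exists_fderiv_fLoc_eq_ξLoc hz) hζ)
    ((F.orthonormal_iff p e).mp he) ((F.orthonormal_iff p u).mp hu)
    (fun l => (F.form_ζ p hζ (u l)).trans (huη l))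
  have hmain := F.scalar_sub_K_eq p hn hS e he u hu huη
  obtain ⟨hd0, hd1⟩ := hdef
  have hmain' : lhs = rhs - _ := hmain
  refine ⟨by linarith, ?_⟩
  rw [hmain', sub_eq_self, hd1]
  -- `df` is injective, so that `df (b (n - 1)) = ξ` says that `b (n - 1) = ζ`
  have hinj : ∀ x : Euc n, fderiv ℝ (F.fLoc p) (extChartAt (𝓡 n) p p) x =
      fderiv ℝ (F.fLoc p) (extChartAt (𝓡 n) p p) ζ → x = ζ := fun x hx =>
    eq_of_form_eq (hI.source.pos _ hy) fun z => by
      rw [← hI.isometric _ hy, ← hI.isometric _ hy, hx]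
  refine exists_congr fun b => exists_congr fun ν => ?_
  refine (and_congr (F.orthonormal_iff p b).symm ?_)
  rw [← and_assoc]
  refine and_congr (F.isNormalFrame_iff p ν).symm (and_congr ?_ (and_congr ?_ (and_congr ?_ ?_)))
  · constructor
    · intro h
      rw [h]
      exact (F.fderiv_fLoc_centre p ζ).symm.trans (hζ.trans (F.ξLoc_fLoc_centre p))
    · intro h
      refine hinj _ ?_
      rw [hζ]
      exact (F.fderiv_fLoc_centre p _).trans (h.trans (F.ξLoc_fLoc_centre p).symm)
  · rw [← huPl]
    exact Iff.rfl
  · refine forall_congr' fun r => forall_congr' fun _ => exists_congr fun a => ?_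
    rw [← F.shapeMatrix_eq]
  · refine forall_congr' fun r => forall_congr' fun _ => exists_congr fun c' =>
      exists_congr fun d' => ?_
    rw [← F.shapeMatrix_eq]
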